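/- Let $G$ be a finite group, $M$ a smooth $G$-manifold without boundary, and $X$ a based $G$-space whose basepoint $*$ is $G$-fixed and non-degenerate (there is a $G$-equivariant retraction of $X\times[0,1]$ onto $X\times\{0\}\cup\{*\}\times[0,1]$). For a based $G$-space $Y$ let $C_M(Y)$ be the space of finite subsets of $M$ that are closed under $G$ and equivariantly labelled in $Y$, where points labelled by the basepoint may be deleted, with the quotient topology from ordered labelled configurations in $(M\times Y)^r$, $r\ge 0$; its basepoint is the empty configuration. Let $SX$ be the reduced suspension of $X$ ($G$ acting trivially on the suspension coordinate). Let $C$ be the strictly associative model of $C_{M\times\mathbb R}(X)$: a point of $C$ is a length $s\ge 0$ together with a finite $G$-closed set of pairwise disjoint closed discs $d=\{c'(d)\}\times[c''(d)-\varepsilon(d),\,c''(d)+\varepsilon(d)]\subset M\times(0,s)$, $\varepsilon(d)>0$, equivariantly labelled in $X$, where discs labelled by $*$ may be deleted ($C$ has the quotient topology from ordered collections of discs); addition juxtaposes the intervals $(0,s)$ and $(0,s')$ to $(0,s+s')$. Let $BC_{M\times\mathbb R}(X):=BC$ be the geometric realization of the nerve of $C$: the quotient of $\coprod_n C^n\times\Delta_n$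 by the face and degeneracy identifications, the faces of an $n$-tuple omitting the first or the last entry or adding two adjacent entries. Let $\Delta_n$ have vertices $v_0,\dots,v_n$ and let $\theta(t)=\frac2\pi\arctan(1+t)$. Given $s_1,\dots,s_n\ge0$, put, for $1\le k\le n$, $t\in(0,s_k)$, $u=\sum_{i<k}\lambda_iv_i$ and $v=\sum_{j\ge k}\mu_jv_j$ (with $\lambda_i,\mu_j\ge0$, $\sum\lambda_i=\sum\mu_j=1$), $$S_k(t,u,v)=\sum_{0\le i<k\le j\le n}\lambda_i\mu_j\bigl((1-u_{i,k})v_i+u_{i,k}v_j\bigr),\qquad u_{i,k}=\theta(s_{i+1}+\cdots+s_{k-1}+t).$$ Then there is a well-defined continuous map $q\colon BC_{M\times\mathbb R}(X)\to C_M(SX)$ given as follows, and $q$ is a homotopy equivalence. Let $b=[p;c_1,\dots,c_n]$ with $p\in\Delta_n$ and $c_k\in C$ of length $s_k$. If $p=S_k(t,u,v)$ for some $k$, $t$, $u$, $v$ as above, then $q(b)$ consists of the points $c'(d)$ for the discs $d$ of $c_k$ with $|t-c''(d)|\le\varepsilon(d)$, where $c'(d)$ is labelled by the point of $SX$ whose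 $X$-coordinate is the label of $d$ and whose suspension coordinate is $\frac{1}{2\varepsilon(d)}(t+\varepsilon(d)-c''(d))$. If $p$ is in the image of no $S_k$, then $q(b)$ is the empty configuration. In particular, $BC_{M\times\mathbb R}(X)$ is homotopy equivalent to $C_M(SX)$. -/

import Mathlib

open Set
open scoped Manifold ContDiff unitInterval

namespace EquivConf

/-! ### Based spaces with group action -/

/-- A space with a chosen basepoint. -/
class BasedSpace (X : Type*) where
  /-- the basepoint -/
  pt : X

/-- A based `G`-space (for a discrete group `G`): every element of `G` acts by a continuous map, and
the basepoint is fixed. -/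
class BasedGSpace (G X : Type*) [Group G] [TopologicalSpace X] [BasedSpace X] [MulAction G X] : Prop
    extends ContinuousConstSMul G X where
  smul_pt : ∀ g : G, g • (BasedSpace.pt : X) = BasedSpace.pt

/-- The basepoint of `X` is non-degenerate: there is a `G`-equivariant retraction of `X × I` onto
`X × {0} ∪ {*} × I` (with `G` acting trivially on `I = [0,1]`). -/
def NondegenerateBasepoint (G X : Type*) [Group G] [TopologicalSpace X] [BasedSpace X]
    [MulAction G X] : Prop :=
  ∃ r : C(X × I, X × I),
    (∀ p, (r p).2 = 0 ∨ (r p).1 = BasedSpace.pt) ∧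
    (∀ p : X × I, p.2 = 0 ∨ p.1 = BasedSpace.pt → r p = p) ∧
    (∀ (g : G) (x : X) (t : I), r (g • x, t) = (g • (r (x, t)).1, (r (x, t)).2))

section

variable {G X : Type*} [Group G] [TopologicalSpace X] [BasedSpace X] [MulAction G X]
  [BasedGSpace G X]

theorem smul_ne_pt (g : G) {x : X} (hx : x ≠ BasedSpace.pt) : g • x ≠ BasedSpace.pt := by
  intro h
  apply hx
  have h2 := congrArg (fun y => g⁻¹ • y) h
  simpa [BasedGSpace.smul_pt] using h2

end

/-! ### The reduced suspension -/

/-- The subspace of `I × X` that is collapsed to the basepoint of the reduced suspension. -/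
def suspBase (X : Type*) [BasedSpace X] : Set (I × X) :=
  {p | p.1 = 0 ∨ p.1 = 1 ∨ p.2 = BasedSpace.pt}

/-- The equivalence relation on `I × X` collapsing `{0,1} × X ∪ I × {*}` to a point. -/
def suspSetoid (X : Type*) [BasedSpace X] : Setoid (I × X) where
  r a b := a = b ∨ (a ∈ suspBase X ∧ b ∈ suspBase X)
  iseqv := by
    refine ⟨fun a => Or.inl rfl, ?_, ?_⟩
    · rintro a b (h | h)
      · exact Or.inl h.symm
      · exact Or.inr h.symm
    · rintro a b c (rfl | h) (rfl | h')
      · exact Or.inl rfl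
      · exact Or.inr h'
      · exact Or.inr h
      · exact Or.inr ⟨h.1, h'.2⟩

/-- The reduced suspension `SX = S¹ ∧ X`. -/
def Susp (X : Type*) [BasedSpace X] : Type _ := Quotient (suspSetoid X)

/-- The point of `SX` with suspension coordinate `a` and `X`-coordinate `x`. -/
def Susp.mk {X : Type*} [BasedSpace X] (a : I) (x : X) : Susp X :=
  Quotient.mk (suspSetoid X) (a, x)

instance {X : Type*} [TopologicalSpace X] [BasedSpace X] : TopologicalSpace (Susp X) :=
  inferInstanceAs (TopologicalSpace (Quotient (suspSetoid X)))

instance {X : Type*} [BasedSpace X] : BasedSpace (Susp X) := ⟨Susp.mk 0 BasedSpace.pt⟩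

section

variable {G X : Type*} [Group G] [TopologicalSpace X] [BasedSpace X] [MulAction G X]
  [BasedGSpace G X]

theorem suspBase_smul (g : G) {p : I × X} (hp : p ∈ suspBase X) : (p.1, g • p.2) ∈ suspBase X := by
  rcases hp with h | h | h
  · exact Or.inl h
  · exact Or.inr (Or.inl h)
  · exact Or.inr (Or.inr (by simp only [h]; exact BasedGSpace.smul_pt g))

/-- `G` acts on `SX` through `X`. -/
instance : MulAction G (Susp X) where
  smul g := Quotient.map (fun p : I × X => (p.1, g • p.2)) (by
    rintro a b (rfl | ⟨ha, hb⟩)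
    · exact Or.inl rfl
    · exact Or.inr ⟨suspBase_smul g ha, suspBase_smul g hb⟩)
  one_smul := by
    rintro ⟨p⟩
    exact congrArg (Quotient.mk (suspSetoid X)) (Prod.ext rfl (one_smul G p.2))
  mul_smul := by
    rintro g h ⟨p⟩
    exact congrArg (Quotient.mk (suspSetoid X)) (Prod.ext rfl (mul_smul g h p.2))

theorem Susp.smul_mk (g : G) (a : I) (x : X) : g • Susp.mk a x = Susp.mk a (g • x) := rfl

instance : BasedGSpace G (Susp X) where
  continuous_const_smul g := by
    refine continuous_quot_lift _ ?_
    exact continuous_quotient_mk'.comp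
      (continuous_fst.prodMk ((continuous_const_smul g).comp continuous_snd))
  smul_pt g := congrArg (Susp.mk 0) (BasedGSpace.smul_pt g)

end

/-! ### Equivariant labelled configurations -/

section

variable (G M X : Type*) [Group G] [MulAction G M] [BasedSpace X] [MulAction G X]

/-- The set underlying `C_M(X)`: finite subsets of `M`, closed under `G` and equivariantly labelled
in `X`.  Points labelled by the basepoint are deleted, so that each class of labelled configurations
is recorded by its unique member without basepoint labels. -/
@[ext]
structure Conf where
  /-- the labelled points, with label different from the basepoint -/
  carrier : Set (M × X)
  finite : carrier.Finite
  label_ne : ∀ p ∈ carrier, p.2 ≠ BasedSpace.pt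
  injOn : InjOn Prod.fst carrier
  smul_mem : ∀ (g : G), ∀ p ∈ carrier, g • p ∈ carrier

/-- The empty configuration, the basepoint of `C_M(X)`. -/
def Conf.empty : Conf G M X where
  carrier := ∅
  finite := finite_empty
  label_ne := by simp
  injOn := by simp
  smul_mem := by simp

/-- Ordered equivariant labelled configurations of `q` distinct points, where labels may be equal to
the basepoint: a subspace of `(M × X)^q`. -/
def ConfTuple (q : ℕ) : Type _ :=
  {f : Fin q → M × X // Function.Injective (fun i => (f i).1) ∧
    ∀ (g : G) (i : Fin q), ∃ j, f j = g • f i}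

instance (q : ℕ) [TopologicalSpace M] [TopologicalSpace X] :
    TopologicalSpace (ConfTuple G M X q) :=
  inferInstanceAs (TopologicalSpace (Subtype _))

end

section

variable {G M X : Type*} [Group G] [MulAction G M] [TopologicalSpace X] [BasedSpace X]
  [MulAction G X] [BasedGSpace G X]

/-- Forget the order and delete the points labelled by the basepoint. -/
def toConf (f : Σ q, ConfTuple G M X q) : Conf G M X where
  carrier := {p | p ∈ range f.2.1 ∧ p.2 ≠ BasedSpace.pt}
  finite := (finite_range f.2.1).subset fun _ h => h.1
  label_ne := fun _ h => h.2
  injOn := by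
    rintro _ ⟨⟨i, rfl⟩, -⟩ _ ⟨⟨j, rfl⟩, -⟩ h
    exact congrArg f.2.1 (f.2.2.1 h)
  smul_mem := by
    rintro g _ ⟨⟨i, rfl⟩, hi⟩
    exact ⟨f.2.2.2 g i, smul_ne_pt g hi⟩

/-- `C_M(X)` has the quotient topology from the ordered configurations. -/
instance [TopologicalSpace M] : TopologicalSpace (Conf G M X) :=
  TopologicalSpace.coinduced toConf inferInstance

end

/-! ### Little 1-discs in `M × ℝ` and the monoid `C` -/

/-- A little 1-disc in `M × ℝ` parallel to `ℝ`, labelled in `X`. -/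
abbrev LabelledDisc (M X : Type*) : Type _ := M × ℝ × ℝ × X

namespace LabelledDisc

variable {M X : Type*}

/-- The `M`-coordinate of (every point of) the disc. -/
abbrev base (d : LabelledDisc M X) : M := d.1

/-- The `ℝ`-coordinate of the centre. -/
abbrev height (d : LabelledDisc M X) : ℝ := d.2.1

/-- The radius. -/
abbrev radius (d : LabelledDisc M X) : ℝ := d.2.2.1

/-- The label. -/
abbrev label (d : LabelledDisc M X) : X := d.2.2.2

/-- The disc is `{base} × interval`. -/
def interval (d : LabelledDisc M X) : Set ℝ := Icc (d.height - d.radius) (d.height + d.radius)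

/-- `G` acts on `M` and on labels, and trivially on `ℝ`. -/
def act {G : Type*} [Group G] [MulAction G M] [MulAction G X] (g : G) (d : LabelledDisc M X) :
    LabelledDisc M X := (g • d.base, d.height, d.radius, g • d.label)

/-- The disc lies in `M × (0, t)`. -/
def InSlab (t : ℝ) (d : LabelledDisc M X) : Prop := 0 < d.radius ∧ d.interval ⊆ Ioo 0 t

/-- Two little discs are disjoint as subsets of `M × ℝ`. -/
def Apart (d d' : LabelledDisc M X) : Prop := d.base = d'.base → Disjoint d.interval d'.interval

/-- Translation by `s` along `ℝ`. -/
def shift (s : ℝ) (d : LabelledDisc M X) : LabelledDisc M X :=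
  (d.base, s + d.height, d.radius, d.label)

theorem mem_interval_shift {s : ℝ} {d : LabelledDisc M X} {y : ℝ} :
    y ∈ (shift s d).interval ↔ y - s ∈ d.interval := by
  simp only [interval, shift, mem_Icc]
  constructor <;> rintro ⟨h1, h2⟩ <;> constructor <;> linarith

theorem shift_zero (d : LabelledDisc M X) : shift 0 d = d := by simp [shift]

theorem shift_shift (s t : ℝ) (d : LabelledDisc M X) : shift s (shift t d) = shift (s + t) d := by
  simp [shift, add_assoc]

end LabelledDisc

open LabelledDisc

section

variable (G M X : Type*) [Group G] [MulAction G M] [BasedSpace X] [MulAction G X]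

/-- The set underlying the monoid `C`: a length `t ≥ 0` and a finite `G`-closed, equivariantly
labelled collection of disjoint little 1-discs in `M × (0, t)` parallel to `ℝ`.  As for `Conf`,
discs labelled by the basepoint are deleted. -/
@[ext]
structure DiscConf where
  /-- the length `t` of the interval `(0, t)` -/
  len : ℝ
  /-- the labelled discs, with label different from the basepoint -/
  carrier : Set (LabelledDisc M X)
  len_nonneg : 0 ≤ len
  finite : carrier.Finite
  inSlab : ∀ d ∈ carrier, d.InSlab len
  apart : ∀ d ∈ carrier, ∀ d' ∈ carrier, d ≠ d' → d.Apart d'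
  label_ne : ∀ d ∈ carrier, d.label ≠ BasedSpace.pt
  act_mem : ∀ (g : G), ∀ d ∈ carrier, d.act g ∈ carrier

/-- Ordered collections of `q` discs, where labels may be equal to the basepoint: a subspace of
`ℝ × (M × ℝ × ℝ × X)^q`. -/
def DiscTuple (q : ℕ) : Type _ :=
  {f : ℝ × (Fin q → LabelledDisc M X) // 0 ≤ f.1 ∧ (∀ i, (f.2 i).InSlab f.1) ∧
    (∀ i j, i ≠ j → (f.2 i).Apart (f.2 j)) ∧ ∀ (g : G) (i : Fin q), ∃ j, f.2 j = (f.2 i).act g}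

instance (q : ℕ) [TopologicalSpace M] [TopologicalSpace X] :
    TopologicalSpace (DiscTuple G M X q) :=
  inferInstanceAs (TopologicalSpace (Subtype _))

end

section

variable {G M X : Type*} [Group G] [MulAction G M] [TopologicalSpace X] [BasedSpace X]
  [MulAction G X] [BasedGSpace G X]

/-- Forget the order and delete the discs labelled by the basepoint. -/
def toDiscConf (f : Σ q, DiscTuple G M X q) : DiscConf G M X where
  len := f.2.1.1
  carrier := {d | d ∈ range f.2.1.2 ∧ d.label ≠ BasedSpace.pt}
  len_nonneg := f.2.2.1
  finite := (finite_range f.2.1.2).subset fun _ h => h.1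
  inSlab := by
    rintro _ ⟨⟨i, rfl⟩, -⟩
    exact f.2.2.2.1 i
  apart := by
    rintro _ ⟨⟨i, rfl⟩, -⟩ _ ⟨⟨j, rfl⟩, -⟩ h
    exact f.2.2.2.2.1 i j fun hij => h (congrArg f.2.1.2 hij)
  label_ne := fun _ h => h.2
  act_mem := by
    rintro g _ ⟨⟨i, rfl⟩, hi⟩
    exact ⟨f.2.2.2.2.2 g i, smul_ne_pt g hi⟩

/-- `C` has the quotient topology from the ordered collections. -/
instance [TopologicalSpace M] : TopologicalSpace (DiscConf G M X) :=
  TopologicalSpace.coinduced toDiscConf inferInstance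

end

section

variable {G M X : Type*} [Group G] [MulAction G M] [BasedSpace X] [MulAction G X]

/-- Juxtaposition: `(0, t)` and `(0, t')` are put together to form `(0, t + t')`. -/
def DiscConf.juxtapose (c c' : DiscConf G M X) : DiscConf G M X where
  len := c.len + c'.len
  carrier := c.carrier ∪ shift c.len '' c'.carrier
  len_nonneg := add_nonneg c.len_nonneg c'.len_nonneg
  finite := c.finite.union (c'.finite.image _)
  inSlab := by
    rintro d (hd | ⟨d, hd, rfl⟩)
    · refine ⟨(c.inSlab d hd).1, fun y hy => ?_⟩
      have h := (c.inSlab d hd).2 hy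
      exact ⟨h.1, by linarith [h.2, c'.len_nonneg]⟩
    · refine ⟨(c'.inSlab d hd).1, fun y hy => ?_⟩
      have h := (c'.inSlab d hd).2 (mem_interval_shift.1 hy)
      exact ⟨by linarith [h.1, c.len_nonneg], by linarith [h.2]⟩
  apart := by
    rintro d (hd | ⟨d, hd, rfl⟩) e (he | ⟨e, he, rfl⟩) hne
    · exact c.apart d hd e he hne
    · intro _
      refine Set.disjoint_left.2 fun y hy hy' => ?_
      have h1 := (c.inSlab d hd).2 hy
      have h2 := (c'.inSlab e he).2 (mem_interval_shift.1 hy')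
      linarith [h1.2, h2.1]
    · intro _
      refine Set.disjoint_left.2 fun y hy hy' => ?_
      have h1 := (c.inSlab e he).2 hy'
      have h2 := (c'.inSlab d hd).2 (mem_interval_shift.1 hy)
      linarith [h1.2, h2.1]
    · intro hb
      have h := c'.apart d hd e he (fun h => hne (congrArg _ h)) hb
      refine Set.disjoint_left.2 fun y hy hy' => ?_
      exact Set.disjoint_left.1 h (mem_interval_shift.1 hy) (mem_interval_shift.1 hy')
  label_ne := by
    rintro d (hd | ⟨d, hd, rfl⟩)
    · exact c.label_ne d hd
    · exact c'.label_ne d hd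
  act_mem := by
    rintro g d (hd | ⟨d, hd, rfl⟩)
    · exact Or.inl (c.act_mem g d hd)
    · exact Or.inr ⟨d.act g, c'.act_mem g d hd, rfl⟩

instance : Add (DiscConf G M X) := ⟨DiscConf.juxtapose⟩

/-- The neutral element: the empty configuration of length `0`. -/
instance : Zero (DiscConf G M X) where
  zero :=
    { len := 0
      carrier := ∅
      len_nonneg := le_rfl
      finite := finite_empty
      inSlab := by simp
      apart := by simp
      label_ne := by simp
      act_mem := by simp }

/-- The strictly associative monoid `C`, written additively; it is not commutative. -/
instance : AddMonoid (DiscConf G M X) where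
  add_assoc a b c := by
    refine DiscConf.ext (add_assoc a.len b.len c.len) ?_
    change (a.carrier ∪ shift a.len '' b.carrier) ∪ shift (a.len + b.len) '' c.carrier =
      a.carrier ∪ shift a.len '' (b.carrier ∪ shift b.len '' c.carrier)
    rw [image_union, image_image, union_assoc]
    simp only [shift_shift]
  zero_add a := by
    refine DiscConf.ext (zero_add a.len) ?_
    change ∅ ∪ shift 0 '' a.carrier = a.carrier
    simp [shift_zero]
  add_zero a := by
    refine DiscConf.ext (add_zero a.len) ?_
    change a.carrier ∪ shift a.len '' ∅ = a.carrier
    simp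
  nsmul := nsmulRec

end

/-! ### The classifying space of a monoid -/

section

variable (C : Type*) [AddMonoid C] [TopologicalSpace C]

/-- The `n`-simplices of the nerve are `n`-tuples; the `i`-th face omits the first or last entry
(`i = 0`, `i = n + 1`) or adds two adjacent ones (`Fin.contractNth` at its last index omits the last
entry). -/
def nerveFace {C : Type*} [AddMonoid C] {n : ℕ} (i : Fin (n + 2)) (c : Fin (n + 1) → C) :
    Fin n → C :=
  Fin.cases (fun k => c k.succ) (fun j => Fin.contractNth j (· + ·) c) i

/-- The degeneracies insert the neutral element. -/
def nerveDegen {C : Type*} [AddMonoid C] {n : ℕ} (i : Fin (n + 1)) (c : Fin n → C) :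
    Fin (n + 1) → C :=
  Fin.insertNth (α := fun _ => C) i 0 c

/-- The identifications in the geometric realization of the nerve. -/
inductive NerveRel : (Σ n : ℕ, (Fin n → C) × stdSimplex ℝ (Fin (n + 1))) →
    (Σ n : ℕ, (Fin n → C) × stdSimplex ℝ (Fin (n + 1))) → Prop
  | face {n : ℕ} (i : Fin (n + 2)) (c : Fin (n + 1) → C) (p : stdSimplex ℝ (Fin (n + 1))) :
      NerveRel ⟨n, nerveFace i c, p⟩ ⟨n + 1, c, stdSimplex.map i.succAbove p⟩
  | degen {n : ℕ} (i : Fin (n + 1)) (c : Fin n → C) (p : stdSimplex ℝ (Fin (n + 2))) :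
      NerveRel ⟨n, c, stdSimplex.map i.predAbove p⟩ ⟨n + 1, nerveDegen i c, p⟩

/-- The classifying space `BC`: the realization of the nerve of `C`, a quotient of
`∐ₙ Cⁿ × Δₙ`. -/
def ClassifyingSpace : Type _ := Quot (NerveRel C)

instance : TopologicalSpace (ClassifyingSpace C) :=
  inferInstanceAs (TopologicalSpace (Quot _))

variable {C}

/-- The point `[p, c₁, …, cₙ]` of `BC`. -/
def ClassifyingSpace.mk {n : ℕ} (c : Fin n → C) (p : stdSimplex ℝ (Fin (n + 1))) :
    ClassifyingSpace C := Quot.mk _ ⟨n, c, p⟩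

end

/-! ### The map `q` -/

/-- The homeomorphism `θ : [0, ∞) → [1/2, 1)`. -/
noncomputable def theta (t : ℝ) : ℝ := 2 / Real.pi * Real.arctan (1 + t)

/-- The point `S_k(t, u, v)` of the thickened `k`-th slice, in barycentric coordinates.  Here `k`
is counted from `0`, `u = ∑ λ_i v_i` with `i ≤ k`, `v = ∑ μ_j v_j` with `k < j`, and
`S_k(t, v_i, v_j) = (1 - u_{i,k}) v_i + u_{i,k} v_j` where
`u_{i,k} = θ(s_i + ⋯ + s_{k-1} + t)`. -/
noncomputable def thickSlice {n : ℕ} (s : Fin n → ℝ) (k : Fin n) (t : ℝ)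
    (u v : Fin (n + 1) → ℝ) : Fin (n + 1) → ℝ :=
  ∑ i : Fin (n + 1), ∑ j : Fin (n + 1), (u i * v j) •
    ((1 - theta ((∑ l : Fin n with i ≤ l.castSucc ∧ l < k, s l) + t)) • Pi.single i (1 : ℝ) +
      theta ((∑ l : Fin n with i ≤ l.castSucc ∧ l < k, s l) + t) • Pi.single j (1 : ℝ))

/-- `p = S_k(t, u, v)` for some `u` in the face `σ_k` spanned by the vertices up to `k` and some `v`
in the face `τ_k` spanned by the later vertices, where `t ∈ (0, s_k)`. -/
def InThickSlice {n : ℕ} (s : Fin n → ℝ) (p : stdSimplex ℝ (Fin (n + 1))) (k : Fin n) (t : ℝ) :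
    Prop :=
  t ∈ Ioo 0 (s k) ∧ ∃ u v : stdSimplex ℝ (Fin (n + 1)),
    (∀ i, k.castSucc < i → u i = 0) ∧ (∀ j, j ≤ k.castSucc → v j = 0) ∧
    (p : Fin (n + 1) → ℝ) = thickSlice s k t u v

section

variable {G M X : Type*} [Group G] [MulAction G M] [TopologicalSpace X] [BasedSpace X]
  [MulAction G X] [BasedGSpace G X]

/-- The point `[(t + ε - c'') / 2ε, x]` of `SX` for a disc with label `x` and radius `ε` at height
`c''`; it is only used for `|t - c''| ≤ ε`, when the quotient is in `[0,1]`. -/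
noncomputable def suspLabel (t : ℝ) (d : LabelledDisc M X) : Susp X :=
  Susp.mk (projIcc 0 1 zero_le_one ((t + d.radius - d.height) / (2 * d.radius))) d.label

/-- The slice at height `t` of a configuration of little 1-discs: the points `c'` of `M` such that
the disc over `c'` contains `t`, labelled in `SX`. -/
noncomputable def DiscConf.slice (c : DiscConf G M X) (t : ℝ) : Conf G M (Susp X) where
  carrier := {y | y.2 ≠ BasedSpace.pt ∧
    ∃ d ∈ c.carrier, |t - d.height| ≤ d.radius ∧ y = (d.base, suspLabel t d)}
  finite := by
    refine (c.finite.image fun d => (d.base, suspLabel t d)).subset ?_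
    rintro y ⟨-, d, hd, -, rfl⟩
    exact ⟨d, hd, rfl⟩
  label_ne := fun _ h => h.1
  injOn := by
    rintro _ ⟨-, d, hd, hdt, rfl⟩ _ ⟨-, e, he, het, rfl⟩ h
    by_cases hde : d = e
    · rw [hde]
    · have hdis := c.apart d hd e he hde h
      rw [abs_le] at hdt het
      have h1 : t ∈ d.interval := ⟨by linarith, by linarith⟩
      have h2 : t ∈ e.interval := ⟨by linarith, by linarith⟩
      exact (Set.disjoint_left.1 hdis h1 h2).elim
  smul_mem := by
    rintro g _ ⟨hne, d, hd, hdt, rfl⟩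
    exact ⟨smul_ne_pt g hne, d.act g, c.act_mem g d hd, hdt, rfl⟩

/-- `f : BC → C_M(SX)` is the map `q`: if the simplex coordinate is `S_k(t, u, v)`, then the value is
the slice of the `k`-th configuration at height `t`; if it is in no thickened slice, then the value
is the empty configuration. -/
def IsThickSliceMap (f : ClassifyingSpace (DiscConf G M X) → Conf G M (Susp X)) : Prop :=
  ∀ (n : ℕ) (c : Fin n → DiscConf G M X) (p : stdSimplex ℝ (Fin (n + 1))),
    (∀ k t, InThickSlice (fun l => (c l).len) p k t →
      f (ClassifyingSpace.mk c p) = (c k).slice t) ∧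
    ((¬ ∃ k t, InThickSlice (fun l => (c l).len) p k t) →
      f (ClassifyingSpace.mk c p) = Conf.empty G M (Susp X))

end

end EquivConf

open EquivConf

/-!
The map `q` has a homotopy inverse that can be written down.

A point `[p; c₁, …, cₙ]` of `BC` is the same as the juxtaposition of the `cₖ`, on an interval,
together with the probability measure on this interval that puts the barycentric coordinates of `p`
at the ends of the pieces; face and degeneracy identifications amount to forgetting what lies
outside of the support of the measure (`LineConf.mk_eq_cut`, `DiscConf.eq_of_nerveRel`). The
condition that `p = S_k(t, u, v)` says that a weighted sum of increasing functions, the `mass` of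
the measure, takes the value `1` at the height `t` of the `k`-th piece (`inThickSlice_iff`). There
is a unique height `level` at which the mass reaches `1`, possibly by a jump at an end of a piece,
where the slice is empty. It depends continuously on cuts and weights (`continuousAt_level`), and
`q`, called `sliceMap`, is the slice at this height: it is well defined on all of `BC`, and
continuous.

For the inverse `unslice`, each point of a configuration `ζ` labelled in `SX` is replaced by a disc
of fixed radius, at a height that is a function of its suspension coordinate (`stack`): points near
one end of the suspension go above, and points near the other end below, a range of heights whose
size, the `room`, is proportional to the number of points away from the basepoint. Integral heights
in this range that are away from all discs always exist (`exists_clearance_eq_one`), and they are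
given weights depending continuously on `ζ` (`weight`), which cut the stack into a point of `BC`. A
label that comes near the basepoint of `X` is moved to the basepoint by the homotopy that comes from
the equivariant retraction (`LabelContraction`), so that its disc may then be ignored in the choice
of the heights.

The composite `unslice ∘ sliceMap` is homotopic to the identity in two steps. In the first, room is
made at the slicing height of a configuration, by pushing all discs that miss it up or down, and
moving those that meet it into their positions in the stack (`spread`,
`continuous_deform_openMeasure`). After this, the measure of the old cuts is deformed linearly into
the weights at the integral heights inside the room (`continuous_deform_mixed`); at the end the
discs outside of the room are lost, and what remains is the stack over the slice
(`deform_sliceMeasure`). The composite `sliceMap ∘ unslice` only changes the suspension coordinates,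
by a map fixing the ends of the suspension, and labels in `X` by the contraction; a straight line
homotopy leads back to the identity (`settleConf`).

Maps out of `BC × [0,1]` and out of configuration spaces are continuous as soon as they are so on
the spaces of which these are quotients, since the parameter spaces are locally compact. Maps into
configuration spaces are controlled by the fact that a configuration varies continuously if it is
locally listed by finitely many continuously moving discs, whose labels may pass through the
basepoint.
-/

namespace EquivConf

open Filter Topology LabelledDisc

set_option linter.unusedSectionVars false

/-! ### Continuity into and out of configuration spaces -/

section Conf

variable {G M Y : Type*} [Group G] [MulAction G M] [TopologicalSpace M] [TopologicalSpace Y]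
  [BasedSpace Y] [MulAction G Y] [BasedGSpace G Y]

theorem isQuotientMap_toConf : IsQuotientMap (toConf : (Σ q, ConfTuple G M Y q) → Conf G M Y) := by
  refine ⟨⟨rfl⟩, fun ζ => ?_⟩
  obtain ⟨n, e, he⟩ := ζ.finite.fin_param
  have hr : range e = ζ.carrier := he.2
  have hm : ∀ i, e i ∈ ζ.carrier := fun i => hr ▸ mem_range_self i
  refine ⟨⟨n, e, fun i j h => he.1 (ζ.injOn (hm i) (hm j) h), fun g i => ?_⟩, ?_⟩
  · have := ζ.smul_mem g _ (hm i)
    rw [← hr] at this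
    exact this
  · apply Conf.ext
    ext p
    change (p ∈ range e ∧ _) ↔ _
    rw [hr]
    exact ⟨fun h => h.1, fun h => ⟨h, ζ.label_ne p h⟩⟩

/-- A map into `C_M(Y)` is continuous at a point near which its values are listed, up to points
labelled by the basepoint, by a finite family of labelled points varying continuously. -/
theorem Conf.continuousAt_of_family {W ι : Type*} [TopologicalSpace W] [Finite ι]
    {Φ : W → Conf G M Y} {w₀ : W} (f : W → ι → M × Y)
    (hc : ∀ i, ContinuousAt (fun w => f w i) w₀)
    (h : ∀ᶠ w in 𝓝 w₀, Function.Injective (fun i => (f w i).1) ∧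
      (∀ (g : G) i, ∃ j, f w j = g • f w i) ∧
      (Φ w).carrier = {p | p ∈ range (f w) ∧ p.2 ≠ BasedSpace.pt}) :
    ContinuousAt Φ w₀ := by
  obtain ⟨q, ⟨e⟩⟩ := Finite.exists_equiv_fin ι
  obtain ⟨A, hA, hA'⟩ := h.exists_mem
  have hw : w₀ ∈ A := mem_of_mem_nhds hA
  let F : A → ConfTuple G M Y q := fun w => ⟨fun i => f w (e.symm i),
    fun i j hij => e.symm.injective ((hA' w w.2).1 hij), fun g i => by
      obtain ⟨j, hj⟩ := (hA' w w.2).2.1 g (e.symm i)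
      exact ⟨e j, by simpa using hj⟩⟩
  have hF : ContinuousAt F ⟨w₀, hw⟩ := by
    refine Topology.IsInducing.subtypeVal.continuousAt_iff.2 ?_
    exact continuousAt_pi.2 fun i => (hc (e.symm i)).comp
      (f := ((↑) : A → W)) (x := ⟨w₀, hw⟩) continuousAt_subtype_val
  have hΦ : (fun w : A => Φ w) = fun w => toConf ⟨q, F w⟩ := by
    funext w
    apply Conf.ext
    rw [(hA' w w.2).2.2]
    ext p
    change (p ∈ range (f w) ∧ _) ↔ (p ∈ range (f w ∘ e.symm) ∧ _)
    rw [e.symm.surjective.range_comp]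
  have h1 : ContinuousAt (fun w : A => Φ w) ⟨w₀, hw⟩ := by
    rw [hΦ]
    exact (isQuotientMap_toConf.continuous.comp continuous_sigmaMk).continuousAt.comp hF
  have h2 : ContinuousWithinAt Φ A w₀ := (continuousWithinAt_iff_continuousAt_domRestrict Φ hw).2 h1
  exact h2.continuousAt hA

/-- A map out of `Conf × P` is continuous if it is so on ordered collections. -/
theorem Conf.continuous_of_tuples {P Z : Type*} [TopologicalSpace P] [LocallyCompactSpace P]
    [TopologicalSpace Z] {g : Conf G M Y × P → Z}
    (hg : ∀ q, Continuous fun p : ConfTuple G M Y q × P => g (toConf ⟨q, p.1⟩, p.2)) : Continuous g :=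
  isQuotientMap_toConf.continuous_lift_prod_left
    ((Homeomorph.sigmaProdDistrib.symm).comp_continuous_iff'.1 (continuous_sigma hg))

end Conf

section DiscConf

variable {G M X : Type*} [Group G] [MulAction G M] [TopologicalSpace M] [TopologicalSpace X]
  [BasedSpace X] [MulAction G X] [BasedGSpace G X]

theorem isQuotientMap_toDiscConf :
    IsQuotientMap (toDiscConf : (Σ q, DiscTuple G M X q) → DiscConf G M X) := by
  refine ⟨⟨rfl⟩, fun c => ?_⟩
  obtain ⟨n, e, he⟩ := c.finite.fin_param
  have hr : range e = c.carrier := he.2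
  have hm : ∀ i, e i ∈ c.carrier := fun i => hr ▸ mem_range_self i
  refine ⟨⟨n, (c.len, e), c.len_nonneg, fun i => c.inSlab _ (hm i), fun i j hij =>
    c.apart _ (hm i) _ (hm j) fun h => hij (he.1 h), fun g i => ?_⟩, ?_⟩
  · have := c.act_mem g _ (hm i)
    rw [← hr] at this
    exact this
  · apply DiscConf.ext
    · rfl
    ext p
    change (p ∈ range e ∧ _) ↔ _
    rw [hr]
    exact ⟨fun h => h.1, fun h => ⟨h, c.label_ne p h⟩⟩

/-- A map into `C` is continuous at a point near which its values are listed, up to discs labelled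
by the basepoint, by a finite family of labelled discs varying continuously. -/
theorem DiscConf.continuousAt_of_family {W ι : Type*} [TopologicalSpace W] [Finite ι]
    {Φ : W → DiscConf G M X} {w₀ : W} (f : W → ι → LabelledDisc M X)
    (hl : ContinuousAt (fun w => (Φ w).len) w₀)
    (hc : ∀ i, ContinuousAt (fun w => f w i) w₀)
    (h : ∀ᶠ w in 𝓝 w₀, (∀ i, (f w i).InSlab (Φ w).len) ∧
      (∀ i j, i ≠ j → (f w i).Apart (f w j)) ∧
      (∀ (g : G) i, ∃ j, f w j = (f w i).act g) ∧
      (Φ w).carrier = {d | d ∈ range (f w) ∧ d.label ≠ BasedSpace.pt}) :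
    ContinuousAt Φ w₀ := by
  obtain ⟨q, ⟨e⟩⟩ := Finite.exists_equiv_fin ι
  obtain ⟨A, hA, hA'⟩ := h.exists_mem
  have hw : w₀ ∈ A := mem_of_mem_nhds hA
  let F : A → DiscTuple G M X q := fun w => ⟨((Φ w).len, fun i => f w (e.symm i)),
    (Φ w).len_nonneg, fun i => (hA' w w.2).1 _,
    fun i j hij => (hA' w w.2).2.1 _ _ fun h => hij (e.symm.injective h), fun g i => by
      obtain ⟨j, hj⟩ := (hA' w w.2).2.2.1 g (e.symm i)
      exact ⟨e j, by simpa using hj⟩⟩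
  have hF : ContinuousAt F ⟨w₀, hw⟩ := by
    refine Topology.IsInducing.subtypeVal.continuousAt_iff.2 ?_
    refine ContinuousAt.prodMk ?_ (continuousAt_pi.2 fun i => ?_)
    · exact hl.comp (f := ((↑) : A → W)) (x := ⟨w₀, hw⟩) continuousAt_subtype_val
    · exact (hc (e.symm i)).comp (f := ((↑) : A → W)) (x := ⟨w₀, hw⟩) continuousAt_subtype_val
  have hΦ : (fun w : A => Φ w) = fun w => toDiscConf ⟨q, F w⟩ := by
    funext w
    apply DiscConf.ext
    · rfl
    rw [(hA' w w.2).2.2.2]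
    ext p
    change (p ∈ range (f w) ∧ _) ↔ (p ∈ range (f w ∘ e.symm) ∧ _)
    rw [e.symm.surjective.range_comp]
  have h1 : ContinuousAt (fun w : A => Φ w) ⟨w₀, hw⟩ := by
    rw [hΦ]
    exact (isQuotientMap_toDiscConf.continuous.comp continuous_sigmaMk).continuousAt.comp hF
  have h2 : ContinuousWithinAt Φ A w₀ := (continuousWithinAt_iff_continuousAt_domRestrict Φ hw).2 h1
  exact h2.continuousAt hA

/-- The length is a continuous function on `C`. -/
theorem DiscConf.continuous_len : Continuous (DiscConf.len : DiscConf G M X → ℝ) := by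
  refine isQuotientMap_toDiscConf.continuous_iff.2 (continuous_sigma fun q => ?_)
  exact continuous_fst.comp continuous_subtype_val

/-- A map out of `DiscConf × P` is continuous if it is so on ordered collections. -/
theorem DiscConf.continuous_of_tuples {P Z : Type*} [TopologicalSpace P] [LocallyCompactSpace P]
    [TopologicalSpace Z] {g : DiscConf G M X × P → Z}
    (hg : ∀ q, Continuous fun p : DiscTuple G M X q × P => g (toDiscConf ⟨q, p.1⟩, p.2)) :
    Continuous g :=
  isQuotientMap_toDiscConf.continuous_lift_prod_left
    ((Homeomorph.sigmaProdDistrib.symm).comp_continuous_iff'.1 (continuous_sigma hg))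

end DiscConf

/-- If finitely many points of a Hausdorff space move continuously and are permuted by a continuous
self-map, then the permutation is locally constant. -/
theorem eventually_eq_map {Y W ι : Type*} [TopologicalSpace Y] [T2Space Y]
    [TopologicalSpace W] [Finite ι] {P : W → ι → Y} {w₀ : W} {α : Y → Y} (hα : Continuous α)
    (hc : ∀ i, ContinuousAt (fun w => P w i) w₀) :
    ∀ᶠ w in 𝓝 w₀, ∀ i j : ι, P w j = α (P w i) → P w₀ j = α (P w₀ i) := by
  refine eventually_all.2 fun i => eventually_all.2 fun j => ?_
  by_cases h : P w₀ j = α (P w₀ i)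
  · exact Eventually.of_forall fun _ _ => h
  · have := ((hc j).prodMk (hα.continuousAt.comp (hc i))).eventually
      (isClosed_diagonal.isOpen_compl.mem_nhds (x := (P w₀ j, α (P w₀ i))) h)
    filter_upwards [this] with w hw hw'
    exact absurd hw' hw

theorem LabelledDisc.InSlab.bounds {M X : Type*} {d : LabelledDisc M X} {l : ℝ} (h : d.InSlab l) :
    0 < d.height - d.radius ∧ d.height + d.radius < l := by
  have h0 := h.1
  exact ⟨(h.2 (left_mem_Icc.2 (by linarith))).1, (h.2 (right_mem_Icc.2 (by linarith))).2⟩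

theorem LabelledDisc.inSlab_of_bounds {M X : Type*} {d : LabelledDisc M X} {l : ℝ}
    (h : 0 < d.radius) (h1 : 0 < d.height - d.radius) (h2 : d.height + d.radius < l) : d.InSlab l :=
  ⟨h, fun _ hy => ⟨h1.trans_le hy.1, hy.2.trans_lt h2⟩⟩

/-! ### Coordinates on the reduced suspension -/

section Susp

variable {X : Type*} [BasedSpace X]

theorem Susp.mk_eq_pt_iff {a : I} {x : X} :
    Susp.mk a x = BasedSpace.pt ↔ a = 0 ∨ a = 1 ∨ x = BasedSpace.pt := by
  refine ⟨fun h => ?_, fun h => Quotient.sound (Or.inr ⟨h, Or.inl rfl⟩)⟩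
  rcases Quotient.exact h with h | h
  · exact Or.inl (congrArg Prod.fst h)
  · exact h.1

theorem Susp.mk_inj {a b : I} {x y : X} (h : Susp.mk a x = Susp.mk b y)
    (hne : Susp.mk a x ≠ BasedSpace.pt) : a = b ∧ x = y := by
  rcases Quotient.exact h with h | h
  · exact Prod.mk.inj h
  · exact absurd (Susp.mk_eq_pt_iff.2 h.1) hne

theorem Susp.continuous_mk [TopologicalSpace X] : Continuous fun p : I × X => Susp.mk p.1 p.2 :=
  continuous_quotient_mk'

theorem Susp.isQuotientMap_mk [TopologicalSpace X] :
    IsQuotientMap fun p : I × X => Susp.mk p.1 p.2 :=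
  isQuotientMap_quotient_mk'

end Susp

/-! ### Relabelling and weighted products -/

section Relabel

variable {G M Y Z N P : Type*} [Group G] [MulAction G M] [BasedSpace Y] [MulAction G Y]
  [BasedSpace Z] [MulAction G Z]

/-- The map `C_M(Y) → C_M(Z)` induced by an equivariant map of labels; points whose new label is the
basepoint are deleted. -/
def Conf.relabel [TopologicalSpace Z] [BasedGSpace G Z] (φ : Y → Z)
    (hφ : ∀ (g : G) y, φ (g • y) = g • φ y) (ζ : Conf G M Y) : Conf G M Z where
  carrier := {p | p.2 ≠ BasedSpace.pt ∧ ∃ y, (p.1, y) ∈ ζ.carrier ∧ p.2 = φ y}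
  finite := by
    refine (ζ.finite.image fun p => (p.1, φ p.2)).subset ?_
    rintro ⟨m, z⟩ ⟨-, y, hy, rfl⟩
    exact ⟨(m, y), hy, rfl⟩
  label_ne := fun _ h => h.1
  injOn := by
    rintro ⟨m, z⟩ ⟨-, y, hy, rfl⟩ ⟨m', z'⟩ ⟨-, y', hy', rfl⟩ (rfl : m = m')
    have := ζ.injOn hy hy' rfl
    simp only [Prod.mk.injEq, true_and] at this
    rw [this]
  smul_mem := by
    rintro g ⟨m, z⟩ ⟨hz, y, hy, rfl⟩
    exact ⟨smul_ne_pt g hz, g • y, ζ.smul_mem g _ hy, (hφ g y).symm⟩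

variable [TopologicalSpace M] [TopologicalSpace Y] [BasedGSpace G Y]

theorem Conf.continuous_relabel [TopologicalSpace Z] [BasedGSpace G Z] [TopologicalSpace P]
    [LocallyCompactSpace P] {φ : P → Y → Z} (hφ : ∀ t (g : G) y, φ t (g • y) = g • φ t y)
    (hpt : ∀ t, φ t BasedSpace.pt = BasedSpace.pt) (hc : Continuous fun p : Y × P => φ p.2 p.1) :
    Continuous fun p : Conf G M Y × P => p.1.relabel (φ p.2) (hφ p.2) := by
  refine Conf.continuous_of_tuples fun q => ?_
  refine continuous_iff_continuousAt.2 fun w₀ => ?_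
  refine Conf.continuousAt_of_family (ι := Fin q)
    (fun w i => ((w.1.1 i).1, φ w.2 (w.1.1 i).2)) (fun i => ?_) (Eventually.of_forall fun w => ?_)
  · refine Continuous.continuousAt ?_
    have h1 : Continuous fun w : ConfTuple G M Y q × P => w.1.1 i :=
      (continuous_apply i).comp (continuous_subtype_val.comp continuous_fst)
    exact (continuous_fst.comp h1).prodMk
      (hc.comp ((continuous_snd.comp h1).prodMk continuous_snd))
  · refine ⟨w.1.2.1, fun g i => ?_, ?_⟩
    · obtain ⟨j, hj⟩ := w.1.2.2 g i
      exact ⟨j, by rw [hj]; exact Prod.ext rfl (hφ _ g _)⟩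
    · ext ⟨m, z⟩
      constructor
      · rintro ⟨hz, y, ⟨⟨i, hi⟩, hy⟩, rfl⟩
        have hi : w.1.1 i = (m, y) := hi
        exact ⟨⟨i, by simp only [hi]⟩, hz⟩
      · rintro ⟨⟨i, hi⟩, hz⟩
        have hi1 : (w.1.1 i).1 = m := congrArg Prod.fst hi
        have hi2 : φ w.2 (w.1.1 i).2 = z := congrArg Prod.snd hi
        refine ⟨hz, (w.1.1 i).2, ⟨⟨i, Prod.ext hi1 rfl⟩, fun h => ?_⟩, hi2.symm⟩
        apply hz
        change z = _
        rw [← hi2]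
        change (w.1.1 i).2 = _ at h
        rw [h, hpt]

/-- The product of a function of the labels over the points of a configuration. -/
noncomputable def Conf.prod [CommMonoid N] (φ : Y → N) (ζ : Conf G M Y) : N :=
  ∏ p ∈ ζ.finite.toFinset, φ p.2

/-- The sum of a function of the labels over the points of a configuration. -/
noncomputable def Conf.sum [AddCommMonoid N] (φ : Y → N) (ζ : Conf G M Y) : N :=
  ∑ p ∈ ζ.finite.toFinset, φ p.2

theorem Conf.prod_toConf [CommMonoid N] {φ : Y → N} (hpt : φ BasedSpace.pt = 1) {q : ℕ}
    (f : ConfTuple G M Y q) : (toConf ⟨q, f⟩).prod φ = ∏ i, φ (f.1 i).2 := by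
  classical
  have hinj : Function.Injective f.1 := fun i j h => f.2.1 (congrArg Prod.fst h)
  rw [← Finset.prod_image (s := Finset.univ) (g := f.1) (f := fun p => φ p.2)
    fun i _ j _ h => hinj h]
  refine Finset.prod_subset (fun p hp => ?_) fun p hp hp' => ?_
  · obtain ⟨i, rfl⟩ := ((toConf ⟨q, f⟩).finite.mem_toFinset.1 hp).1
    exact Finset.mem_image_of_mem _ (Finset.mem_univ i)
  · obtain ⟨i, -, rfl⟩ := Finset.mem_image.1 hp
    by_contra h
    exact hp' ((toConf ⟨q, f⟩).finite.mem_toFinset.2 ⟨⟨i, rfl⟩, fun h' => h (by rw [h', hpt])⟩)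

theorem Conf.continuous_prod [CommMonoid N] [TopologicalSpace N] [ContinuousMul N]
    [TopologicalSpace P] [LocallyCompactSpace P] {φ : P → Y → N}
    (hpt : ∀ t, φ t BasedSpace.pt = 1) (hc : Continuous fun p : Y × P => φ p.2 p.1) :
    Continuous fun p : Conf G M Y × P => p.1.prod (φ p.2) := by
  refine Conf.continuous_of_tuples fun q => ?_
  have : (fun p : ConfTuple G M Y q × P => ∏ i, φ p.2 (p.1.1 i).2) =
      fun p => (toConf ⟨q, p.1⟩).prod (φ p.2) := by
    funext p
    rw [Conf.prod_toConf (hpt _)]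
  refine Continuous.congr ?_ (fun p => congrFun this p)
  refine continuous_finsetProd _ fun i _ => hc.comp (Continuous.prodMk ?_ continuous_snd)
  exact continuous_snd.comp ((continuous_apply i).comp (continuous_subtype_val.comp continuous_fst))

theorem Conf.continuous_sum {φ : Y → ℝ} (hpt : φ BasedSpace.pt = 0) (hc : Continuous φ) :
    Continuous fun ζ : Conf G M Y => ζ.sum φ := by
  have := Conf.continuous_prod (G := G) (M := M) (P := Unit) (N := Multiplicative ℝ)
    (φ := fun _ y => Multiplicative.ofAdd (φ y)) (fun _ => by rw [hpt]; rfl)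
    (continuous_ofAdd.comp (hc.comp continuous_fst))
  exact continuous_toAdd.comp (this.comp (Continuous.prodMk continuous_id (continuous_const (y := ()))))

end Relabel

/-! ### Continuity of slices -/

section Slice

variable {G M X : Type*} [Group G] [Finite G] [TopologicalSpace M] [T2Space M] [MulAction G M]
  [ContinuousConstSMul G M] [TopologicalSpace X] [BasedSpace X] [MulAction G X] [BasedGSpace G X]

theorem suspLabel_eq_pt_iff {t : ℝ} {d : LabelledDisc M X} (hd : 0 < d.radius) :
    suspLabel t d = BasedSpace.pt ↔ d.label = BasedSpace.pt ∨ d.radius ≤ |t - d.height| := by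
  have h0 : projIcc (0 : ℝ) 1 zero_le_one ((t + d.radius - d.height) / (2 * d.radius)) = 0 ↔
      t - d.height ≤ -d.radius := by
    have := projIcc_eq_left (zero_lt_one' ℝ) (x := (t + d.radius - d.height) / (2 * d.radius))
    refine this.trans ?_
    rw [div_le_iff₀ (by positivity)]
    constructor <;> intro <;> linarith
  have h1 : projIcc (0 : ℝ) 1 zero_le_one ((t + d.radius - d.height) / (2 * d.radius)) = 1 ↔
      d.radius ≤ t - d.height := by
    have := projIcc_eq_right (zero_lt_one' ℝ) (x := (t + d.radius - d.height) / (2 * d.radius))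
    refine this.trans ?_
    rw [le_div_iff₀ (by positivity)]
    constructor <;> intro <;> linarith
  rw [suspLabel, Susp.mk_eq_pt_iff, h0, h1, le_abs, or_comm (a := d.label = _), ← or_assoc,
    or_comm (a := t - d.height ≤ _), le_neg]

/-- The action of `g` on the space `M × ℝ` of centres. -/
theorem continuous_smul_centre (g : G) : Continuous fun p : M × ℝ => (g • p.1, p.2) :=
  ((continuous_const_smul g).comp continuous_fst).prodMk continuous_snd

/-- Different discs of an ordered collection have different centres. -/
theorem DiscTuple.eq_of_centre_eq {q : ℕ} (f : DiscTuple G M X q) {i j : Fin q}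
    (h : ((f.1.2 i).base, (f.1.2 i).height) = ((f.1.2 j).base, (f.1.2 j).height)) : i = j := by
  by_contra hij
  have hb := congrArg Prod.fst h
  have hh := congrArg Prod.snd h
  have hdis := Set.disjoint_left.1 (f.2.2.2.1 i j hij hb)
  refine @hdis (f.1.2 i).height ?_ ?_
  · have := (f.2.2.1 i).1
    exact ⟨by linarith, by linarith⟩
  · have := (f.2.2.1 j).1
    simp only at hh
    rw [hh]
    exact ⟨by linarith, by linarith⟩

/-- Locally on the space of ordered collections of discs, the action of `G` on the indices is
constant. -/
theorem DiscTuple.eventually_act {q : ℕ} {W : Type*} [TopologicalSpace W]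
    {F : W → DiscTuple G M X q} (hF : Continuous F) (w₀ : W) :
    ∀ᶠ w in 𝓝 w₀, ∀ (g : G) (i j : Fin q), (F w).1.2 j = ((F w).1.2 i).act g →
      (F w₀).1.2 j = ((F w₀).1.2 i).act g := by
  refine eventually_all.2 fun g => ?_
  have hc : ∀ i, ContinuousAt (fun w => (((F w).1.2 i).base, ((F w).1.2 i).height)) w₀ := by
    intro i
    have h1 : Continuous fun w => (F w).1.2 i :=
      (continuous_apply i).comp (continuous_snd.comp (continuous_subtype_val.comp hF))
    exact ((continuous_fst.comp h1).prodMk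
      (continuous_fst.comp (continuous_snd.comp h1))).continuousAt
  filter_upwards [eventually_eq_map (continuous_smul_centre (M := M) g) hc] with w hw i j hij
  have h2 := hw i j (by rw [hij]; rfl)
  obtain ⟨j', hj'⟩ := (F w₀).2.2.2.2 g i
  have : j' = j := DiscTuple.eq_of_centre_eq (F w₀) (by rw [hj', h2]; rfl)
  rw [← this, hj']

/-- Slices depend continuously on configuration and height: a disc that enters or leaves the slice
does so with its label at the basepoint of `SX`. -/
theorem continuous_slice :
    Continuous fun p : DiscConf G M X × ℝ => p.1.slice p.2 := by
  refine DiscConf.continuous_of_tuples fun q => ?_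
  refine continuous_iff_continuousAt.2 fun w₀ => ?_
  have hd : ∀ i, Continuous fun w : DiscTuple G M X q × ℝ => w.1.1.2 i := fun i =>
    (continuous_apply i).comp (continuous_snd.comp (continuous_subtype_val.comp continuous_fst))
  have hh : ∀ i, Continuous fun w : DiscTuple G M X q × ℝ => (w.1.1.2 i).height := fun i =>
    continuous_fst.comp (continuous_snd.comp (hd i))
  have hr : ∀ i, Continuous fun w : DiscTuple G M X q × ℝ => (w.1.1.2 i).radius := fun i =>
    continuous_fst.comp (continuous_snd.comp (continuous_snd.comp (hd i)))
  have hb : ∀ i, Continuous fun w : DiscTuple G M X q × ℝ => (w.1.1.2 i).base := fun i =>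
    continuous_fst.comp (hd i)
  have hlab : ∀ i, Continuous fun w : DiscTuple G M X q × ℝ => (w.1.1.2 i).label := fun i =>
    continuous_snd.comp (continuous_snd.comp (continuous_snd.comp (hd i)))
  -- Only the discs that meet the height `w₀.2` contribute near `w₀`.
  let ι := {i : Fin q // |w₀.2 - (w₀.1.1.2 i).height| ≤ (w₀.1.1.2 i).radius}
  have hne : ∀ i j : ι, i ≠ j → (w₀.1.1.2 i).base ≠ (w₀.1.1.2 j).base := by
    rintro ⟨i, hi⟩ ⟨j, hj⟩ hij h
    rw [abs_le] at hi hj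
    have := w₀.1.2.2.2.1 i j (fun h => hij (Subtype.ext h)) h
    have h1 : w₀.2 ∈ (w₀.1.1.2 i).interval := ⟨by linarith, by linarith⟩
    exact Set.disjoint_left.1 this h1 ⟨by linarith, by linarith⟩
  have h1 : ∀ᶠ w in 𝓝 w₀, ∀ i j : ι, i ≠ j → (w.1.1.2 i).base ≠ (w.1.1.2 j).base := by
    refine eventually_all.2 fun i => eventually_all.2 fun j => ?_
    by_cases hij : i = j
    · exact Eventually.of_forall fun w h => absurd hij h
    · have := ((hb i).continuousAt.prodMk (hb j).continuousAt).eventually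
        (isClosed_diagonal.isOpen_compl.mem_nhds
          (x := ((w₀.1.1.2 i).base, (w₀.1.1.2 j).base)) (hne i j hij))
      filter_upwards [this] with w hw _ using hw
  have h2 : ∀ᶠ w in 𝓝 w₀, ∀ i : Fin q, |w.2 - (w.1.1.2 i).height| ≤ (w.1.1.2 i).radius →
      |w₀.2 - (w₀.1.1.2 i).height| ≤ (w₀.1.1.2 i).radius := by
    refine eventually_all.2 fun i => ?_
    by_cases hi : |w₀.2 - (w₀.1.1.2 i).height| ≤ (w₀.1.1.2 i).radius
    · exact Eventually.of_forall fun _ _ => hi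
    · have := (hr i).continuousAt.eventually_lt
        ((continuous_snd.sub (hh i)).abs).continuousAt (not_le.1 hi)
      filter_upwards [this] with w hw hw' using absurd hw' (not_le.2 hw)
  refine Conf.continuousAt_of_family (ι := ι)
    (fun w i => ((w.1.1.2 i).base, suspLabel w.2 (w.1.1.2 i))) (fun i => ?_) ?_
  · refine ((hb i).prodMk ?_).continuousAt
    refine Susp.continuous_mk.comp (Continuous.prodMk ?_ (hlab i))
    refine (continuous_projIcc (h := zero_le_one)).comp (Continuous.div₀ ?_ ?_ fun w => ?_)
    · exact (continuous_snd.add (hr i)).sub (hh i)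
    · exact continuous_const.mul (hr i)
    · have := (w.1.2.2.1 i).1
      positivity
  · filter_upwards [h1, h2, DiscTuple.eventually_act (continuous_fst) w₀] with w hw1 hw2 hw3
    refine ⟨fun i j hij => ?_, fun g i => ?_, ?_⟩
    · by_contra h
      exact hw1 i j h hij
    · obtain ⟨j, hj⟩ := w.1.2.2.2.2 g i
      have h0 := hw3 g i j hj
      refine ⟨⟨j, ?_⟩, ?_⟩
      · rw [h0]
        exact i.2
      · change ((w.1.1.2 j).base, suspLabel w.2 (w.1.1.2 j)) = _
        rw [hj]
        rfl
    · ext ⟨m, z⟩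
      constructor
      · rintro ⟨hz, d, ⟨⟨i, rfl⟩, hi⟩, hd', he⟩
        exact ⟨⟨⟨i, hw2 i hd'⟩, he.symm⟩, hz⟩
      · rintro ⟨⟨i, hi⟩, hz⟩
        have hs : suspLabel w.2 (w.1.1.2 i) = z := congrArg Prod.snd hi
        have hz' : ¬ (_ ∨ _) := fun h =>
          hz (hs.symm.trans ((suspLabel_eq_pt_iff (w.1.2.2.1 i).1).2 h))
        rw [not_or, not_le] at hz'
        exact ⟨hz, w.1.1.2 i, ⟨⟨i, rfl⟩, hz'.1⟩, hz'.2.le, hi.symm⟩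

end Slice

/-! ### Spreading intervals around a height -/

section Spread

/-- A piecewise linear function of the suspension coordinate, equal to `1` for `t ≤ 1/3` and to `-1`
for `t ≥ 2/3`. -/
noncomputable def ramp (t : ℝ) : ℝ := max (-1) (min 1 (3 - 6 * t))

theorem continuous_ramp : Continuous ramp := by unfold ramp; fun_prop

theorem ramp_of_le {t : ℝ} (h : t ≤ 1 / 3) : ramp t = 1 := by
  rw [ramp, min_eq_left (by linarith), max_eq_right (by norm_num)]

theorem ramp_of_ge {t : ℝ} (h : 2 / 3 ≤ t) : ramp t = -1 := by
  rw [ramp, min_eq_right (by linarith), max_eq_left (by linarith)]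

/-- The value `w`, forced into `[-L, L]` prolonged by the part of `[e, 0]` or `[0, e]`. -/
noncomputable def confine (L w e : ℝ) : ℝ := max (-L + min e 0) (min w (L + max e 0))

/-- The target centre of the interval `[a, b]` in the spreading around `0`: if `[a, b]` contains `0`,
then it only depends on the proportion in which `0` divides the interval. -/
noncomputable def spreadCentre (L a b : ℝ) : ℝ :=
  (L + 1) * ramp (-a / (b - a)) + max a 0 - max (-b) 0

/-- The lower end of the room for `[a, b]` in the spreading around `0`. -/
noncomputable def spreadLo (L a b : ℝ) : ℝ := confine L (spreadCentre L a b - 1 / 8) a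

/-- The upper end of the room for `[a, b]` in the spreading around `0`. -/
noncomputable def spreadHi (L a b : ℝ) : ℝ := confine L (spreadCentre L a b + 1 / 8) b

variable {L a b a' b' : ℝ}

theorem spreadCentre_of_nonneg (hab : a < b) (ha : 0 ≤ a) : spreadCentre L a b = L + 1 + a := by
  have : -a / (b - a) ≤ 0 := div_nonpos_of_nonpos_of_nonneg (by linarith) (by linarith)
  rw [spreadCentre, ramp_of_le (by linarith), max_eq_left ha, max_eq_right (by linarith)]
  ring

theorem spreadCentre_of_nonpos (hab : a < b) (hb : b ≤ 0) : spreadCentre L a b = -L - 1 + b := by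
  have : 1 ≤ -a / (b - a) := by
    rw [le_div_iff₀ (by linarith)]
    linarith
  rw [spreadCentre, ramp_of_ge (by linarith), max_eq_right (by linarith), max_eq_left (by linarith)]
  ring

theorem spreadCentre_of_mem (ha : a ≤ 0) (hb : 0 ≤ b) :
    spreadCentre L a b = (L + 1) * ramp (-a / (b - a)) := by
  rw [spreadCentre, max_eq_right ha, max_eq_right (by linarith)]
  ring

/-- For an interval above `0`, the lower end of the room is the lower end shifted by `L`. -/
theorem spreadLo_of_nonneg (hL : 0 ≤ L) (hab : a < b) (ha : 0 ≤ a) : spreadLo L a b = L + a := by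
  rw [spreadLo, spreadCentre_of_nonneg hab ha, confine, max_eq_left ha, min_eq_right ha,
    min_eq_right (by linarith), max_eq_right (by linarith)]

theorem spreadHi_of_nonpos (hL : 0 ≤ L) (hab : a < b) (hb : b ≤ 0) :
    spreadHi L a b = -L + b := by
  rw [spreadHi, spreadCentre_of_nonpos hab hb, confine, max_eq_right hb, min_eq_left hb,
    min_eq_left (by linarith), max_eq_left (by linarith)]

theorem spreadHi_of_nonneg (hL : 0 ≤ L) (hab : a < b) (ha : 0 ≤ a) :
    spreadHi L a b = L + min (1 + a + 1 / 8) b := by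
  have hb : 0 ≤ b := by linarith
  rw [spreadHi, spreadCentre_of_nonneg hab ha, confine, max_eq_left hb, min_eq_right hb,
    ← min_add_add_left, max_eq_right]
  · congr 1; ring
  · exact le_min (by linarith) (by linarith)

theorem spreadLo_of_nonpos (hL : 0 ≤ L) (hab : a < b) (hb : b ≤ 0) :
    spreadLo L a b = -L + max a (-1 + b - 1 / 8) := by
  have ha : a ≤ 0 := by linarith
  rw [spreadLo, spreadCentre_of_nonpos hab hb, confine, max_eq_right ha, min_eq_left ha,
    ← max_add_add_left, min_eq_left (by linarith)]
  congr 1; ring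

theorem le_spreadLo : -L + min a 0 ≤ spreadLo L a b := le_max_left _ _

theorem spreadHi_le (hL : 0 ≤ L) : spreadHi L a b ≤ L + max b 0 :=
  max_le (by linarith [min_le_right b 0, le_max_right b 0]) (min_le_right _ _)

theorem spreadLo_lt_spreadHi (hL : 0 ≤ L) (hab : a < b) : spreadLo L a b < spreadHi L a b := by
  rcases le_total 0 a with ha | ha
  · rw [spreadLo_of_nonneg hL hab ha, spreadHi_of_nonneg hL hab ha]
    have : a < min (1 + a + 1 / 8) b := lt_min (by linarith) hab
    linarith
  rcases le_total b 0 with hb | hb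
  · rw [spreadHi_of_nonpos hL hab hb, spreadLo_of_nonpos hL hab hb]
    have : max a (-1 + b - 1 / 8) < b := max_lt hab (by linarith)
    linarith
  · rcases ha.lt_or_eq with ha' | rfl
    · rcases hb.lt_or_eq with hb' | rfl
      · rw [spreadLo, spreadHi, confine, confine, min_eq_left ha, max_eq_right ha,
          min_eq_right hb, max_eq_left hb]
        set y := spreadCentre L a b
        refine max_lt (lt_max_of_lt_left (by linarith)) ?_
        rcases lt_or_ge (min (y - 1 / 8) (L + 0)) (-L + 0) with h | h
        · exact lt_max_of_lt_left h
        · exact lt_max_of_lt_right (lt_min (lt_of_le_of_lt (min_le_left _ _) (by linarith))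
            (lt_of_le_of_lt (min_le_right _ _) (by linarith)))
      · rw [spreadHi_of_nonpos hL hab le_rfl, spreadLo_of_nonpos hL hab le_rfl]
        have : max a (-1 + 0 - 1 / 8) < 0 := max_lt ha' (by linarith)
        linarith
    · rw [spreadLo_of_nonneg hL hab le_rfl, spreadHi_of_nonneg hL hab le_rfl]
      have : 0 < min (1 + 0 + 1 / 8) b := lt_min (by linarith) hab
      linarith

/-- Disjoint intervals are taken to intervals in the same order, whether or not they contain `0`. -/
theorem spreadHi_le_spreadLo (hL : 0 ≤ L) (hab : a < b) (hab' : a' < b') (h : b < a') :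
    spreadHi L a b ≤ spreadLo L a' b' := by
  rcases le_total b 0 with hb | hb
  · rw [spreadHi_of_nonpos hL hab hb]
    refine le_trans ?_ le_spreadLo
    have := le_min h.le hb
    linarith
  · rw [spreadLo_of_nonneg hL hab' (by linarith)]
    refine (spreadHi_le hL).trans ?_
    rw [max_eq_left hb]
    linarith

theorem continuousAt_spread {W : Type*} [TopologicalSpace W] {l f g : W → ℝ} {w : W}
    (hl : ContinuousAt l w) (hf : ContinuousAt f w) (hg : ContinuousAt g w) (h : f w < g w) :
    ContinuousAt (fun x => spreadLo (l x) (f x) (g x)) w ∧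
      ContinuousAt (fun x => spreadHi (l x) (f x) (g x)) w := by
  have hne : g w - f w ≠ 0 := by linarith [sub_pos.2 h]
  have h1 : ContinuousAt (fun x => ramp (-f x / (g x - f x))) w :=
    continuous_ramp.continuousAt.comp (f := fun x => -f x / (g x - f x))
      (hf.neg.div₀ (hg.sub hf) hne)
  have h2 : ContinuousAt (fun x => spreadCentre (l x) (f x) (g x)) w := by
    unfold spreadCentre
    fun_prop
  constructor
  · unfold spreadLo confine
    fun_prop
  · unfold spreadHi confine
    fun_prop

end Spread

/-! ### Contracting a neighbourhood of the basepoint -/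

/-- An equivariant based homotopy of `X`, starting at the identity, whose end map sends a
neighbourhood of the basepoint to the basepoint; the neighbourhood is `{ρ ≠ 0}` for an invariant
function `ρ` that is `1` at the basepoint. -/
structure LabelContraction (G X : Type*) [Group G] [TopologicalSpace X] [BasedSpace X]
    [MulAction G X] where
  /-- the homotopy -/
  hom : X × I → X
  /-- the function that measures nearness to the basepoint -/
  ρ : X → ℝ
  continuous_hom : Continuous hom
  continuous_ρ : Continuous ρ
  hom_zero : ∀ x, hom (x, 0) = x
  hom_pt : ∀ s, hom (BasedSpace.pt, s) = BasedSpace.pt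
  hom_smul : ∀ (g : G) x s, hom (g • x, s) = g • hom (x, s)
  ρ_nonneg : ∀ x, 0 ≤ ρ x
  ρ_le_one : ∀ x, ρ x ≤ 1
  ρ_pt : ρ BasedSpace.pt = 1
  ρ_smul : ∀ (g : G) x, ρ (g • x) = ρ x
  hom_one : ∀ x, ρ x ≠ 0 → hom (x, 1) = BasedSpace.pt

theorem NondegenerateBasepoint.exists_labelContraction {G X : Type*} [Group G] [TopologicalSpace X]
    [BasedSpace X] [MulAction G X] (h : NondegenerateBasepoint G X) :
    Nonempty (LabelContraction G X) := by
  obtain ⟨r, hr, hfix, hG⟩ := h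
  exact ⟨{
    hom := fun p => (r p).1
    ρ := fun x => (r (x, 1)).2
    continuous_hom := by fun_prop
    continuous_ρ := by fun_prop
    hom_zero := fun x => by rw [hfix _ (Or.inl rfl)]
    hom_pt := fun s => by rw [hfix _ (Or.inr rfl)]
    hom_smul := fun g x s => by rw [hG]
    ρ_nonneg := fun x => (r (x, 1)).2.2.1
    ρ_le_one := fun x => (r (x, 1)).2.2.2
    ρ_pt := by rw [hfix _ (Or.inr rfl)]; rfl
    ρ_smul := fun g x => by rw [hG]
    hom_one := fun x hx => (hr (x, 1)).resolve_left fun h0 => hx (by rw [h0]; rfl) }⟩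

namespace LabelContraction

section Depth

variable {G X : Type*} [Group G] [TopologicalSpace X] [BasedSpace X] [MulAction G X]

theorem label_ne_pt (D : LabelContraction G X) {x : X} (h : D.hom (x, 1) ≠ BasedSpace.pt) :
    D.ρ x = 0 := by
  by_contra hx
  exact h (D.hom_one x hx)

/-- Nearness of the suspension coordinate to the ends: `1` at `0` and `1`, and `0` on
`[1/3, 2/3]`. -/
noncomputable def endDepth (t : ℝ) : ℝ := max 0 (3 * |t - 1 / 2| - 1 / 2)

theorem continuous_endDepth : Continuous endDepth := by unfold endDepth; fun_prop

theorem endDepth_le_one (t : I) : endDepth t ≤ 1 := by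
  have h0 := t.2.1
  have h1 := t.2.2
  refine max_le zero_le_one ?_
  have : |(t : ℝ) - 1 / 2| ≤ 1 / 2 := abs_le.2 ⟨by linarith, by linarith⟩
  linarith

theorem endDepth_end {t : I} (h : t = 0 ∨ t = 1) : endDepth t = 1 := by
  rcases h with rfl | rfl
  · simp only [endDepth, Icc.coe_zero]; norm_num [abs_of_nonneg]
  · simp only [endDepth, Icc.coe_one]; norm_num [abs_of_nonneg]

theorem abs_ramp_of_endDepth_pos {t : ℝ} (h : 0 < endDepth t) : |ramp t| = 1 := by
  rw [endDepth, lt_max_iff] at h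
  have h := h.resolve_left (lt_irrefl 0)
  have h' : 1 / 6 < |t - 1 / 2| := by linarith
  rcases lt_abs.1 h' with h2 | h2
  · rw [ramp_of_ge (by linarith)]; norm_num
  · rw [ramp_of_le (by linarith)]; norm_num

/-- Nearness of a point of `SX` to the basepoint. -/
noncomputable def depth (D : LabelContraction G X) : Susp X → ℝ :=
  Quotient.lift (fun p : I × X => max (D.ρ p.2) (endDepth p.1)) (by
    have key : ∀ p ∈ suspBase X, max (D.ρ p.2) (endDepth p.1) = 1 := by
      rintro ⟨t, x⟩ (h | h | h)
      · exact (max_eq_right ((D.ρ_le_one x).trans (endDepth_end (Or.inl h)).ge)).trans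
          (endDepth_end (Or.inl h))
      · exact (max_eq_right ((D.ρ_le_one x).trans (endDepth_end (Or.inr h)).ge)).trans
          (endDepth_end (Or.inr h))
      · have h : x = BasedSpace.pt := h
        subst h
        exact (max_eq_left ((endDepth_le_one t).trans D.ρ_pt.ge)).trans D.ρ_pt
    rintro a b (rfl | ⟨ha, hb⟩)
    · rfl
    · exact (key a ha).trans (key b hb).symm)

variable (D : LabelContraction G X)

theorem depth_pt : D.depth BasedSpace.pt = 1 := by
  change max (D.ρ BasedSpace.pt) (endDepth (0 : I)) = 1
  rw [D.ρ_pt, endDepth_end (Or.inl rfl), max_self]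

theorem continuous_depth : Continuous D.depth :=
  continuous_quot_lift _ ((D.continuous_ρ.comp continuous_snd).max
    (continuous_endDepth.comp (continuous_subtype_val.comp continuous_fst)))

theorem depth_nonneg (z : Susp X) : 0 ≤ D.depth z := by
  induction z using Quotient.inductionOn with
  | h p => exact (D.ρ_nonneg p.2).trans (le_max_left _ _)

theorem depth_le_one (z : Susp X) : D.depth z ≤ 1 := by
  induction z using Quotient.inductionOn with
  | h p => exact max_le (D.ρ_le_one p.2) (endDepth_le_one p.1)

end Depth

section Spread

variable {G M X : Type*} [Group G] [Finite G] [TopologicalSpace M] [T2Space M] [MulAction G M]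
  [ContinuousConstSMul G M] [TopologicalSpace X] [BasedSpace X] [MulAction G X] [BasedGSpace G X]
  (D : LabelContraction G X)

/-- The amount of room made on either side of the slicing height: a continuous function on
`C_M(SX)` that is at least twice the number of points of depth at most `1/2`. -/
noncomputable def room (ζ : Conf G M (Susp X)) : ℝ :=
  2 * ζ.sum fun z => min 1 (2 - 2 * D.depth z)

theorem room_nonneg (ζ : Conf G M (Susp X)) : 0 ≤ D.room ζ := by
  refine mul_nonneg zero_le_two (Finset.sum_nonneg fun p _ => le_min zero_le_one ?_)
  linarith [D.depth_le_one p.2]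

theorem room_empty {ζ : Conf G M (Susp X)} (h : ζ.carrier = ∅) : D.room ζ = 0 := by
  have : ζ.finite.toFinset = ∅ := by rw [← Finset.coe_eq_empty, Finite.coe_toFinset, h]
  rw [room, Conf.sum, this, Finset.sum_empty, mul_zero]

theorem continuous_room : Continuous (D.room : Conf G M (Susp X) → ℝ) := by
  refine continuous_const.mul (Conf.continuous_sum ?_ ?_)
  · rw [D.depth_pt]; norm_num
  · have := D.continuous_depth
    fun_prop

/-- The disc `d` moved for the time `s` towards its position in the spreading, with room `L`,
around the height `τ`; the label moves along the contraction.  The disc at the end of the motion is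
the middle third of the interval between the two ends of its room, so that it is disjoint from the
discs in neighbouring rooms that share an end with it. -/
noncomputable def move (s : I) (τ L : ℝ) (d : LabelledDisc M X) : LabelledDisc M X :=
  let lo := spreadLo L (d.height - d.radius - τ) (d.height + d.radius - τ)
  let hi := spreadHi L (d.height - d.radius - τ) (d.height + d.radius - τ)
  (d.base, (1 - s) * d.height + s * (τ + L + (lo + hi) / 2),
    (1 - s) * d.radius + s * ((hi - lo) / 6), D.hom (d.label, s))

variable {s : I} {τ L : ℝ} {d d' : LabelledDisc M X}

theorem move_lower : (D.move s τ L d).height - (D.move s τ L d).radius =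
    (1 - s) * (d.height - d.radius) + s * (τ + L +
      (2 * spreadLo L (d.height - d.radius - τ) (d.height + d.radius - τ) +
        spreadHi L (d.height - d.radius - τ) (d.height + d.radius - τ)) / 3) := by
  simp only [move, LabelledDisc.height, LabelledDisc.radius]
  ring

theorem move_upper : (D.move s τ L d).height + (D.move s τ L d).radius =
    (1 - s) * (d.height + d.radius) + s * (τ + L +
      (spreadLo L (d.height - d.radius - τ) (d.height + d.radius - τ) +
        2 * spreadHi L (d.height - d.radius - τ) (d.height + d.radius - τ)) / 3) := by
  simp only [move, LabelledDisc.height, LabelledDisc.radius]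
  ring

theorem convex_lt {s : I} {a b c e : ℝ} (h : a < b) (h' : c < e) :
    (1 - s) * a + s * c < (1 - s) * b + s * e := by
  have h0 := s.2.1
  have h1 := s.2.2
  rcases h0.lt_or_eq with h0' | h0'
  · have := mul_lt_mul_of_pos_left h' h0'
    have := mul_le_mul_of_nonneg_left h.le (sub_nonneg.2 h1)
    linarith
  · rw [← h0']
    linarith

theorem move_radius_pos (hL : 0 ≤ L) (hd : 0 < d.radius) : 0 < (D.move s τ L d).radius := by
  have h := spreadLo_lt_spreadHi hL (a := d.height - d.radius - τ) (b := d.height + d.radius - τ)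
    (by linarith)
  have := convex_lt (s := s) hd (show 0 < (spreadHi L (d.height - d.radius - τ)
    (d.height + d.radius - τ) - spreadLo L (d.height - d.radius - τ)
    (d.height + d.radius - τ)) / 6 by linarith)
  rw [mul_zero, mul_zero, add_zero] at this
  exact this

theorem move_lt_move (hL : 0 ≤ L) (hd : 0 < d.radius) (hd' : 0 < d'.radius)
    (h : d.height + d.radius < d'.height - d'.radius) :
    (D.move s τ L d).height + (D.move s τ L d).radius <
      (D.move s τ L d').height - (D.move s τ L d').radius := by
  rw [move_upper, move_lower]
  have h1 := spreadLo_lt_spreadHi hL (a := d.height - d.radius - τ) (b := d.height + d.radius - τ)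
    (by linarith)
  have h2 := spreadLo_lt_spreadHi hL (a := d'.height - d'.radius - τ)
    (b := d'.height + d'.radius - τ) (by linarith)
  have h3 := spreadHi_le_spreadLo hL (a := d.height - d.radius - τ) (b := d.height + d.radius - τ)
    (a' := d'.height - d'.radius - τ) (b' := d'.height + d'.radius - τ)
    (by linarith) (by linarith) (by linarith)
  exact convex_lt h (by linarith)

theorem apart_move (hL : 0 ≤ L) (hd : 0 < d.radius) (hd' : 0 < d'.radius) (h : d.Apart d') :
    (D.move s τ L d).Apart (D.move s τ L d') := by
  intro hb
  have h1 := h hb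
  have : d.height + d.radius < d'.height - d'.radius ∨
      d'.height + d'.radius < d.height - d.radius := by
    by_contra hcon
    rw [not_or, not_lt, not_lt] at hcon
    have h2 := Set.disjoint_left.1 h1
    refine @h2 (max (d.height - d.radius) (d'.height - d'.radius)) ?_ ?_
    · exact ⟨le_max_left _ _, max_le (by linarith) hcon.1⟩
    · exact ⟨le_max_right _ _, max_le hcon.2 (by linarith)⟩
  rcases this with h2 | h2
  · have := D.move_lt_move (s := s) (τ := τ) hL hd hd' h2
    refine Set.disjoint_left.2 fun y hy hy' => ?_
    linarith [hy.2, hy'.1]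
  · have := D.move_lt_move (s := s) (τ := τ) hL hd' hd h2
    refine Set.disjoint_left.2 fun y hy hy' => ?_
    linarith [hy.1, hy'.2]

theorem inSlab_move {l : ℝ} (hL : 0 ≤ L) (hd : d.InSlab l) :
    (D.move s τ L d).InSlab (l + 2 * s * L) := by
  obtain ⟨h1, h2⟩ := InSlab.bounds hd
  have h0 := hd.1
  have h3 := spreadLo_lt_spreadHi hL (a := d.height - d.radius - τ) (b := d.height + d.radius - τ)
    (by linarith)
  have h4 := le_spreadLo (L := L) (a := d.height - d.radius - τ) (b := d.height + d.radius - τ)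
  have h5 := spreadHi_le hL (a := d.height - d.radius - τ) (b := d.height + d.radius - τ)
  refine inSlab_of_bounds (D.move_radius_pos hL h0) ?_ ?_
  · rw [move_lower]
    have : 0 ≤ τ + L + spreadLo L (d.height - d.radius - τ) (d.height + d.radius - τ) := by
      rcases le_total τ 0 with h | h
      · rw [spreadLo_of_nonneg hL (by linarith) (by linarith)]
        linarith
      · have : -τ ≤ min (d.height - d.radius - τ) 0 := le_min (by linarith) (by linarith)
        linarith
    have := convex_lt (s := s) h1 (show 0 < τ + L +
      (2 * spreadLo L (d.height - d.radius - τ) (d.height + d.radius - τ) +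
        spreadHi L (d.height - d.radius - τ) (d.height + d.radius - τ)) / 3 by linarith)
    linarith
  · rw [move_upper]
    have : τ + L + spreadHi L (d.height - d.radius - τ) (d.height + d.radius - τ) ≤ l + 2 * L := by
      rcases le_total τ l with h | h
      · have : max (d.height + d.radius - τ) 0 ≤ l - τ := max_le (by linarith) (by linarith)
        linarith
      · rw [spreadHi_of_nonpos hL (by linarith) (by linarith)]
        linarith
    have := convex_lt (s := s) h2 (show τ + L +
      (spreadLo L (d.height - d.radius - τ) (d.height + d.radius - τ) +
        2 * spreadHi L (d.height - d.radius - τ) (d.height + d.radius - τ)) / 3 < l + 2 * L by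
      linarith)
    linarith

theorem move_act (g : G) : D.move s τ L (d.act g) = (D.move s τ L d).act g := by
  simp only [move, LabelledDisc.act, LabelledDisc.label, D.hom_smul]

/-- The configuration `c` moved for the time `s` in the spreading around the height `τ`: room is
made on both sides of `τ`, according to the slice of `c` at `τ`. -/
noncomputable def spread (s : I) (τ : ℝ) (c : DiscConf G M X) : DiscConf G M X where
  len := c.len + 2 * s * D.room (c.slice τ)
  carrier := {d | d.label ≠ BasedSpace.pt ∧
    ∃ e ∈ c.carrier, d = D.move s τ (D.room (c.slice τ)) e}
  len_nonneg := add_nonneg c.len_nonneg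
    (mul_nonneg (mul_nonneg zero_le_two s.2.1) (D.room_nonneg _))
  finite := by
    refine (c.finite.image fun e => D.move s τ (D.room (c.slice τ)) e).subset ?_
    rintro _ ⟨-, e, he, rfl⟩
    exact ⟨e, he, rfl⟩
  inSlab := by
    rintro _ ⟨-, e, he, rfl⟩
    exact inSlab_move D (D.room_nonneg _) (c.inSlab e he)
  apart := by
    rintro _ ⟨-, e, he, rfl⟩ _ ⟨-, e', he', rfl⟩ hne
    exact apart_move D (D.room_nonneg _) (c.inSlab e he).1 (c.inSlab e' he').1
      (c.apart e he e' he' fun h => hne (by rw [h]))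
  label_ne := fun _ h => h.1
  act_mem := by
    rintro g _ ⟨hd, e, he, rfl⟩
    exact ⟨smul_ne_pt g hd, e.act g, c.act_mem g e he, (D.move_act g).symm⟩

end Spread
end LabelContraction

/-! ### Slices and spreadings of sums -/

section SpreadSum

variable {G M X : Type*} [Group G] [Finite G] [TopologicalSpace M] [T2Space M] [MulAction G M]
  [ContinuousConstSMul G M] [TopologicalSpace X] [BasedSpace X] [MulAction G X] [BasedGSpace G X]

theorem DiscConf.len_add (c c' : DiscConf G M X) : (c + c').len = c.len + c'.len := rfl

theorem DiscConf.len_zero : (0 : DiscConf G M X).len = 0 := rfl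

theorem DiscConf.eq_zero {c : DiscConf G M X} (h : c.len = 0) : c = 0 := by
  refine DiscConf.ext h (eq_empty_of_forall_notMem fun d hd => ?_)
  have := InSlab.bounds (c.inSlab d hd)
  linarith [(c.inSlab d hd).1]

theorem suspLabel_shift (τ l : ℝ) (d : LabelledDisc M X) :
    suspLabel τ (shift l d) = suspLabel (τ - l) d := by
  simp only [suspLabel, shift, LabelledDisc.height, LabelledDisc.radius, LabelledDisc.label]
  congr 3
  ring

theorem DiscConf.slice_eq_empty {c : DiscConf G M X} {τ : ℝ} (h : τ ≤ 0 ∨ c.len ≤ τ) :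
    c.slice τ = Conf.empty G M (Susp X) := by
  refine Conf.ext (eq_empty_of_forall_notMem ?_)
  rintro y ⟨-, d, hd, hτ, -⟩
  have := InSlab.bounds (c.inSlab d hd)
  rw [abs_le] at hτ
  rcases h with h | h <;> linarith

theorem DiscConf.slice_add_of_le {c c' : DiscConf G M X} {τ : ℝ} (h : τ ≤ c.len) :
    (c + c').slice τ = c.slice τ := by
  refine Conf.ext (Set.ext fun y => ⟨?_, ?_⟩)
  · rintro ⟨hy, d, hd | ⟨d, hd, rfl⟩, hτ, rfl⟩
    · exact ⟨hy, d, hd, hτ, rfl⟩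
    · have := InSlab.bounds (c'.inSlab d hd)
      rw [abs_le] at hτ
      simp only [shift, LabelledDisc.height, LabelledDisc.radius] at hτ this
      linarith
  · rintro ⟨hy, d, hd, hτ, rfl⟩
    exact ⟨hy, d, Or.inl hd, hτ, rfl⟩

theorem DiscConf.slice_add_of_ge {c c' : DiscConf G M X} {τ : ℝ} (h : c.len ≤ τ) :
    (c + c').slice τ = c'.slice (τ - c.len) := by
  refine Conf.ext (Set.ext fun y => ⟨?_, ?_⟩)
  · rintro ⟨hy, d, hd | ⟨d, hd, rfl⟩, hτ, rfl⟩
    · have := InSlab.bounds (c.inSlab d hd)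
      rw [abs_le] at hτ
      linarith
    · refine ⟨hy, d, hd, ?_, ?_⟩
      · change |τ - (c.len + d.height)| ≤ _ at hτ
        rwa [sub_sub]
      · rw [suspLabel_shift]; rfl
  · rintro ⟨hy, d, hd, hτ, rfl⟩
    refine ⟨hy, shift c.len d, Or.inr ⟨d, hd, rfl⟩, ?_, ?_⟩
    · change |τ - (c.len + d.height)| ≤ _
      rwa [← sub_sub]
    · rw [suspLabel_shift]; rfl

theorem DiscTuple.continuous_disc {q : ℕ} (i : Fin q) :
    Continuous fun f : DiscTuple G M X q => f.1.2 i :=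
  (continuous_apply i).comp (continuous_snd.comp continuous_subtype_val)

theorem DiscTuple.continuous_toDiscConf {q : ℕ} :
    Continuous fun f : DiscTuple G M X q => toDiscConf ⟨q, f⟩ :=
  isQuotientMap_toDiscConf.continuous.comp continuous_sigmaMk

namespace LabelContraction

variable (D : LabelContraction G X)

theorem continuousAt_move {W : Type*} [TopologicalSpace W] {s : W → I} {τ L : W → ℝ}
    {d : W → LabelledDisc M X} {w : W} (hs : ContinuousAt s w) (hτ : ContinuousAt τ w)
    (hL : ContinuousAt L w) (hd : ContinuousAt d w) (h : 0 < (d w).radius) :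
    ContinuousAt (fun w => D.move (s w) (τ w) (L w) (d w)) w := by
  have hb : ContinuousAt (fun w => (d w).base) w := continuousAt_fst.comp hd
  have hh : ContinuousAt (fun w => (d w).height) w := continuousAt_fst.comp (continuousAt_snd.comp hd)
  have hr : ContinuousAt (fun w => (d w).radius) w :=
    continuousAt_fst.comp (continuousAt_snd.comp (continuousAt_snd.comp hd))
  have hl : ContinuousAt (fun w => (d w).label) w :=
    continuousAt_snd.comp (continuousAt_snd.comp (continuousAt_snd.comp hd))
  have hs' : ContinuousAt (fun w => (s w : ℝ)) w := continuous_subtype_val.continuousAt.comp hs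
  obtain ⟨h1, h2⟩ := continuousAt_spread hL ((hh.sub hr).sub hτ) ((hh.add hr).sub hτ)
    (show (d w).height - (d w).radius - τ w < (d w).height + (d w).radius - τ w by linarith)
  have h3 := ((continuousAt_const (y := (1 : ℝ)).sub hs').mul hh).add
    (hs'.mul ((hτ.add hL).add ((h1.add h2).div_const 2)))
  have h4 := ((continuousAt_const (y := (1 : ℝ)).sub hs').mul hr).add
    (hs'.mul ((h2.sub h1).div_const 6))
  have h5 : ContinuousAt (fun w => D.hom ((d w).label, s w)) w :=
    ContinuousAt.comp (f := fun w => ((d w).label, s w)) (g := D.hom)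
      D.continuous_hom.continuousAt (hl.prodMk hs)
  exact hb.prodMk (h3.prodMk (h4.prodMk h5))

theorem continuous_room_slice :
    Continuous fun p : DiscConf G M X × ℝ => D.room (p.1.slice p.2) :=
  D.continuous_room.comp continuous_slice

theorem continuous_spread :
    Continuous fun p : DiscConf G M X × (ℝ × I) => D.spread p.2.2 p.2.1 p.1 := by
  refine DiscConf.continuous_of_tuples fun q => continuous_iff_continuousAt.2 fun w₀ => ?_
  have hroom : Continuous fun w : DiscTuple G M X q × (ℝ × I) =>
      D.room ((toDiscConf ⟨q, w.1⟩).slice w.2.1) := by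
    have h1 : Continuous fun w : DiscTuple G M X q × (ℝ × I) =>
        (toDiscConf ⟨q, w.1⟩, w.2.1) :=
      (DiscTuple.continuous_toDiscConf.comp continuous_fst).prodMk
        (continuous_fst.comp continuous_snd)
    simpa only [Function.comp_def] using (D.continuous_room_slice (M := M)).comp h1
  refine DiscConf.continuousAt_of_family (ι := Fin q)
    (fun w i => D.move w.2.2 w.2.1 (D.room ((toDiscConf ⟨q, w.1⟩).slice w.2.1)) (w.1.1.2 i))
    ?_ (fun i => ?_) (Eventually.of_forall fun w => ⟨?_, ?_, ?_, ?_⟩)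
  · have hlen : Continuous fun w : DiscTuple G M X q × (ℝ × I) => w.1.1.1 :=
      continuous_fst.comp (continuous_subtype_val.comp continuous_fst)
    exact (hlen.add ((continuous_const.mul (continuous_subtype_val.comp
      (continuous_snd.comp continuous_snd))).mul hroom)).continuousAt
  · exact D.continuousAt_move (continuous_snd.comp continuous_snd).continuousAt
      (continuous_fst.comp continuous_snd).continuousAt hroom.continuousAt
      ((DiscTuple.continuous_disc i).comp continuous_fst).continuousAt (w₀.1.2.2.1 i).1
  · exact fun i => inSlab_move D (D.room_nonneg _) (w.1.2.2.1 i)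
  · exact fun i j hij => apart_move D (D.room_nonneg _) (w.1.2.2.1 i).1 (w.1.2.2.1 j).1
      (w.1.2.2.2.1 i j hij)
  · intro g i
    obtain ⟨j, hj⟩ := w.1.2.2.2.2 g i
    exact ⟨j, by rw [← D.move_act, hj]⟩
  · ext d
    constructor
    · rintro ⟨hd, e, ⟨⟨i, rfl⟩, he⟩, rfl⟩
      exact ⟨⟨i, rfl⟩, hd⟩
    · rintro ⟨⟨i, rfl⟩, hd⟩
      refine ⟨hd, w.1.1.2 i, ⟨⟨i, rfl⟩, fun h => hd ?_⟩, rfl⟩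
      change D.hom ((w.1.1.2 i).label, w.2.2) = _
      rw [h, D.hom_pt]

variable {s : I} {τ L : ℝ} {d : LabelledDisc M X}

/-- Discs below the height stay where they are, whatever the room is. -/
theorem move_of_le (hL : 0 ≤ L) (hd : 0 < d.radius) (h : d.height + d.radius ≤ τ) :
    D.move s τ L d = D.move s τ 0 d := by
  have hab : d.height - d.radius - τ < d.height + d.radius - τ := by linarith
  have hb : d.height + d.radius - τ ≤ 0 := by linarith
  simp only [move, spreadHi_of_nonpos hL hab hb, spreadHi_of_nonpos le_rfl hab hb,
    spreadLo_of_nonpos hL hab hb, spreadLo_of_nonpos le_rfl hab hb]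
  refine Prod.ext rfl (Prod.ext ?_ (Prod.ext ?_ rfl)) <;> simp only <;> ring

/-- Discs above the height are shifted by the room made on its two sides. -/
theorem move_of_ge (hL : 0 ≤ L) (hd : 0 < d.radius) (h : τ ≤ d.height - d.radius) :
    D.move s τ L d = shift (2 * s * L) (D.move s τ 0 d) := by
  have hab : d.height - d.radius - τ < d.height + d.radius - τ := by linarith
  have ha : 0 ≤ d.height - d.radius - τ := by linarith
  simp only [move, shift, spreadHi_of_nonneg hL hab ha, spreadHi_of_nonneg le_rfl hab ha,
    spreadLo_of_nonneg hL hab ha, spreadLo_of_nonneg le_rfl hab ha]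
  refine Prod.ext rfl (Prod.ext ?_ (Prod.ext ?_ rfl)) <;> simp only <;> ring

theorem move_shift (l : ℝ) : D.move s τ L (shift l d) = shift l (D.move s (τ - l) L d) := by
  have h1 : l + d.height - d.radius - τ = d.height - d.radius - (τ - l) := by ring
  have h2 : l + d.height + d.radius - τ = d.height + d.radius - (τ - l) := by ring
  simp only [move, shift, LabelledDisc.height, LabelledDisc.radius] at h1 h2 ⊢
  rw [h1, h2]
  refine Prod.ext rfl (Prod.ext ?_ (Prod.ext ?_ rfl)) <;> simp only
  ring

/-- Spreading is compatible with juxtaposition: a summand that does not contain the slicing height has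
an empty slice there, hence gets no room. -/
theorem spread_add (c c' : DiscConf G M X) :
    D.spread s τ (c + c') = D.spread s τ c + D.spread s (τ - c.len) c' := by
  rcases le_total τ c.len with h | h
  · have h1 := DiscConf.slice_add_of_le (c := c) (c' := c') h
    have h2 : D.room (c'.slice (τ - c.len)) = 0 := by
      rw [DiscConf.slice_eq_empty (Or.inl (by linarith))]
      exact D.room_empty rfl
    have key : ∀ d ∈ c'.carrier, D.move s τ (D.room (c.slice τ)) (shift c.len d) =
        shift (c.len + 2 * s * D.room (c.slice τ)) (D.move s (τ - c.len) 0 d) := by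
      intro d hd
      have hb := InSlab.bounds (c'.inSlab d hd)
      rw [D.move_of_ge (D.room_nonneg _) (d := shift c.len d) (c'.inSlab d hd).1, move_shift,
        shift_shift, add_comm]
      change τ ≤ c.len + d.height - d.radius
      linarith
    refine DiscConf.ext ?_ (Set.ext fun e => ⟨?_, ?_⟩)
    · simp only [spread, DiscConf.len_add, h1, h2]
      ring
    · rintro ⟨he, d, hd | ⟨d, hd, rfl⟩, rfl⟩
      · rw [h1] at he ⊢
        exact Or.inl ⟨he, d, hd, rfl⟩
      · rw [h1, key d hd] at he ⊢
        refine Or.inr ⟨D.move s (τ - c.len) 0 d, ⟨he, d, hd, ?_⟩, rfl⟩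
        rw [h2]
    · rintro (⟨he, d, hd, rfl⟩ | ⟨_, ⟨he, d, hd, rfl⟩, rfl⟩)
      · exact ⟨he, d, Or.inl hd, by rw [h1]⟩
      · refine ⟨he, _, Or.inr ⟨d, hd, rfl⟩, ?_⟩
        rw [h1, key d hd, h2]
        rfl
  · have h1 := DiscConf.slice_add_of_ge (c := c) (c' := c') h
    have h2 : D.room (c.slice τ) = 0 := by
      rw [DiscConf.slice_eq_empty (Or.inr h)]
      exact D.room_empty rfl
    have hlen : (D.spread s τ c).len = c.len := by
      simp only [spread, h2, mul_zero, add_zero]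
    have key : ∀ d ∈ c.carrier, ∀ L, 0 ≤ L → D.move s τ L d = D.move s τ 0 d := by
      intro d hd L hL
      have hb := InSlab.bounds (c.inSlab d hd)
      exact D.move_of_le hL (c.inSlab d hd).1 (by linarith)
    refine DiscConf.ext ?_ (Set.ext fun e => ⟨?_, ?_⟩)
    · rw [DiscConf.len_add, hlen]
      simp only [spread, DiscConf.len_add, h1]
      ring
    · rintro ⟨he, d, hd | ⟨d, hd, rfl⟩, rfl⟩
      · rw [key d hd _ (D.room_nonneg _)] at he ⊢
        refine Or.inl ⟨he, d, hd, ?_⟩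
        rw [h2]
      · rw [h1, move_shift] at he ⊢
        refine Or.inr ⟨D.move s (τ - c.len) (D.room (c'.slice (τ - c.len))) d,
          ⟨he, d, hd, rfl⟩, ?_⟩
        rw [hlen]
    · rintro (⟨he, d, hd, rfl⟩ | ⟨_, ⟨he, d, hd, rfl⟩, rfl⟩)
      · refine ⟨he, d, Or.inl hd, ?_⟩
        rw [h2, key d hd _ (D.room_nonneg _)]
      · refine ⟨he, _, Or.inr ⟨d, hd, rfl⟩, ?_⟩
        rw [h1, move_shift, hlen]

theorem spread_zero (c : DiscConf G M X) : D.spread 0 τ c = c := by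
  have key : ∀ L (d : LabelledDisc M X), D.move 0 τ L d = d := by
    intro L d
    refine Prod.ext rfl (Prod.ext ?_ (Prod.ext ?_ (D.hom_zero _))) <;> simp [move]
  refine DiscConf.ext (by simp [spread]) (Set.ext fun e => ⟨?_, fun he => ?_⟩)
  · rintro ⟨he, d, hd, rfl⟩
    rwa [key]
  · exact ⟨c.label_ne e he, e, he, (key _ e).symm⟩

end LabelContraction
end SpreadSum

/-! ### Points of the classifying space as weighted cuts of a configuration on a line -/

section LineConf

/-- A finite `G`-closed collection of disjoint labelled discs in `M × ℝ`, with no length. -/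
structure LineConf (G M X : Type*) [Group G] [MulAction G M] [BasedSpace X] [MulAction G X] where
  /-- the labelled discs, with label different from the basepoint -/
  carrier : Set (LabelledDisc M X)
  finite : carrier.Finite
  radius_pos : ∀ d ∈ carrier, 0 < d.radius
  apart : ∀ d ∈ carrier, ∀ d' ∈ carrier, d ≠ d' → d.Apart d'
  label_ne : ∀ d ∈ carrier, d.label ≠ BasedSpace.pt
  act_mem : ∀ (g : G), ∀ d ∈ carrier, d.act g ∈ carrier

variable {G M X : Type*} [Group G] [MulAction G M] [BasedSpace X] [MulAction G X]

/-- Forget the length. -/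
def DiscConf.toLine (c : DiscConf G M X) : LineConf G M X where
  carrier := c.carrier
  finite := c.finite
  radius_pos := fun d hd => (c.inSlab d hd).1
  apart := c.apart
  label_ne := c.label_ne
  act_mem := c.act_mem

theorem shift_injective (x : ℝ) : Function.Injective (shift x : LabelledDisc M X → _) := by
  intro d d' h
  have := congrArg (shift (-x)) h
  simpa [shift_shift, shift_zero] using this

/-- No disc of the collection meets `M × {x}`. -/
def LineConf.Clean (S : LineConf G M X) (x : ℝ) : Prop :=
  ∀ d ∈ S.carrier, d.height + d.radius < x ∨ x < d.height - d.radius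

/-- The part of a collection in `M × (x, y)`, moved to `M × (0, y - x)`. -/
def LineConf.restr (S : LineConf G M X) (x y : ℝ) : DiscConf G M X where
  len := max 0 (y - x)
  carrier := {d | shift x d ∈ S.carrier ∧ d.InSlab (max 0 (y - x))}
  len_nonneg := le_max_left _ _
  finite := (S.finite.preimage (shift_injective x).injOn).subset fun _ h => h.1
  inSlab := fun _ h => h.2
  apart := by
    intro d hd d' hd' hne hb
    have := S.apart _ hd.1 _ hd'.1 (fun h => hne (shift_injective x h)) hb
    have h := Set.disjoint_left.1 this
    refine Set.disjoint_left.2 fun z hz hz' => @h (x + z) ?_ ?_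
    · exact mem_interval_shift.2 (by simpa using hz)
    · exact mem_interval_shift.2 (by simpa using hz')
  label_ne := fun d hd => S.label_ne (shift x d) hd.1
  act_mem := fun g d hd => ⟨S.act_mem g _ hd.1, hd.2⟩

theorem LineConf.len_restr (S : LineConf G M X) {x y : ℝ} (h : x ≤ y) :
    (S.restr x y).len = y - x := max_eq_right (sub_nonneg.2 h)

theorem LineConf.mem_restr {S : LineConf G M X} {x y : ℝ} (h : x ≤ y) {d : LabelledDisc M X} :
    d ∈ (S.restr x y).carrier ↔
      shift x d ∈ S.carrier ∧ 0 < d.height - d.radius ∧ d.height + d.radius < y - x := by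
  change (_ ∧ d.InSlab (max 0 (y - x))) ↔ _
  rw [max_eq_right (sub_nonneg.2 h)]
  refine and_congr_right fun hd => ⟨InSlab.bounds, fun h => ?_⟩
  exact inSlab_of_bounds (S.radius_pos (shift x d) hd) h.1 h.2

theorem LineConf.restr_add (S : LineConf G M X) {x y z : ℝ} (hxy : x ≤ y) (hyz : y ≤ z)
    (hy : S.Clean y) : S.restr x y + S.restr y z = S.restr x z := by
  refine DiscConf.ext ?_ (Set.ext fun d => ?_)
  · change (S.restr x y).len + (S.restr y z).len = _
    rw [len_restr S hxy, len_restr S hyz, len_restr S (hxy.trans hyz)]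
    ring
  · change d ∈ (S.restr x y).carrier ∪ shift (S.restr x y).len '' (S.restr y z).carrier ↔ _
    rw [len_restr S hxy, mem_restr (hxy.trans hyz), mem_union, mem_restr hxy]
    constructor
    · rintro (⟨h, h1, h2⟩ | ⟨e, he, rfl⟩)
      · exact ⟨h, h1, by linarith⟩
      · obtain ⟨h, h1, h2⟩ := (mem_restr hyz).1 he
        have hr := S.radius_pos _ h
        rw [shift_shift, add_sub_cancel]
        simp only [shift, LabelledDisc.height, LabelledDisc.radius] at h1 h2 hr ⊢
        exact ⟨h, by linarith, by linarith⟩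
    · rintro ⟨h, h1, h2⟩
      rcases hy _ h with h3 | h3
      · simp only [shift, LabelledDisc.height, LabelledDisc.radius] at h1 h2 h3 ⊢
        exact Or.inl ⟨h, h1, by linarith⟩
      · refine Or.inr ⟨shift (-(y - x)) d, (mem_restr hyz).2 ⟨?_, ?_, ?_⟩, ?_⟩
        · rw [shift_shift]
          convert h using 2
          ring
        · simp only [shift, LabelledDisc.height, LabelledDisc.radius] at h1 h2 h3 ⊢
          linarith
        · simp only [shift, LabelledDisc.height, LabelledDisc.radius] at h1 h2 h3 ⊢
          linarith
        · rw [shift_shift, add_neg_cancel, shift_zero]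

theorem LineConf.restr_self (S : LineConf G M X) (x : ℝ) : S.restr x x = 0 := by
  refine DiscConf.ext (by rw [len_restr S le_rfl, sub_self]; rfl) ?_
  refine eq_empty_of_forall_notMem fun d hd => ?_
  obtain ⟨h, h1, h2⟩ := (mem_restr le_rfl).1 hd
  have := S.radius_pos _ h
  simp only [shift, LabelledDisc.radius, LabelledDisc.height] at this h1 h2
  linarith

/-- A collection is determined on `[x', y']` by its restriction to a larger interval. -/
theorem LineConf.restr_congr {S S' : LineConf G M X} {a x y x' y' : ℝ} (hx : x ≤ x') (hxy : x' ≤ y')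
    (hy : y' ≤ y) (h : S.restr x y = S'.restr (a + x) (a + y)) :
    S.restr x' y' = S'.restr (a + x') (a + y') := by
  have key : ∀ {η : LineConf G M X} {b : ℝ} {d : LabelledDisc M X},
      d ∈ (η.restr (b + x') (b + y')).carrier ↔
        shift (x' - x) d ∈ (η.restr (b + x) (b + y)).carrier ∧ 0 < d.height - d.radius ∧
          d.height + d.radius < y' - x' := by
    intro η b d
    rw [mem_restr (by linarith), mem_restr (by linarith), shift_shift,
      show b + x + (x' - x) = b + x' by ring]
    simp only [shift, LabelledDisc.radius, LabelledDisc.height]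
    constructor
    · rintro ⟨h, h1, h2⟩
      exact ⟨⟨h, by linarith, by linarith⟩, by linarith, by linarith⟩
    · rintro ⟨⟨h, -, -⟩, h1, h2⟩
      exact ⟨h, h1, by linarith⟩
  refine DiscConf.ext ?_ (Set.ext fun d => ?_)
  · rw [len_restr _ hxy, len_restr _ (by linarith)]
    ring
  · have h1 := key (η := S) (b := 0) (d := d)
    simp only [zero_add] at h1
    rw [h1, key, h]

theorem DiscConf.restr_toLine (c : DiscConf G M X) : c.toLine.restr 0 c.len = c := by
  refine DiscConf.ext (by rw [LineConf.len_restr _ c.len_nonneg, sub_zero]) (Set.ext fun d => ?_)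
  rw [LineConf.mem_restr c.len_nonneg, shift_zero, sub_zero]
  exact ⟨fun h => h.1, fun h => ⟨h, InSlab.bounds (c.inSlab d h)⟩⟩

theorem DiscConf.restr_add_left (c c' : DiscConf G M X) :
    (c + c').toLine.restr 0 c.len = c := by
  refine DiscConf.ext (by rw [LineConf.len_restr _ c.len_nonneg, sub_zero]) (Set.ext fun d => ?_)
  rw [LineConf.mem_restr c.len_nonneg, shift_zero, sub_zero]
  constructor
  · rintro ⟨h | ⟨e, he, rfl⟩, h1, h2⟩
    · exact h
    · have := InSlab.bounds (c'.inSlab e he)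
      have hr := (c'.inSlab e he).1
      simp only [shift, LabelledDisc.radius, LabelledDisc.height] at this h1 h2 hr
      linarith
  · exact fun h => ⟨Or.inl h, InSlab.bounds (c.inSlab d h)⟩

theorem DiscConf.restr_add_right (c c' : DiscConf G M X) :
    (c + c').toLine.restr c.len (c.len + c'.len) = c' := by
  have hl := c'.len_nonneg
  refine DiscConf.ext (by rw [LineConf.len_restr _ (by linarith)]; ring) (Set.ext fun d => ?_)
  rw [LineConf.mem_restr (by linarith), add_sub_cancel_left]
  constructor
  · rintro ⟨h | ⟨e, he, h⟩, h1, h2⟩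
    · have := InSlab.bounds (c.inSlab _ h)
      have hr := (c.inSlab _ h).1
      simp only [shift, LabelledDisc.radius, LabelledDisc.height] at this h1 h2 hr
      linarith
    · rwa [← shift_injective _ h]
  · exact fun h => ⟨Or.inr ⟨d, h, rfl⟩, InSlab.bounds (c'.inSlab d h)⟩

theorem DiscConf.clean_add (c c' : DiscConf G M X) : (c + c').toLine.Clean c.len := by
  rintro d (hd | ⟨d, hd, rfl⟩)
  · exact Or.inl (InSlab.bounds (c.inSlab d hd)).2
  · have := (InSlab.bounds (c'.inSlab d hd)).1
    simp only [shift, LabelledDisc.radius, LabelledDisc.height] at this ⊢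
    exact Or.inr (by linarith)

theorem exists_partialSum_add {n : ℕ} {C : Type*} [AddMonoid C] (c : Fin n → C) (i : Fin (n + 1)) :
    ∃ r, Fin.partialSum c i + r = Fin.partialSum c (Fin.last n) := by
  induction i using Fin.reverseInduction with
  | last => exact ⟨0, add_zero _⟩
  | cast i ih =>
    obtain ⟨r, hr⟩ := ih
    exact ⟨c i + r, by rw [← hr, Fin.partialSum_succ, add_assoc]⟩

variable {n : ℕ} (c : Fin n → DiscConf G M X)

theorem DiscConf.monotone_len_partialSum : Monotone fun i => (Fin.partialSum c i).len := by
  refine Fin.monotone_iff_le_succ.2 fun i => ?_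
  rw [Fin.partialSum_succ]
  exact le_add_of_nonneg_right (c i).len_nonneg

theorem DiscConf.len_partialSum_succ (i : Fin n) :
    (Fin.partialSum c i.succ).len = (Fin.partialSum c i.castSucc).len + (c i).len := by
  rw [Fin.partialSum_succ]
  rfl

theorem DiscConf.clean_partialSum (i : Fin (n + 1)) :
    (Fin.partialSum c (Fin.last n)).toLine.Clean (Fin.partialSum c i).len := by
  obtain ⟨r, hr⟩ := exists_partialSum_add c i
  rw [← hr]
  exact DiscConf.clean_add _ _

theorem DiscConf.restr_partialSum (i : Fin n) :
    (Fin.partialSum c (Fin.last n)).toLine.restr (Fin.partialSum c i.castSucc).len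
      (Fin.partialSum c i.succ).len = c i := by
  obtain ⟨r, hr⟩ := exists_partialSum_add c i.succ
  have h0 := (Fin.partialSum c i.castSucc).len_nonneg
  have h1 := (c i).len_nonneg
  have hs := DiscConf.len_partialSum_succ c i
  have h2 := DiscConf.restr_add_left (Fin.partialSum c i.succ) r
  rw [hr, hs, Fin.partialSum_succ] at h2
  have h3 := DiscConf.restr_add_right (Fin.partialSum c i.castSucc) (c i)
  rw [hs]
  refine Eq.trans ?_ h3
  have h4 := DiscConf.restr_toLine (Fin.partialSum c i.castSucc + c i)
  have := LineConf.restr_congr (S := (Fin.partialSum c (Fin.last n)).toLine)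
    (S' := (Fin.partialSum c i.castSucc + c i).toLine) (a := 0) (x := 0)
    (x' := (Fin.partialSum c i.castSucc).len)
    (y' := (Fin.partialSum c i.castSucc).len + (c i).len)
    (y := (Fin.partialSum c i.castSucc).len + (c i).len) h0 (by linarith) le_rfl
    (by
      rw [h2, zero_add, zero_add]
      exact h4.symm)
  simpa only [zero_add] using this

end LineConf

section Realization

variable {G M X : Type*} [Group G] [MulAction G M] [TopologicalSpace M] [TopologicalSpace X]
  [BasedSpace X] [MulAction G X] [BasedGSpace G X]

theorem stdSimplex.sum_single_map {A B : Type*} [Fintype A] [Fintype B] (f : A → B) (x : B → ℝ)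
    (p : stdSimplex ℝ A) :
    ∑ b, Finsupp.single (x b) (stdSimplex.map f p b) = ∑ a, Finsupp.single (x (f a)) (p a) := by
  classical
  simp only [stdSimplex.map_coe, FunOnFinite.linearMap_apply_apply]
  simp only [Finsupp.single_finsetSum]
  rw [← Finset.sum_fiberwise Finset.univ f fun a => Finsupp.single (x (f a)) (p a)]
  refine Finset.sum_congr rfl fun b _ => Finset.sum_congr rfl fun a ha => ?_
  rw [(Finset.mem_filter.1 ha).2]

open Classical in
/-- The point of the classifying space given by a configuration on a line and a probability measure
with finite support: the support cuts the configuration into an element of the nerve, and the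
weights are the barycentric coordinates.  The value is a junk point if `μ` is not a probability
measure, and discs that meet a point of the support are lost. -/
noncomputable def LineConf.cut (S : LineConf G M X) (μ : ℝ →₀ ℝ) :
    ClassifyingSpace (DiscConf G M X) :=
  if h : ((∀ x, 0 ≤ μ x) ∧ μ.sum (fun _ a => a) = 1) ∧ μ.support.card = μ.support.card - 1 + 1 then
    ClassifyingSpace.mk (n := μ.support.card - 1)
      (fun l => S.restr (μ.support.orderEmbOfFin h.2 l.castSucc)
        (μ.support.orderEmbOfFin h.2 l.succ))
      ⟨fun i => μ (μ.support.orderEmbOfFin h.2 i), fun _ => h.1.1 _, by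
        refine Eq.trans ?_ h.1.2
        change _ = ∑ y ∈ μ.support, μ y
        conv_rhs => rw [← Finset.map_orderEmbOfFin_univ μ.support h.2]
        rw [Finset.sum_map]
        rfl⟩
  else ClassifyingSpace.mk (n := 0) Fin.elim0 (stdSimplex.vertex 0)

theorem LineConf.cut_of_strictMono (S : LineConf G M X) {n : ℕ} {x : Fin (n + 1) → ℝ}
    (hx : StrictMono x) (p : stdSimplex ℝ (Fin (n + 1))) (hp : ∀ i, p i ≠ 0) :
    ClassifyingSpace.mk (fun l : Fin n => S.restr (x l.castSucc) (x l.succ)) p =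
      S.cut (∑ i, Finsupp.single (x i) (p i)) := by
  classical
  set μ := ∑ i, Finsupp.single (x i) (p i) with hμ
  have happ : ∀ i, μ (x i) = p i := by
    intro i
    rw [hμ, Finsupp.finsetSum_apply, Finset.sum_eq_single i]
    · simp
    · intro j _ hj
      exact Finsupp.single_eq_of_ne (fun h => hj (hx.injective h.symm))
    · simp
  have hsupp : μ.support = Finset.univ.map ⟨x, hx.injective⟩ := by
    ext y
    rw [Finsupp.mem_support_iff, Finset.mem_map]
    constructor
    · intro hy
      by_contra hcon
      apply hy
      rw [hμ, Finsupp.finsetSum_apply]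
      refine Finset.sum_eq_zero fun i _ => Finsupp.single_eq_of_ne fun h => hcon ⟨i, by simp, h.symm⟩
    · rintro ⟨i, -, rfl⟩
      change μ (x i) ≠ 0
      rw [happ]
      exact hp i
  have hcard : μ.support.card = n + 1 := by rw [hsupp]; simp
  have hpos : ∀ y, 0 ≤ μ y := by
    intro y
    rw [hμ, Finsupp.finsetSum_apply]
    refine Finset.sum_nonneg fun i _ => ?_
    rw [Finsupp.single_apply]
    split_ifs
    · exact stdSimplex.zero_le p i
    · exact le_rfl
  have hsum : μ.sum (fun _ a => a) = 1 := by
    rw [Finsupp.sum, hsupp, Finset.sum_map, ← stdSimplex.sum_eq_one p]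
    exact Finset.sum_congr rfl fun i _ => happ i
  rw [cut, dif_pos ⟨⟨hpos, hsum⟩, by omega⟩]
  have key : ∀ (m : ℕ) (hm : μ.support.card = m + 1) (hm' : _), m = n →
      ClassifyingSpace.mk (fun l : Fin n => S.restr (x l.castSucc) (x l.succ)) p =
      ClassifyingSpace.mk (n := m) (fun l => S.restr (μ.support.orderEmbOfFin hm l.castSucc)
        (μ.support.orderEmbOfFin hm l.succ)) ⟨fun i => μ (μ.support.orderEmbOfFin hm i), hm'⟩ := by
    rintro m hm hm' rfl
    have h1 : x = μ.support.orderEmbOfFin hm := Finset.orderEmbOfFin_unique hm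
      (fun i => by rw [hsupp]; exact Finset.mem_map_of_mem _ (Finset.mem_univ i)) hx
    congr 1
    · rw [← h1]
    · ext i
      change p i = μ (μ.support.orderEmbOfFin hm i)
      rw [← h1, happ]
  exact key _ _ _ (by omega)

/-- A point of the classifying space is determined by the measure of its cuts: cuts of weight zero
are removed by the face identifications, and repeated cuts by the degeneracies. -/
theorem LineConf.mk_eq_cut (S : LineConf G M X) : ∀ {n : ℕ} {x : Fin (n + 1) → ℝ}
    (_ : Monotone x) (_ : ∀ i, S.Clean (x i)) (p : stdSimplex ℝ (Fin (n + 1))),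
    ClassifyingSpace.mk (fun l : Fin n => S.restr (x l.castSucc) (x l.succ)) p =
      S.cut (∑ i, Finsupp.single (x i) (p i)) := by
  intro n
  induction n with
  | zero =>
    intro x hx hc p
    have : Subsingleton (Fin (0 + 1)) := inferInstanceAs (Subsingleton (Fin 1))
    refine S.cut_of_strictMono (Subsingleton.strictMono x) p fun i => ?_
    have := stdSimplex.sum_eq_one p
    rw [Fintype.sum_subsingleton _ i] at this
    rw [this]
    exact one_ne_zero
  | succ n ih =>
    intro x hx hc p
    by_cases h0 : ∃ i, p i = 0
    · obtain ⟨i, hi⟩ := h0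
      let p' : stdSimplex ℝ (Fin (n + 1)) := ⟨fun j => p (i.succAbove j),
        fun j => stdSimplex.zero_le p _, by
          have := stdSimplex.sum_eq_one p
          rwa [Fin.sum_univ_succAbove _ i, hi, zero_add] at this⟩
      have hp' : ∀ j, p' j = p (i.succAbove j) := fun j => rfl
      have hp : p = stdSimplex.map i.succAbove p' := by
        ext j
        rw [stdSimplex.map_coe, FunOnFinite.linearMap_apply_apply]
        rcases Fin.eq_self_or_eq_succAbove i j with rfl | ⟨k, rfl⟩
        · rw [hi, Finset.sum_eq_zero]
          intro k hk
          exact absurd (Finset.mem_filter.1 hk).2 (Fin.succAbove_ne _ _)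
        · rw [Finset.sum_eq_single k]
          · rfl
          · intro l hl hlk
            exact absurd (Fin.succAbove_right_injective (Finset.mem_filter.1 hl).2) hlk
          · intro hk
            exact absurd (by simp) hk
      have hface : nerveFace i (fun l : Fin (n + 1) => S.restr (x l.castSucc) (x l.succ)) =
          fun l : Fin n => S.restr (x (i.succAbove l.castSucc)) (x (i.succAbove l.succ)) := by
        funext l
        induction i using Fin.cases with
        | zero => rfl
        | succ j =>
          simp only [nerveFace, Fin.cases_succ]
          rw [Fin.succ_succAbove_succ]
          rcases lt_trichotomy (l : ℕ) j with h | h | h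
          · rw [Fin.contractNth_apply_of_lt _ _ _ _ h, Fin.succAbove_of_castSucc_lt j l h,
              Fin.succAbove_of_castSucc_lt]
            · rw [Fin.lt_def]; simp only [Fin.val_castSucc, Fin.val_succ]; omega
          · rw [Fin.contractNth_apply_of_eq _ _ _ _ h, Fin.succAbove_of_le_castSucc j l (by
              rw [Fin.le_def]; simp only [Fin.val_castSucc]; omega), Fin.succAbove_of_castSucc_lt]
            · exact S.restr_add (hx (Fin.castSucc_lt_succ).le) (hx (by
                rw [Fin.le_def]; simp)) (hc _)
            · rw [Fin.lt_def]; simp only [Fin.val_castSucc, Fin.val_succ]; omega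
          · rw [Fin.contractNth_apply_of_gt _ _ _ _ h, Fin.succAbove_of_le_castSucc j l (by
              rw [Fin.le_def]; simp only [Fin.val_castSucc]; omega), Fin.succAbove_of_le_castSucc]
            · rfl
            · rw [Fin.le_def]; simp only [Fin.val_castSucc, Fin.val_succ]; omega
      have h1 := Quot.sound (NerveRel.face i
        (fun l : Fin (n + 1) => S.restr (x l.castSucc) (x l.succ)) p')
      rw [← hp, hface] at h1
      refine Eq.trans (Eq.symm h1) ?_
      refine (ih (x := x ∘ i.succAbove) (hx.comp (Fin.strictMono_succAbove i).monotone)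
        (fun _ => hc _) p').trans ?_
      conv_rhs => rw [hp, stdSimplex.sum_single_map]
      rfl
    push Not at h0
    by_cases hs : StrictMono x
    · exact S.cut_of_strictMono hs p h0
    · obtain ⟨l, hl⟩ : ∃ l : Fin (n + 1), x l.castSucc = x l.succ := by
        by_contra hcon
        push Not at hcon
        exact hs (Fin.strictMono_iff_lt_succ.2 fun l =>
          lt_of_le_of_ne (hx (Fin.castSucc_lt_succ).le) (hcon l))
      have hx' : ∀ m, x (l.castSucc.succAbove m) = x (l.succ.succAbove m) := by
        intro m
        rcases lt_trichotomy m l with h | rfl | h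
        · rw [Fin.succAbove_of_castSucc_lt _ _ (Fin.castSucc_lt_castSucc_iff.2 h),
            Fin.succAbove_of_castSucc_lt _ _ (by
              rw [Fin.lt_def] at h ⊢; simp only [Fin.val_castSucc, Fin.val_succ]; omega)]
        · rw [Fin.succAbove_castSucc_self, Fin.succAbove_succ_self, hl]
        · rw [Fin.succAbove_of_le_castSucc _ _ (Fin.castSucc_le_castSucc_iff.2 h.le),
            Fin.succAbove_of_le_castSucc _ _ (by
              rw [Fin.le_def]; simp only [Fin.val_castSucc, Fin.val_succ]; omega)]
      have hdeg : nerveDegen l (fun m : Fin n => S.restr (x (l.castSucc.succAbove m.castSucc))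
          (x (l.castSucc.succAbove m.succ))) =
          fun l : Fin (n + 1) => S.restr (x l.castSucc) (x l.succ) := by
        refine Fin.insertNth_eq_iff.2 ⟨?_, ?_⟩
        · rw [hl, S.restr_self]
        · funext m
          change _ = S.restr (x (l.succAbove m).castSucc) (x (l.succAbove m).succ)
          rw [Fin.castSucc_succAbove_castSucc, hx' m.succ, Fin.succ_succAbove_succ]
      have hxp : ∀ i, x (l.castSucc.succAbove (l.predAbove i)) = x i := by
        intro i
        by_cases hi : i = l.castSucc
        · rw [hx', Fin.succ_succAbove_predAbove]
          rw [hi]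
          exact (Fin.castSucc_lt_succ).ne
        · rw [Fin.succAbove_predAbove hi]
      have h1 := Quot.sound (NerveRel.degen l (fun m : Fin n =>
        S.restr (x (l.castSucc.succAbove m.castSucc)) (x (l.castSucc.succAbove m.succ))) p)
      rw [hdeg] at h1
      refine Eq.trans (Eq.symm h1) ?_
      refine (ih (x := x ∘ l.castSucc.succAbove)
        (hx.comp (Fin.strictMono_succAbove _).monotone) (fun _ => hc _) _).trans ?_
      rw [stdSimplex.sum_single_map]
      simp only [Function.comp_apply, hxp]

end Realization

/-! ### Continuity into and out of the classifying space -/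

section Lift

variable {C : Type*} [AddMonoid C] [TopologicalSpace C]

theorem ClassifyingSpace.continuous_mk {n : ℕ} :
    Continuous fun q : (Fin n → C) × stdSimplex ℝ (Fin (n + 1)) => ClassifyingSpace.mk q.1 q.2 := by
  have h : Continuous (Sigma.mk (β := fun n : ℕ => (Fin n → C) × stdSimplex ℝ (Fin (n + 1))) n) :=
    continuous_sigmaMk
  exact continuous_quot_mk.comp h

/-- A map out of `BC × P` is continuous if it is so on each product with a simplex. -/
theorem ClassifyingSpace.continuous_of_mk {P Z : Type*} [TopologicalSpace P]
    [LocallyCompactSpace P] [TopologicalSpace Z] {g : ClassifyingSpace C × P → Z}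
    (hg : ∀ n, Continuous fun q : ((Fin n → C) × stdSimplex ℝ (Fin (n + 1))) × P =>
      g (ClassifyingSpace.mk q.1.1 q.1.2, q.2)) : Continuous g :=
  (isQuotientMap_quot_mk (r := NerveRel C)).continuous_lift_prod_left
    ((Homeomorph.sigmaProdDistrib.symm).comp_continuous_iff'.1 (continuous_sigma hg))

end Lift

section Cut

variable {G M X : Type*} [Group G] [MulAction G M] [TopologicalSpace M] [TopologicalSpace X]
  [BasedSpace X] [MulAction G X] [BasedGSpace G X]

theorem exists_strictMono_rep {μ : ℝ →₀ ℝ} (h0 : ∀ x, 0 ≤ μ x) (h1 : μ.sum (fun _ a => a) = 1) :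
    ∃ (n : ℕ) (x : Fin (n + 1) → ℝ) (p : stdSimplex ℝ (Fin (n + 1))), StrictMono x ∧
      (∀ i, p i ≠ 0) ∧ (∀ i, x i ∈ μ.support) ∧ μ = ∑ i, Finsupp.single (x i) (p i) := by
  classical
  have hc : μ.support.card ≠ 0 := by
    intro h
    rw [Finset.card_eq_zero] at h
    rw [Finsupp.sum, h, Finset.sum_empty] at h1
    exact zero_ne_one h1
  obtain ⟨n, hn⟩ := Nat.exists_eq_succ_of_ne_zero hc
  have hs : ∀ {N : Type} [AddCommMonoid N] (f : ℝ → N),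
      ∑ i, f (μ.support.orderEmbOfFin hn i) = ∑ x ∈ μ.support, f x := by
    intro N _ f
    conv_rhs => rw [← Finset.map_orderEmbOfFin_univ μ.support hn]
    rw [Finset.sum_map]
    rfl
  refine ⟨n, μ.support.orderEmbOfFin hn, ⟨fun i => μ (μ.support.orderEmbOfFin hn i),
    fun i => h0 _, (hs μ).trans h1⟩, (μ.support.orderEmbOfFin hn).strictMono, fun i => ?_,
    fun i => Finset.orderEmbOfFin_mem _ _ _, ?_⟩
  · exact Finsupp.mem_support_iff.1 (Finset.orderEmbOfFin_mem μ.support hn i)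
  · exact (Finsupp.sum_single μ).symm.trans (hs fun x => Finsupp.single x (μ x)).symm

/-- The cut by a measure only depends, up to translation, on the part of the configuration between
the points of the support. -/
theorem LineConf.cut_congr {S S' : LineConf G M X} {μ : ℝ →₀ ℝ} (h0 : ∀ x, 0 ≤ μ x)
    (h1 : μ.sum (fun _ a => a) = 1) (a : ℝ)
    (h : ∀ x ∈ μ.support, ∀ y ∈ μ.support, x ≤ y → S.restr x y = S'.restr (a + x) (a + y)) :
    S.cut μ = S'.cut (μ.mapDomain (a + ·)) := by
  obtain ⟨n, x, p, hx, hp, hm, hμ⟩ := exists_strictMono_rep h0 h1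
  have h2 := S.cut_of_strictMono hx p hp
  have h3 := S'.cut_of_strictMono (x := fun i => a + x i) (fun i j hij => by
    simpa using hx hij) p hp
  have h4 : μ.mapDomain (a + ·) = ∑ i, Finsupp.single (a + x i) (p i) := by
    rw [hμ, Finsupp.mapDomain_finsetSum]
    simp only [Finsupp.mapDomain_single]
  rw [h4, ← h3, hμ, ← h2]
  congr 1
  funext l
  exact h _ (hm _) _ (hm _) (hx (Fin.castSucc_lt_succ)).le

theorem LineConf.continuousWithinAt_cut {W ι : Type*} [TopologicalSpace W] [Fintype ι]
    [LinearOrder ι] {A : Set W} {w₀ : W} (hw₀ : w₀ ∈ A) {S : W → LineConf G M X} {x p : W → ι → ℝ}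
    (hp : ∀ᶠ w in 𝓝[A] w₀, p w ∈ stdSimplex ℝ ι) (hx : ∀ᶠ w in 𝓝[A] w₀, Monotone (x w))
    (hS : ∀ᶠ w in 𝓝[A] w₀, ∀ i, (S w).Clean (x w i))
    (hpc : ∀ i, ContinuousWithinAt (fun w => p w i) A w₀)
    (hc : ∀ i j, i ⋖ j → ContinuousWithinAt (fun w => (S w).restr (x w i) (x w j)) A w₀) :
    ContinuousWithinAt (fun w => (S w).cut (∑ i, Finsupp.single (x w i) (p w i))) A w₀ := by
  classical
  have hcard : Fintype.card ι ≠ 0 := by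
    intro h
    have := Fintype.card_eq_zero_iff.1 h
    have h1 := (hp.self_of_nhdsWithin hw₀).2
    rw [Finset.univ_eq_empty, Finset.sum_empty] at h1
    exact zero_ne_one h1
  obtain ⟨n, hn⟩ := Nat.exists_eq_succ_of_ne_zero hcard
  let e : Fin (n + 1) ≃o ι := Fintype.orderIsoFinOfCardEq ι hn
  have hmem : ∀ {w}, p w ∈ stdSimplex ℝ ι → (fun i => p w (e i)) ∈ stdSimplex ℝ (Fin (n + 1)) := by
    intro w h
    exact ⟨fun i => h.1 _, (e.toEquiv.sum_comp (p w)).trans h.2⟩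
  let P : W → stdSimplex ℝ (Fin (n + 1)) := fun w =>
    if h : p w ∈ stdSimplex ℝ ι then ⟨_, hmem h⟩ else stdSimplex.vertex 0
  have hP : ContinuousWithinAt P A w₀ := by
    refine Topology.IsInducing.subtypeVal.continuousWithinAt_iff.2 ?_
    have h1 : ContinuousWithinAt (fun w i => p w (e i)) A w₀ :=
      continuousWithinAt_pi.2 fun i => hpc (e i)
    refine h1.congr_of_eventuallyEq ?_ ?_
    · filter_upwards [hp] with w hw
      change ((P w : stdSimplex ℝ (Fin (n + 1))) : Fin (n + 1) → ℝ) = _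
      simp only [P, dif_pos hw]
      rfl
    · have hw := hp.self_of_nhdsWithin hw₀
      change ((P w₀ : stdSimplex ℝ (Fin (n + 1))) : Fin (n + 1) → ℝ) = _
      simp only [P, dif_pos hw]
      rfl
  have hF : ContinuousWithinAt (fun w => ClassifyingSpace.mk (fun l : Fin n =>
      (S w).restr (x w (e l.castSucc)) (x w (e l.succ))) (P w)) A w₀ := by
    have h2 : ContinuousWithinAt (fun w => fun l : Fin n =>
        (S w).restr (x w (e l.castSucc)) (x w (e l.succ))) A w₀ := by
      refine continuousWithinAt_pi.2 fun l => hc _ _ ?_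
      refine (apply_covBy_apply_iff e).2 ⟨Fin.castSucc_lt_succ, fun k h1 h2 => ?_⟩
      rw [Fin.lt_def] at h1 h2
      simp only [Fin.val_castSucc, Fin.val_succ] at h1 h2
      omega
    exact ClassifyingSpace.continuous_mk.continuousAt.comp_continuousWithinAt (h2.prodMk hP)
  have hev : ∀ᶠ w in 𝓝[A] w₀, (S w).cut (∑ i, Finsupp.single (x w i) (p w i)) =
      ClassifyingSpace.mk (fun l : Fin n =>
        (S w).restr (x w (e l.castSucc)) (x w (e l.succ))) (P w) := by
    filter_upwards [hp, hx, hS] with w h1 h2 h3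
    rw [(S w).mk_eq_cut (x := fun i => x w (e i)) (h2.comp e.monotone) (fun i => h3 _)]
    congr 1
    rw [← e.toEquiv.sum_comp]
    refine Finset.sum_congr rfl fun i _ => ?_
    have : (P w) i = p w (e i) := by
      simp only [P, dif_pos h1]
      rfl
    rw [this]
    rfl
  exact hF.congr_of_eventuallyEq hev (hev.self_of_nhdsWithin hw₀)

end Cut

/-! ### The slicing height of a weighted family of cuts -/

theorem theta_strictMono : StrictMono theta := fun a b h => by
  have := Real.arctan_strictMono (show 1 + a < 1 + b by linarith)
  have := Real.pi_pos
  unfold theta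
  gcongr

theorem continuous_theta : Continuous theta := by unfold theta; fun_prop

theorem theta_lt_one (z : ℝ) : theta z < 1 := by
  have h1 := Real.arctan_lt_pi_div_two (1 + z)
  have := Real.pi_pos
  rw [theta, div_mul_eq_mul_div, div_lt_one this]
  linarith

theorem theta_zero : theta 0 = 1 / 2 := by
  have := Real.pi_ne_zero
  rw [theta, add_zero, Real.arctan_one]
  field_simp
  norm_num

open Classical in
/-- The factor `1 / (1 - θ)`, on positive numbers, by which a barycentric coordinate has to be
multiplied to recover the coordinate of the first end of the segment it lies on.  It jumps from `0` to
`2` at the origin, since `θ 0 = 1/2`. -/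
noncomputable def gauge (z : ℝ) : ℝ := if 0 < z then 1 / (1 - theta z) else 0

theorem gauge_of_pos {z : ℝ} (h : 0 < z) : gauge z = 1 / (1 - theta z) := if_pos h

theorem gauge_of_nonpos {z : ℝ} (h : z ≤ 0) : gauge z = 0 := if_neg h.not_gt

theorem two_lt_gauge {z : ℝ} (h : 0 < z) : 2 < gauge z := by
  have h1 := theta_strictMono h
  have h2 := theta_lt_one z
  rw [theta_zero] at h1
  rw [gauge_of_pos h, lt_div_iff₀ (by linarith)]
  linarith

theorem gauge_nonneg (z : ℝ) : 0 ≤ gauge z := by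
  rcases lt_or_ge 0 z with h | h
  · linarith [two_lt_gauge h]
  · rw [gauge_of_nonpos h]

theorem gauge_lt {z z' : ℝ} (h : z < z') (h' : 0 < z') : gauge z < gauge z' := by
  rcases lt_or_ge 0 z with h0 | h0
  · rw [gauge_of_pos h0, gauge_of_pos h']
    have := theta_strictMono h
    have := theta_lt_one z'
    exact one_div_lt_one_div_of_lt (by linarith) (by linarith)
  · rw [gauge_of_nonpos h0]
    linarith [two_lt_gauge h']

theorem gauge_mono : Monotone gauge := by
  intro z z' h
  rcases h.lt_or_eq with h1 | rfl
  · rcases lt_or_ge 0 z' with h0 | h0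
    · exact (gauge_lt h1 h0).le
    · rw [gauge_of_nonpos h0, gauge_of_nonpos (h.trans h0)]
  · exact le_rfl

theorem continuousAt_gauge {z : ℝ} (h : z ≠ 0) : ContinuousAt gauge z := by
  rcases h.lt_or_gt with h | h
  · refine (continuousAt_const (y := (0 : ℝ))).congr ?_
    filter_upwards [gt_mem_nhds h] with y hy using (gauge_of_nonpos hy.le).symm
  · have : ContinuousAt (fun z => 1 / (1 - theta z)) z := by
      refine continuousAt_const.div₀ (continuousAt_const.sub continuous_theta.continuousAt) ?_
      linarith [theta_lt_one z]
    refine this.congr ?_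
    filter_upwards [lt_mem_nhds h] with y hy using (gauge_of_pos hy).symm

/-- A continuous function between two translates of the gauge. -/
theorem exists_continuous_gauge {δ : ℝ} (hδ : 0 < δ) :
    ∃ g : ℝ → ℝ, Continuous g ∧ ∀ z, gauge (z - δ) ≤ g z ∧ g z ≤ gauge z := by
  refine ⟨fun z => 1 / (1 - theta (max z 0)) * max 0 (min 1 (z / δ)), ?_, fun z => ?_⟩
  · have h : ∀ z, 1 - theta (max z 0) ≠ 0 := fun z => by linarith [theta_lt_one (max z 0)]
    have := continuous_theta
    fun_prop (disch := exact h _)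
  · have h1 : 0 < 1 / (1 - theta (max z 0)) := by
      have := theta_lt_one (max z 0)
      exact one_div_pos.2 (by linarith)
    simp only
    rcases lt_or_ge 0 z with h | h
    · have h2 : 0 ≤ max 0 (min 1 (z / δ)) := le_max_left _ _
      rw [max_eq_left h.le, ← gauge_of_pos h] at h1 ⊢
      constructor
      · rcases lt_or_ge δ z with h3 | h3
        · rw [min_eq_left ((one_le_div hδ).2 h3.le), max_eq_right zero_le_one, mul_one]
          exact gauge_mono (by linarith)
        · rw [gauge_of_nonpos (by linarith)]
          exact mul_nonneg h1.le h2
      · exact mul_le_of_le_one_right h1.le (max_le zero_le_one (min_le_left _ _))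
    · have : z / δ ≤ 0 := div_nonpos_of_nonpos_of_nonneg h hδ.le
      rw [gauge_of_nonpos (by linarith), gauge_of_nonpos h,
        max_eq_left ((min_le_right _ _).trans this), mul_zero]
      exact ⟨le_rfl, le_rfl⟩

/-- The sum of the coordinates of the first ends, if the slicing height is `z`. -/
noncomputable def mass (μ : ℝ →₀ ℝ) (z : ℝ) : ℝ := μ.sum fun x a => a * gauge (z - x)

/-- The slicing height: the height at which the mass reaches `1`, possibly by a jump at a point of the
support.  For a probability measure the mass is `0` below the support, strictly increasing above its
minimum, and greater than `1` above its maximum. -/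
noncomputable def level (μ : ℝ →₀ ℝ) : ℝ := sSup {z | mass μ z < 1}

theorem mass_sum_single {ι : Type*} [Fintype ι] (x p : ι → ℝ) (z : ℝ) :
    mass (∑ i, Finsupp.single (x i) (p i)) z = ∑ i, p i * gauge (z - x i) := by
  rw [mass, ← Finsupp.sum_finsetSum_index (fun _ => zero_mul _) (fun _ _ _ => add_mul _ _ _)]
  exact Finset.sum_congr rfl fun i _ => Finsupp.sum_single_index (zero_mul _)

theorem mass_mapDomain (μ : ℝ →₀ ℝ) (a z : ℝ) : mass (μ.mapDomain (a + ·)) z = mass μ (z - a) := by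
  rw [mass, Finsupp.sum_mapDomain_index (fun _ => zero_mul _) (fun _ _ _ => add_mul _ _ _)]
  simp only [mass, sub_sub]

theorem level_eq {μ : ℝ →₀ ℝ} {t : ℝ} (h : ∀ z < t, mass μ z < 1) (h' : ∀ z, t < z → 1 ≤ mass μ z) :
    level μ = t := by
  refine csSup_eq_of_forall_le_of_forall_lt_exists_gt ⟨t - 1, h _ (by linarith)⟩ (fun z hz => ?_)
    fun w hw => ?_
  · by_contra hcon
    exact absurd (h' z (not_le.1 hcon)) (not_le.2 hz)
  · obtain ⟨z, h1, h2⟩ := exists_between hw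
    exact ⟨z, h z h2, h1⟩

section Prob

variable {μ : ℝ →₀ ℝ} (h0 : ∀ x, 0 ≤ μ x) (h1 : μ.sum (fun _ a => a) = 1)

include h0 in
theorem mass_mono : Monotone (mass μ) := fun z z' h =>
  Finset.sum_le_sum fun x _ => mul_le_mul_of_nonneg_left (gauge_mono (by linarith)) (h0 x)

include h0 in
theorem mass_lt {z z' : ℝ} (h : z < z') (h' : 0 < mass μ z') : mass μ z < mass μ z' := by
  obtain ⟨x, hx, hpos⟩ : ∃ x ∈ μ.support, 0 < μ x * gauge (z' - x) := by
    by_contra hcon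
    push Not at hcon
    exact absurd (Finset.sum_nonpos hcon) (not_le.2 h')
  refine Finset.sum_lt_sum (fun x _ => mul_le_mul_of_nonneg_left (gauge_mono (by linarith)) (h0 x))
    ⟨x, hx, mul_lt_mul_of_pos_left (gauge_lt (by linarith) ?_) ?_⟩
  · by_contra hcon
    rw [gauge_of_nonpos (not_lt.1 hcon), mul_zero] at hpos
    exact lt_irrefl _ hpos
  · exact (h0 x).lt_of_ne (Finsupp.mem_support_iff.1 hx).symm

theorem mass_eq_zero {z : ℝ} (h : ∀ x ∈ μ.support, z ≤ x) : mass μ z = 0 :=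
  Finset.sum_eq_zero fun x hx => by
    beta_reduce
    rw [gauge_of_nonpos (sub_nonpos.2 (h x hx)), mul_zero]

include h0 h1 in
theorem one_le_mass {z : ℝ} (h : ∀ x ∈ μ.support, x < z) : 1 ≤ mass μ z := by
  rw [← h1]
  refine Finset.sum_le_sum fun x hx => le_mul_of_one_le_right (h0 x) ?_
  linarith [two_lt_gauge (sub_pos.2 (h x hx))]

include h0 h1 in
theorem bddAbove_mass_lt : BddAbove {z | mass μ z < 1} := by
  obtain ⟨b, hb⟩ := μ.support.bddAbove
  refine ⟨b, fun z hz => ?_⟩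
  by_contra hcon
  exact absurd (one_le_mass h0 h1 fun x hx => (hb hx).trans_lt (not_le.1 hcon)) (not_le.2 hz)

theorem nonempty_mass_lt : {z | mass μ z < 1}.Nonempty := by
  obtain ⟨a, ha⟩ := μ.support.bddBelow
  refine ⟨a, ?_⟩
  change mass μ a < 1
  rw [mass_eq_zero fun x hx => ha hx]
  exact zero_lt_one

include h0 in
theorem mass_lt_one {z : ℝ} (h : z < level μ) : mass μ z < 1 := by
  obtain ⟨z', hz', h'⟩ := exists_lt_of_lt_csSup nonempty_mass_lt h
  exact (mass_mono h0 h'.le).trans_lt hz'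

include h0 h1 in
theorem one_le_mass_of_lt {z : ℝ} (h : level μ < z) : 1 ≤ mass μ z := by
  by_contra hcon
  exact absurd (le_csSup (bddAbove_mass_lt h0 h1) (not_le.1 hcon)) (not_le.2 h)

include h0 h1 in
theorem one_lt_mass_of_lt {z : ℝ} (h : level μ < z) : 1 < mass μ z := by
  obtain ⟨z', h2, h3⟩ := exists_between h
  have := one_le_mass_of_lt h0 h1 h2
  exact this.trans_lt (mass_lt h0 h3 (by linarith [mass_mono h0 h3.le]))

include h0 h1 in
theorem le_level {z : ℝ} (h : ∀ x ∈ μ.support, z ≤ x) : z ≤ level μ :=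
  le_csSup (bddAbove_mass_lt h0 h1) (by
    change mass μ z < 1
    rw [mass_eq_zero h]
    exact zero_lt_one)

include h0 h1 in
theorem level_le {z : ℝ} (h : ∀ x ∈ μ.support, x ≤ z) : level μ ≤ z := by
  by_contra hcon
  obtain ⟨z', h2, h3⟩ := exists_between (not_le.1 hcon)
  exact absurd (one_le_mass h0 h1 fun x hx => (h x hx).trans_lt h2) (not_le.2 (mass_lt_one h0 h3))

include h0 h1 in
theorem level_mapDomain (a : ℝ) : level (μ.mapDomain (a + ·)) = a + level μ := by
  refine level_eq (fun z hz => ?_) fun z hz => ?_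
  · rw [mass_mapDomain]
    exact mass_lt_one h0 (by linarith)
  · rw [mass_mapDomain]
    exact one_le_mass_of_lt h0 h1 (by linarith)

include h0 in
theorem level_eq_of_mass_eq_one {z : ℝ} (h : mass μ z = 1) : level μ = z :=
  level_eq (fun z' h' => h ▸ mass_lt h0 h' (by linarith)) fun z' h' => h ▸ mass_mono h0 h'.le

include h0 h1 in
theorem mass_level (h : level μ ∉ μ.support) : mass μ (level μ) = 1 := by
  have hc : ContinuousAt (mass μ) (level μ) := by
    refine tendsto_finsetSum _ fun x hx => tendsto_const_nhds.mul ?_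
    have hne : level μ - x ≠ 0 := fun h' => h (by rwa [sub_eq_zero.1 h'])
    exact (continuousAt_gauge hne).comp (f := fun z => z - x) (continuous_sub_right x).continuousAt
  refine le_antisymm ?_ ?_
  · refine le_of_tendsto (hc.mono_left (nhdsWithin_le_nhds (s := Iio (level μ)))) ?_
    filter_upwards [self_mem_nhdsWithin] with z hz using (mass_lt_one h0 hz).le
  · refine ge_of_tendsto (hc.mono_left (nhdsWithin_le_nhds (s := Ioi (level μ)))) ?_
    filter_upwards [self_mem_nhdsWithin] with z hz using one_le_mass_of_lt h0 h1 hz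

end Prob

section Family

variable {ι : Type*} [Fintype ι] {x p : ι → ℝ}

theorem sum_single_nonneg (hp : p ∈ stdSimplex ℝ ι) (z : ℝ) :
    0 ≤ (∑ i, Finsupp.single (x i) (p i)) z := by
  classical
  rw [Finsupp.finsetSum_apply]
  refine Finset.sum_nonneg fun i _ => ?_
  rw [Finsupp.single_apply]
  split_ifs
  · exact hp.1 i
  · exact le_rfl

theorem sum_single_sum (hp : p ∈ stdSimplex ℝ ι) :
    (∑ i, Finsupp.single (x i) (p i)).sum (fun _ a => a) = 1 := by
  rw [← Finsupp.sum_finsetSum_index (fun _ => rfl) (fun _ _ _ => rfl), ← hp.2]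
  exact Finset.sum_congr rfl fun i _ => Finsupp.sum_single_index rfl

theorem exists_of_mem_support_sum_single {z : ℝ}
    (h : z ∈ (∑ i, Finsupp.single (x i) (p i)).support) : ∃ i, z = x i ∧ p i ≠ 0 := by
  classical
  by_contra hcon
  push Not at hcon
  refine Finsupp.mem_support_iff.1 h ?_
  rw [Finsupp.finsetSum_apply]
  refine Finset.sum_eq_zero fun i _ => ?_
  by_cases hz : z = x i
  · rw [hcon i hz, Finsupp.single_zero]; rfl
  · exact Finsupp.single_eq_of_ne hz

/-- The slicing height depends continuously on cuts and weights. -/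
theorem continuousAt_level {W : Type*} [TopologicalSpace W] {w₀ : W} {x p : W → ι → ℝ}
    (hx : ContinuousAt x w₀) (hp : ContinuousAt p w₀) (hs : ∀ᶠ w in 𝓝 w₀, p w ∈ stdSimplex ℝ ι) :
    ContinuousAt (fun w => level (∑ i, Finsupp.single (x w i) (p w i))) w₀ := by
  have key : ∀ {g : ℝ → ℝ} (_ : Continuous g) (z : ℝ),
      ContinuousAt (fun w => ∑ i, p w i * g (z - x w i)) w₀ := by
    intro g hg z
    refine tendsto_finsetSum _ fun i _ => ((continuous_apply i).continuousAt.comp hp).mul ?_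
    exact hg.continuousAt.comp (continuousAt_const.sub ((continuous_apply i).continuousAt.comp hx))
  refine tendsto_order.2 ⟨fun a ha => ?_, fun b hb => ?_⟩
  · obtain ⟨b, h1, h2⟩ := exists_between ha
    obtain ⟨g, hg, hg'⟩ := exists_continuous_gauge (half_pos (sub_pos.2 h1))
    have h3 : ∑ i, p w₀ i * g (b - x w₀ i) < 1 := by
      refine lt_of_le_of_lt ?_ (mass_lt_one (sum_single_nonneg hs.self_of_nhds) h2)
      rw [mass_sum_single]
      exact Finset.sum_le_sum fun i _ => mul_le_mul_of_nonneg_left (hg' _).2 ((hs.self_of_nhds).1 i)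
    filter_upwards [(key hg b).eventually_lt_const h3, hs] with w hw hs
    have h4 : mass (∑ i, Finsupp.single (x w i) (p w i)) (b - (b - a) / 2) < 1 := by
      refine lt_of_le_of_lt ?_ hw
      rw [mass_sum_single]
      refine Finset.sum_le_sum fun i _ => mul_le_mul_of_nonneg_left ?_ (hs.1 i)
      refine le_trans (le_of_eq ?_) (hg' _).1
      congr 1
      ring
    have := le_csSup (bddAbove_mass_lt (sum_single_nonneg hs) (sum_single_sum hs)) h4
    refine lt_of_lt_of_le ?_ this
    linarith
  · obtain ⟨a, h1, h2⟩ := exists_between hb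
    obtain ⟨g, hg, hg'⟩ := exists_continuous_gauge (half_pos (sub_pos.2 h2))
    have h3 : 1 < ∑ i, p w₀ i * g (a + (b - a) / 2 - x w₀ i) := by
      refine (one_lt_mass_of_lt (sum_single_nonneg hs.self_of_nhds) (sum_single_sum hs.self_of_nhds) h1).trans_le ?_
      rw [mass_sum_single]
      refine Finset.sum_le_sum fun i _ => mul_le_mul_of_nonneg_left ?_ ((hs.self_of_nhds).1 i)
      refine le_trans (le_of_eq ?_) (hg' _).1
      congr 1
      ring
    filter_upwards [(key hg _).eventually_const_lt h3, hs] with w hw hs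
    have h4 : 1 < mass (∑ i, Finsupp.single (x w i) (p w i)) (a + (b - a) / 2) := by
      refine hw.trans_le ?_
      rw [mass_sum_single]
      exact Finset.sum_le_sum fun i _ => mul_le_mul_of_nonneg_left (hg' _).2 (hs.1 i)
    have h5 : level (∑ i, Finsupp.single (x w i) (p w i)) ≤ a + (b - a) / 2 := by
      by_contra hcon
      exact absurd (mass_lt_one (sum_single_nonneg hs) (not_le.1 hcon)) (not_lt.2 h4.le)
    linarith

end Family

/-! ### The slicing map -/

section ThickSlice

variable {n : ℕ} {s : Fin n → ℝ} {h : Fin (n + 1) → ℝ}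

theorem sum_filter_eq_sub (hs : ∀ l : Fin n, h l.succ = h l.castSucc + s l) {i j : Fin (n + 1)}
    (hij : i ≤ j) : ∑ l : Fin n with i ≤ l.castSucc ∧ l.castSucc < j, s l = h j - h i := by
  induction j using Fin.induction with
  | zero =>
    obtain rfl : i = 0 := Fin.le_zero_iff.1 hij
    rw [Finset.filter_false_of_mem fun l _ h => Fin.not_lt_zero _ h.2, Finset.sum_empty, sub_self]
  | succ m ih =>
    rcases hij.lt_or_eq with hlt | rfl
    · have hle : i ≤ m.castSucc := Fin.le_castSucc_iff.2 hlt
      have : (Finset.univ.filter fun l : Fin n => i ≤ l.castSucc ∧ l.castSucc < m.succ) =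
          insert m (Finset.univ.filter fun l : Fin n => i ≤ l.castSucc ∧ l.castSucc < m.castSucc) := by
        ext l
        simp only [Finset.mem_filter, Finset.mem_univ, true_and, Finset.mem_insert,
          Fin.castSucc_lt_succ_iff, Fin.castSucc_lt_castSucc_iff]
        constructor
        · rintro ⟨h1, h2⟩
          rcases h2.lt_or_eq with h3 | h3
          · exact Or.inr ⟨h1, h3⟩
          · exact Or.inl h3
        · rintro (rfl | ⟨h1, h2⟩)
          · exact ⟨hle, le_rfl⟩
          · exact ⟨h1, h2.le⟩
      rw [this, Finset.sum_insert (by simp), ih hle, hs]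
      ring
    · rw [Finset.filter_false_of_mem, Finset.sum_empty, sub_self]
      rintro l - ⟨h1, h2⟩
      exact absurd h1 (not_le.2 h2)

theorem thickSlice_apply (k : Fin n) (t : ℝ) (u v : Fin (n + 1) → ℝ) (m : Fin (n + 1)) :
    thickSlice s k t u v m =
      u m * (1 - theta ((∑ l : Fin n with m ≤ l.castSucc ∧ l < k, s l) + t)) * ∑ j, v j +
      v m * ∑ i, u i * theta ((∑ l : Fin n with i ≤ l.castSucc ∧ l < k, s l) + t) := by
  set θ : Fin (n + 1) → ℝ := fun i =>
    theta ((∑ l : Fin n with i ≤ l.castSucc ∧ l < k, s l) + t) with hθ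
  have h1 : thickSlice s k t u v m = ∑ i, ∑ j, ((if m = i then u i * (1 - θ i) * v j else 0) +
      if m = j then v j * (u i * θ i) else 0) := by
    simp only [thickSlice, Finset.sum_apply, Pi.smul_apply, Pi.add_apply, Pi.single_apply,
      smul_eq_mul]
    refine Finset.sum_congr rfl fun i _ => Finset.sum_congr rfl fun j _ => ?_
    split_ifs <;> ring
  rw [h1]
  simp only [Finset.sum_add_distrib, Finset.sum_ite_eq, Finset.mem_univ, if_true]
  rw [Finset.sum_comm]
  simp only [Finset.sum_ite_eq, Finset.mem_univ, if_true, Finset.mul_sum]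
  rfl

/-- A point of the simplex lies in the slice at height `t` over the `k`-th edge of the spine iff the
mass of its cuts at that height is `1`. -/
theorem inThickSlice_iff (hs : ∀ l : Fin n, h l.succ = h l.castSucc + s l) (hmono : Monotone h)
    {p : stdSimplex ℝ (Fin (n + 1))} {k : Fin n} {t : ℝ} :
    InThickSlice s p k t ↔
      t ∈ Ioo 0 (s k) ∧ ∑ i, p i * gauge (h k.castSucc + t - h i) = 1 := by
  set θ : Fin (n + 1) → ℝ := fun i =>
    theta ((∑ l : Fin n with i ≤ l.castSucc ∧ l < k, s l) + t) with hθ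
  refine and_congr_right fun ht => ?_
  have hg : ∀ i ≤ k.castSucc, gauge (h k.castSucc + t - h i) * (1 - θ i) = 1 := by
    intro i hi
    have h1 := hmono hi
    have h2 : θ i = theta (h k.castSucc + t - h i) := by
      have := sum_filter_eq_sub hs hi
      simp only [Fin.castSucc_lt_castSucc_iff] at this
      simp only [hθ, this]
      congr 1
      ring
    have h3 := theta_lt_one (h k.castSucc + t - h i)
    rw [h2, gauge_of_pos (by linarith [ht.1]), one_div, inv_mul_cancel₀ (by linarith)]
  have hg0 : ∀ i, k.castSucc < i → gauge (h k.castSucc + t - h i) = 0 := by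
    intro i hi
    refine gauge_of_nonpos ?_
    have := hmono (Fin.castSucc_lt_iff_succ_le.1 hi)
    rw [hs] at this
    linarith [ht.2]
  constructor
  · rintro ⟨u, v, hu, hv, hp⟩
    rw [← stdSimplex.sum_eq_one u]
    refine Finset.sum_congr rfl fun i _ => ?_
    rcases le_or_gt i k.castSucc with hi | hi
    · have h1 : p i = _ := congrFun hp i
      rw [thickSlice_apply, hv i hi, zero_mul, add_zero] at h1
      have h2 : ∑ j, v j = 1 := stdSimplex.sum_eq_one v
      rw [h2, mul_one] at h1
      rw [h1]
      have := hg i hi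
      change u i * (1 - θ i) * _ = _
      rw [mul_assoc, mul_comm (1 - θ i), this, mul_one]
    · rw [hg0 i hi, hu i hi, mul_zero]
  · intro hsum
    set u : Fin (n + 1) → ℝ := fun i => p i * gauge (h k.castSucc + t - h i) with hu
    have hu0 : ∀ i, 0 ≤ u i := fun i => mul_nonneg (stdSimplex.zero_le p i) (gauge_nonneg _)
    have huθ : ∀ i, u i * (1 - θ i) = if i ≤ k.castSucc then p i else 0 := by
      intro i
      split_ifs with hi
      · rw [hu, mul_assoc, hg i hi, mul_one]
      · rw [hu]
        simp only [hg0 i (not_le.1 hi), mul_zero, zero_mul]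
    set a := ∑ i, u i * θ i with ha
    have ha' : a = ∑ i, if i ≤ k.castSucc then 0 else p i := by
      have h1 : a = ∑ i, u i - ∑ i, u i * (1 - θ i) := by
        rw [ha, ← Finset.sum_sub_distrib]
        exact Finset.sum_congr rfl fun i _ => by ring
      rw [h1, hsum]
      refine (congrArg (· - _) (stdSimplex.sum_eq_one p).symm).trans ?_
      rw [← Finset.sum_sub_distrib]
      refine Finset.sum_congr rfl fun i _ => ?_
      rw [huθ]
      split_ifs <;> simp
    have hapos : 0 < a := by
      have h1 : (1 / 2 : ℝ) ≤ a := by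
        rw [ha, show (1 / 2 : ℝ) = ∑ i, u i * (1 / 2) by rw [← Finset.sum_mul, hsum, one_mul]]
        refine Finset.sum_le_sum fun i _ => ?_
        rcases le_or_gt i k.castSucc with hi | hi
        · refine mul_le_mul_of_nonneg_left ?_ (hu0 i)
          rw [← theta_zero]
          refine theta_strictMono.monotone ?_
          have := sum_filter_eq_sub hs hi
          simp only [Fin.castSucc_lt_castSucc_iff] at this
          rw [this]
          linarith [hmono hi, ht.1]
        · rw [hu]
          simp only [hg0 i hi, mul_zero, zero_mul, le_refl]
      linarith
    have hv1 : (∑ j, if j ≤ k.castSucc then 0 else p j / a) = 1 := by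
      have h1 : (∑ j, if j ≤ k.castSucc then 0 else p j / a) =
          (∑ j, if j ≤ k.castSucc then 0 else p j) / a := by
        rw [Finset.sum_div]
        exact Finset.sum_congr rfl fun j _ => by split_ifs <;> simp
      rw [h1]
      exact (div_eq_one_iff_eq hapos.ne').2 ha'.symm
    refine ⟨⟨u, hu0, hsum⟩, ⟨fun j => if j ≤ k.castSucc then 0 else p j / a, fun j => ?_, ?_⟩,
      fun i hi => ?_, fun j hj => if_pos hj, ?_⟩
    · beta_reduce
      split_ifs
      · exact le_rfl
      · exact div_nonneg (stdSimplex.zero_le p j) hapos.le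
    · exact hv1
    · change p i * _ = 0
      rw [hg0 i hi, mul_zero]
    · funext m
      rw [thickSlice_apply]
      change p m = u m * (1 - θ m) * (∑ j, if j ≤ k.castSucc then 0 else p j / a) +
        (if m ≤ k.castSucc then 0 else p m / a) * a
      rw [hv1, huθ]
      split_ifs
      · simp
      · rw [zero_mul, zero_add, div_mul_cancel₀ _ hapos.ne']

end ThickSlice

section Lift

variable {G M X : Type*} [Group G] [MulAction G M] [TopologicalSpace M] [TopologicalSpace X]
  [BasedSpace X] [MulAction G X] [BasedGSpace G X]

/-- The sum of all entries of an element of the nerve. -/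
def DiscConf.total {n : ℕ} (c : Fin n → DiscConf G M X) : DiscConf G M X :=
  Fin.partialSum c (Fin.last n)

/-- The lengths of the partial sums of an element of the nerve. -/
def DiscConf.cutHeight {n : ℕ} (c : Fin n → DiscConf G M X) (i : Fin (n + 1)) : ℝ :=
  (Fin.partialSum c i).len

/-- The probability measure on the line that is given by barycentric coordinates placed at the
lengths of the partial sums. -/
noncomputable def DiscConf.cutMeasure {n : ℕ} (c : Fin n → DiscConf G M X)
    (p : stdSimplex ℝ (Fin (n + 1))) : ℝ →₀ ℝ :=
  ∑ i, Finsupp.single (DiscConf.cutHeight c i) (p i)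

/-- A probability measure with finite support inside the interval of `c`. -/
structure DiscConf.IsCutMeasure (c : DiscConf G M X) (μ : ℝ →₀ ℝ) : Prop where
  nonneg : ∀ x, 0 ≤ μ x
  sum_eq_one : μ.sum (fun _ a => a) = 1
  bounds : ∀ x ∈ μ.support, 0 ≤ x ∧ x ≤ c.len

variable {n : ℕ}

theorem DiscConf.cutHeight_nonneg (c : Fin n → DiscConf G M X) (i : Fin (n + 1)) :
    0 ≤ DiscConf.cutHeight c i := (Fin.partialSum c i).len_nonneg

theorem DiscConf.cutHeight_le (c : Fin n → DiscConf G M X) (i : Fin (n + 1)) :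
    DiscConf.cutHeight c i ≤ (DiscConf.total c).len :=
  DiscConf.monotone_len_partialSum c (Fin.le_last i)

theorem DiscConf.isCutMeasure_sum {ι : Type*} [Fintype ι] {c : DiscConf G M X} {x p : ι → ℝ}
    (hp : p ∈ stdSimplex ℝ ι) (hx : ∀ i, p i ≠ 0 → 0 ≤ x i ∧ x i ≤ c.len) :
    c.IsCutMeasure (∑ i, Finsupp.single (x i) (p i)) where
  nonneg := sum_single_nonneg hp
  sum_eq_one := sum_single_sum hp
  bounds := by
    intro z hz
    obtain ⟨i, rfl, hi⟩ := exists_of_mem_support_sum_single hz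
    exact hx i hi

theorem DiscConf.isCutMeasure (c : Fin n → DiscConf G M X) (p : stdSimplex ℝ (Fin (n + 1))) :
    (DiscConf.total c).IsCutMeasure (DiscConf.cutMeasure c p) :=
  DiscConf.isCutMeasure_sum p.2 fun i _ => ⟨DiscConf.cutHeight_nonneg c i, DiscConf.cutHeight_le c i⟩

theorem DiscConf.partialSum_degen (i : Fin (n + 1)) (c : Fin n → DiscConf G M X)
    (k : Fin (n + 2)) : Fin.partialSum (nerveDegen i c) k = Fin.partialSum c (i.predAbove k) := by
  have h1 : Fin.contractNth i (· + ·) (nerveDegen i c) = c := by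
    funext k
    have hi : ∀ k, nerveDegen i c (i.succAbove k) = c k := fun k =>
      Fin.insertNth_apply_succAbove (α := fun _ => DiscConf G M X) i 0 c k
    rcases lt_trichotomy (k : ℕ) i with h | h | h
    · rw [Fin.contractNth_apply_of_lt _ _ _ _ h, ← hi k, Fin.succAbove_of_castSucc_lt]
      rw [Fin.lt_def]; exact h
    · have h2 : k.castSucc = i := Fin.ext h
      have h3 : nerveDegen i c i = 0 :=
        Fin.insertNth_apply_same (α := fun _ => DiscConf G M X) i 0 c
      rw [Fin.contractNth_apply_of_eq _ _ _ _ h, h2, h3, zero_add, ← hi k,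
        Fin.succAbove_of_le_castSucc]
      exact h2.ge
    · rw [Fin.contractNth_apply_of_gt _ _ _ _ h, ← hi k, Fin.succAbove_of_le_castSucc]
      rw [Fin.le_def]; exact h.le
  have h2 := Fin.partialSum_contractNth (nerveDegen i c) i
  rw [h1] at h2
  rw [h2, Function.comp_apply]
  by_cases hk : k = i.succ
  · subst hk
    have h3 : nerveDegen i c i = 0 :=
      Fin.insertNth_apply_same (α := fun _ => DiscConf G M X) i 0 c
    rw [Fin.partialSum_succ, Fin.predAbove_succ_self, Fin.succAbove_succ_self, h3, add_zero]
  · rw [Fin.succ_succAbove_predAbove hk]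

/-- An invariant of a configuration in an interval and a measure on it, that is not changed when the
configuration is prolonged on either side, is a function on the classifying space. -/
theorem DiscConf.eq_of_nerveRel {Z : Type*} {Ψ : DiscConf G M X → (ℝ →₀ ℝ) → Z}
    (hl : ∀ a c μ, c.IsCutMeasure μ → Ψ (a + c) (μ.mapDomain (a.len + ·)) = Ψ c μ)
    (hr : ∀ a c μ, c.IsCutMeasure μ → Ψ (c + a) μ = Ψ c μ)
    (a b : Σ n : ℕ, (Fin n → DiscConf G M X) × stdSimplex ℝ (Fin (n + 1)))
    (h : NerveRel _ a b) :
    Ψ (DiscConf.total a.2.1) (DiscConf.cutMeasure a.2.1 a.2.2) =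
      Ψ (DiscConf.total b.2.1) (DiscConf.cutMeasure b.2.1 b.2.2) := by
  induction h with
  | @face n i c p =>
    simp only
    have hcut : DiscConf.cutMeasure c (stdSimplex.map i.succAbove p) =
        ∑ j, Finsupp.single (DiscConf.cutHeight c (i.succAbove j)) (p j) :=
      stdSimplex.sum_single_map _ _ _
    rw [hcut]
    induction i using Fin.cases with
    | zero =>
      have h1 : ∀ j, Fin.partialSum c j.succ = c 0 + Fin.partialSum (nerveFace 0 c) j :=
        Fin.partialSum_succ' c
      have h2 : DiscConf.total c = c 0 + DiscConf.total (nerveFace 0 c) := h1 (Fin.last n)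
      rw [h2, ← hl (c 0) _ _ (DiscConf.isCutMeasure _ p)]
      congr 1
      rw [DiscConf.cutMeasure, Finsupp.mapDomain_finsetSum]
      refine Finset.sum_congr rfl fun j _ => ?_
      rw [Finsupp.mapDomain_single, Fin.zero_succAbove, DiscConf.cutHeight, DiscConf.cutHeight, h1]
      rfl
    | succ i =>
      have h1 : Fin.partialSum (nerveFace i.succ c) = Fin.partialSum c ∘ i.succ.succAbove :=
        Fin.partialSum_contractNth c i
      obtain ⟨r, hr'⟩ := exists_partialSum_add c (i.succ.succAbove (Fin.last n))
      have h2 : DiscConf.total c = DiscConf.total (nerveFace i.succ c) + r := by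
        rw [DiscConf.total, ← hr', DiscConf.total, h1]
        rfl
      have h3 : DiscConf.cutMeasure (nerveFace i.succ c) p =
          ∑ j, Finsupp.single (DiscConf.cutHeight c (i.succ.succAbove j)) (p j) := by
        simp only [DiscConf.cutMeasure, DiscConf.cutHeight, h1]
        rfl
      rw [h2, hr _ _ _ (h3 ▸ DiscConf.isCutMeasure _ p), h3]
  | @degen n i c p =>
    simp only
    have h1 : DiscConf.total (nerveDegen i c) = DiscConf.total c := by
      rw [DiscConf.total, DiscConf.partialSum_degen, Fin.predAbove_right_last]
      rfl
    rw [h1]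
    congr 1
    refine (stdSimplex.sum_single_map _ _ _).trans ?_
    refine Finset.sum_congr rfl fun j _ => ?_
    simp only [DiscConf.cutHeight, DiscConf.partialSum_degen]

end Lift

section Slicing

variable {G M X : Type*} [Group G] [Finite G] [TopologicalSpace M] [T2Space M] [MulAction G M]
  [ContinuousConstSMul G M] [TopologicalSpace X] [BasedSpace X] [MulAction G X] [BasedGSpace G X]

/-- The slice of the total configuration at the slicing height. -/
noncomputable def sliceMap : ClassifyingSpace (DiscConf G M X) → Conf G M (Susp X) :=
  Quot.lift (fun a => (DiscConf.total a.2.1).slice (level (DiscConf.cutMeasure a.2.1 a.2.2)))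
    (DiscConf.eq_of_nerveRel (Ψ := fun c μ => c.slice (level μ))
      (fun a c μ h => by
        have h1 := level_mapDomain h.nonneg h.sum_eq_one a.len
        have h2 : 0 ≤ level μ := le_level h.nonneg h.sum_eq_one fun x hx => (h.bounds x hx).1
        rw [h1, DiscConf.slice_add_of_ge (by linarith), add_sub_cancel_left])
      fun a c μ h => DiscConf.slice_add_of_le
        (level_le h.nonneg h.sum_eq_one fun x hx => (h.bounds x hx).2))

variable {n : ℕ}

theorem sliceMap_mk (c : Fin n → DiscConf G M X) (p : stdSimplex ℝ (Fin (n + 1))) :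
    sliceMap (ClassifyingSpace.mk c p) =
      (DiscConf.total c).slice (level (DiscConf.cutMeasure c p)) := rfl

theorem DiscConf.cutHeight_succ (c : Fin n → DiscConf G M X) (l : Fin n) :
    DiscConf.cutHeight c l.succ = DiscConf.cutHeight c l.castSucc + (c l).len :=
  DiscConf.len_partialSum_succ c l

theorem DiscConf.monotone_cutHeight (c : Fin n → DiscConf G M X) :
    Monotone (DiscConf.cutHeight c) := DiscConf.monotone_len_partialSum c

theorem DiscConf.cutHeight_zero (c : Fin n → DiscConf G M X) : DiscConf.cutHeight c 0 = 0 := by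
  rw [DiscConf.cutHeight, Fin.partialSum_zero]
  rfl

theorem DiscConf.continuous_cutHeight (i : Fin (n + 1)) :
    Continuous fun c : Fin n → DiscConf G M X => DiscConf.cutHeight c i := by
  induction i using Fin.induction with
  | zero =>
    simp only [DiscConf.cutHeight_zero]
    exact continuous_const
  | succ i ih =>
    simp only [DiscConf.cutHeight_succ]
    exact ih.add (DiscConf.continuous_len.comp (continuous_apply i))

theorem DiscConf.slice_total (c : Fin n → DiscConf G M X) (k : Fin n) {z : ℝ}
    (h1 : DiscConf.cutHeight c k.castSucc ≤ z) (h2 : z ≤ DiscConf.cutHeight c k.succ) :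
    (DiscConf.total c).slice z = (c k).slice (z - DiscConf.cutHeight c k.castSucc) := by
  obtain ⟨r, hr⟩ := exists_partialSum_add c k.succ
  rw [DiscConf.total, ← hr, DiscConf.slice_add_of_le h2, Fin.partialSum_succ,
    DiscConf.slice_add_of_ge h1]
  rfl

theorem LineConf.Clean.slice_eq_empty {c : DiscConf G M X} {z : ℝ} (h : c.toLine.Clean z) :
    c.slice z = Conf.empty G M (Susp X) := by
  refine Conf.ext (eq_empty_of_forall_notMem ?_)
  rintro y ⟨-, d, hd, hz, -⟩
  rw [abs_le] at hz
  rcases h d hd with h | h <;> linarith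

theorem exists_slab {x : Fin (n + 1) → ℝ} {z : ℝ} (h0 : x 0 ≤ z) (h1 : z ≤ x (Fin.last n))
    (hn : n ≠ 0) : ∃ k : Fin n, x k.castSucc ≤ z ∧ z ≤ x k.succ := by
  obtain ⟨m, rfl⟩ := Nat.exists_eq_succ_of_ne_zero hn
  by_contra hcon
  push Not at hcon
  have h : ∀ i, x i ≤ z := Fin.induction h0 fun i hi => (hcon i hi).le
  exact absurd (hcon (Fin.last m) (h _)) (not_lt.2 h1)

theorem DiscConf.cutHeight_le_level (c : Fin n → DiscConf G M X) (p : stdSimplex ℝ (Fin (n + 1))) :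
    DiscConf.cutHeight c 0 ≤ level (DiscConf.cutMeasure c p) ∧
      level (DiscConf.cutMeasure c p) ≤ DiscConf.cutHeight c (Fin.last n) := by
  have h := DiscConf.isCutMeasure c p
  exact ⟨le_level h.nonneg h.sum_eq_one fun x hx => DiscConf.cutHeight_zero c ▸ (h.bounds x hx).1,
    level_le h.nonneg h.sum_eq_one fun x hx => (h.bounds x hx).2⟩

theorem isThickSliceMap_sliceMap : IsThickSliceMap (sliceMap (G := G) (M := M) (X := X)) := by
  intro n c p
  have hμ := DiscConf.isCutMeasure c p
  have key : ∀ k t, InThickSlice (fun l => (c l).len) p k t ↔ t ∈ Ioo 0 (c k).len ∧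
      mass (DiscConf.cutMeasure c p) (DiscConf.cutHeight c k.castSucc + t) = 1 := by
    intro k t
    rw [inThickSlice_iff (DiscConf.cutHeight_succ c) (DiscConf.monotone_cutHeight c),
      DiscConf.cutMeasure, mass_sum_single]
  refine ⟨fun k t h => ?_, fun h => ?_⟩
  · rw [key] at h
    rw [sliceMap_mk, level_eq_of_mass_eq_one hμ.nonneg h.2, DiscConf.slice_total c k
      (by linarith [h.1.1]) (by rw [DiscConf.cutHeight_succ]; linarith [h.1.2]),
      add_sub_cancel_left]
  · rw [sliceMap_mk]
    set z := level (DiscConf.cutMeasure c p) with hz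
    refine LineConf.Clean.slice_eq_empty ?_
    by_cases hi : ∃ i, z = DiscConf.cutHeight c i
    · obtain ⟨i, hi⟩ := hi
      rw [hi]
      exact DiscConf.clean_partialSum c i
    · push Not at hi
      obtain ⟨h0, h1⟩ := DiscConf.cutHeight_le_level c p
      have hn : n ≠ 0 := by
        rintro rfl
        exact hi 0 (le_antisymm h1 h0)
      obtain ⟨k, h2, h3⟩ := exists_slab h0 h1 hn
      have h2 := h2.lt_of_ne (hi k.castSucc).symm
      have h3 := h3.lt_of_ne (hi k.succ)
      rw [DiscConf.cutHeight_succ] at h3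
      refine absurd ⟨k, z - DiscConf.cutHeight c k.castSucc, (key _ _).2 ⟨⟨?_, ?_⟩, ?_⟩⟩ h
      · linarith
      · linarith
      · rw [add_sub_cancel]
        refine mass_level hμ.nonneg hμ.sum_eq_one fun hmem => ?_
        obtain ⟨i, hi', -⟩ := exists_of_mem_support_sum_single hmem
        exact hi i hi'

theorem DiscConf.continuous_level :
    Continuous fun q : (Fin n → DiscConf G M X) × stdSimplex ℝ (Fin (n + 1)) =>
      level (DiscConf.cutMeasure q.1 q.2) := by
  refine continuous_iff_continuousAt.2 fun w₀ => continuousAt_level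
    (x := fun q : (Fin n → DiscConf G M X) × stdSimplex ℝ (Fin (n + 1)) => DiscConf.cutHeight q.1)
    (p := fun q : (Fin n → DiscConf G M X) × stdSimplex ℝ (Fin (n + 1)) => q.2.1) ?_ ?_
    (Eventually.of_forall fun w => w.2.2)
  · exact (continuous_pi fun i =>
      (DiscConf.continuous_cutHeight i).comp continuous_fst).continuousAt
  · exact (continuous_subtype_val.comp continuous_snd).continuousAt

/-- The set of pairs whose slicing height is in the `k`-th slab. -/
def levelSlab (G M X : Type*) [Group G] [MulAction G M] [TopologicalSpace M] [TopologicalSpace X]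
    [BasedSpace X] [MulAction G X] [BasedGSpace G X] {n : ℕ} (k : Fin n) :
    Set ((Fin n → DiscConf G M X) × stdSimplex ℝ (Fin (n + 1))) :=
  {q | DiscConf.cutHeight q.1 k.castSucc ≤ level (DiscConf.cutMeasure q.1 q.2) ∧
    level (DiscConf.cutMeasure q.1 q.2) ≤ DiscConf.cutHeight q.1 k.succ}

theorem isClosed_levelSlab (k : Fin n) : IsClosed (levelSlab G M X k) :=
  (isClosed_le ((DiscConf.continuous_cutHeight _).comp continuous_fst)
    DiscConf.continuous_level).inter
    (isClosed_le DiscConf.continuous_level ((DiscConf.continuous_cutHeight _).comp continuous_fst))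

theorem iUnion_levelSlab (hn : n ≠ 0) : ⋃ k, levelSlab G M X (n := n) k = univ :=
  eq_univ_of_forall fun q =>
    let ⟨h0, h1⟩ := DiscConf.cutHeight_le_level q.1 q.2
    mem_iUnion.2 (exists_slab h0 h1 hn)

theorem continuous_sliceMap : Continuous (sliceMap (G := G) (M := M) (X := X)) := by
  refine (isQuotientMap_quot_mk (r := NerveRel (DiscConf G M X))).continuous_iff.2
    (continuous_sigma fun n => ?_)
  change Continuous fun q : (Fin n → DiscConf G M X) × stdSimplex ℝ (Fin (n + 1)) =>
    (DiscConf.total q.1).slice (level (DiscConf.cutMeasure q.1 q.2))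
  by_cases hn : n = 0
  · subst hn
    have : ∀ q : (Fin 0 → DiscConf G M X) × stdSimplex ℝ (Fin (0 + 1)),
        (DiscConf.total q.1).slice (level (DiscConf.cutMeasure q.1 q.2)) = Conf.empty _ _ _ := by
      intro q
      refine Conf.ext (eq_empty_of_forall_notMem ?_)
      rintro y ⟨-, d, hd, -⟩
      exact hd
    simp only [this]
    exact continuous_const
  · refine (locallyFinite_of_finite _).continuous (iUnion_levelSlab hn)
      isClosed_levelSlab fun k => ?_
    have h1 : Continuous fun q : (Fin n → DiscConf G M X) × stdSimplex ℝ (Fin (n + 1)) =>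
        (q.1 k, level (DiscConf.cutMeasure q.1 q.2) - DiscConf.cutHeight q.1 k.castSucc) :=
      ((continuous_apply k).comp continuous_fst).prodMk (DiscConf.continuous_level.sub
        ((DiscConf.continuous_cutHeight _).comp continuous_fst))
    have h2 := (continuous_slice (G := G) (M := M) (X := X)).comp h1
    exact h2.continuousOn.congr fun q hq => DiscConf.slice_total q.1 k hq.1 hq.2

end Slicing

/-! ### Choosing heights away from the points of a configuration -/

section Coord

variable {G X : Type*} [Group G] [TopologicalSpace X] [BasedSpace X] [MulAction G X]

/-- The coordinates of a point of the reduced suspension; a junk value at the basepoint. -/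
noncomputable def Susp.coord (z : Susp X) : I × X := Quotient.out z

theorem Susp.mk_coord (z : Susp X) : Susp.mk z.coord.1 z.coord.2 = z := Quotient.out_eq z

theorem Susp.coord_mk {t : I} {x : X} (h : Susp.mk t x ≠ BasedSpace.pt) :
    (Susp.mk t x).coord = (t, x) := by
  obtain ⟨h1, h2⟩ := Susp.mk_inj (Susp.mk_coord (Susp.mk t x)) (by rwa [Susp.mk_coord])
  exact Prod.ext h1 h2

theorem Susp.coord_smul [BasedGSpace G X] (g : G) {z : Susp X} (h : z ≠ BasedSpace.pt) :
    (g • z).coord = (z.coord.1, g • z.coord.2) := by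
  have h1 : g • z = Susp.mk z.coord.1 (g • z.coord.2) := by
    rw [← Susp.smul_mk, Susp.mk_coord]
  rw [h1, Susp.coord_mk]
  rw [← h1]
  exact smul_ne_pt g h

namespace LabelContraction

variable (D : LabelContraction G X)

theorem ne_pt_of_depth_lt {z : Susp X} (h : D.depth z < 1) : z ≠ BasedSpace.pt := by
  rintro rfl
  exact absurd D.depth_pt h.ne

theorem continuousAt_coord {z : Susp X} (h : D.depth z < 1) : ContinuousAt Susp.coord z := by
  have hU : IsOpen {z : Susp X | D.depth z < 1} := isOpen_lt D.continuous_depth continuous_const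
  have hc : ContinuousOn Susp.coord {z : Susp X | D.depth z < 1} := by
    rw [continuousOn_iff_continuous_domRestrict]
    refine (Susp.isQuotientMap_mk.restrictPreimage_isOpen hU).continuous_iff.2 ?_
    refine continuous_subtype_val.congr fun p => ?_
    exact (Susp.coord_mk (D.ne_pt_of_depth_lt p.2)).symm
  exact hc.continuousAt (hU.mem_nhds h)

theorem depth_coord (z : Susp X) : D.depth z = max (D.ρ z.coord.2) (endDepth z.coord.1) := by
  conv_lhs => rw [← Susp.mk_coord z]
  rfl

/-- How far the height at which a point of `SX` is placed in the room `L` is away from `κ`, up to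
a factor, truncated at `1`; points of depth at least `1/4` do not count. -/
noncomputable def gap (κ : ℕ) (L : ℝ) (z : Susp X) : ℝ :=
  min 1 (max (2 * |(L + 1) * ramp z.coord.1 - κ|) (4 * D.depth z))

theorem gap_nonneg (κ : ℕ) (L : ℝ) (z : Susp X) : 0 ≤ D.gap κ L z :=
  le_min zero_le_one (le_max_of_le_left (by positivity))

theorem gap_le_one (κ : ℕ) (L : ℝ) (z : Susp X) : D.gap κ L z ≤ 1 := min_le_left _ _

theorem gap_of_depth {κ : ℕ} {L : ℝ} {z : Susp X} (h : 1 / 4 ≤ D.depth z) : D.gap κ L z = 1 :=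
  min_eq_left (le_max_of_le_right (by linarith))

theorem continuous_gap (κ : ℕ) : Continuous fun p : Susp X × ℝ => D.gap κ p.2 p.1 := by
  refine Susp.isQuotientMap_mk.continuous_lift_prod_left ?_
  have h : ∀ p : (I × X) × ℝ, min 1 (max (2 * |(p.2 + 1) * ramp p.1.1 - κ|)
      (4 * D.depth (Susp.mk p.1.1 p.1.2))) = D.gap κ p.2 (Susp.mk p.1.1 p.1.2) := by
    intro p
    by_cases hp : Susp.mk p.1.1 p.1.2 = BasedSpace.pt
    · have h1 : 1 / 4 ≤ D.depth (Susp.mk p.1.1 p.1.2) := by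
        rw [hp, D.depth_pt]
        norm_num
      rw [D.gap_of_depth h1, min_eq_left]
      exact le_max_of_le_right (by linarith)
    · rw [gap, Susp.coord_mk hp]
  refine Continuous.congr ?_ h
  have h1 := D.continuous_depth.comp (Susp.continuous_mk (X := X))
  have h2 : Continuous fun p : (I × X) × ℝ => D.depth (Susp.mk p.1.1 p.1.2) :=
    h1.comp continuous_fst
  have h3 := continuous_ramp
  fun_prop

end LabelContraction
end Coord

namespace LabelContraction

section Weight

variable {G M X : Type*} [Group G] [Finite G] [TopologicalSpace M] [T2Space M] [MulAction G M]
  [ContinuousConstSMul G M] [TopologicalSpace X] [BasedSpace X] [MulAction G X] [BasedGSpace G X]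
  (D : LabelContraction G X)

/-- The product of the distances of the points of a configuration from the height `κ`. -/
noncomputable def clearance (κ : ℕ) (ζ : Conf G M (Susp X)) : ℝ := ζ.prod (D.gap κ (D.room ζ))

theorem continuous_clearance (κ : ℕ) :
    Continuous (D.clearance κ : Conf G M (Susp X) → ℝ) := by
  have h1 := Conf.continuous_prod (G := G) (M := M) (φ := fun L : ℝ => D.gap κ L)
    (fun L => D.gap_of_depth (by rw [D.depth_pt]; norm_num)) (D.continuous_gap κ)
  exact h1.comp (continuous_id.prodMk D.continuous_room)

theorem clearance_le_gap {κ : ℕ} {ζ : Conf G M (Susp X)} {p : M × Susp X} (hp : p ∈ ζ.carrier) :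
    D.clearance κ ζ ≤ D.gap κ (D.room ζ) p.2 := by
  classical
  rw [clearance, Conf.prod, ← Finset.mul_prod_erase _ _ (ζ.finite.mem_toFinset.2 hp)]
  exact mul_le_of_le_one_right (D.gap_nonneg _ _ _)
    (Finset.prod_le_one (fun _ _ => D.gap_nonneg _ _ _) fun _ _ => D.gap_le_one _ _ _)

theorem clearance_le_one (κ : ℕ) (ζ : Conf G M (Susp X)) : D.clearance κ ζ ≤ 1 :=
  Finset.prod_le_one (fun _ _ => D.gap_nonneg _ _ _) fun _ _ => D.gap_le_one _ _ _

/-- There is room for a height away from all points: each point obstructs at most one integer, and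
there are more integers below half the room than points. -/
theorem exists_clearance_eq_one (ζ : Conf G M (Susp X)) :
    ∃ κ : ℕ, 2 * κ ≤ D.room ζ ∧ D.clearance κ ζ = 1 := by
  classical
  set A := ζ.finite.toFinset.filter fun p => D.depth p.2 < 1 / 4 with hA
  have hcard : 2 * (A.card : ℝ) ≤ D.room ζ := by
    rw [room, Conf.sum, ← nsmul_one, ← Finset.sum_const]
    refine mul_le_mul_of_nonneg_left ?_ zero_le_two
    refine (Finset.sum_le_sum fun p hp => ?_).trans
      (Finset.sum_le_sum_of_subset_of_nonneg (Finset.filter_subset _ _) fun p _ _ => ?_)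
    · have := (Finset.mem_filter.1 hp).2
      exact le_min le_rfl (by linarith)
    · exact le_min zero_le_one (by linarith [D.depth_le_one p.2])
  by_contra hcon
  push Not at hcon
  have h : ∀ κ : Fin (A.card + 1), ∃ p ∈ A,
      2 * |(D.room ζ + 1) * ramp p.2.coord.1 - (κ : ℕ)| < 1 := by
    intro κ
    have h1 : ((κ : ℕ) : ℝ) ≤ A.card := by exact_mod_cast Nat.lt_succ_iff.1 κ.2
    have h2 := hcon κ (by linarith)
    obtain ⟨p, hp, h3⟩ : ∃ p ∈ ζ.finite.toFinset, D.gap κ (D.room ζ) p.2 ≠ 1 := by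
      by_contra hcon'
      push Not at hcon'
      exact h2 (Finset.prod_eq_one hcon')
    have h4 := (D.gap_le_one _ _ _).lt_of_ne h3
    rw [gap, min_lt_iff] at h4
    have h5 := max_lt_iff.1 (h4.resolve_left (lt_irrefl _))
    exact ⟨p, Finset.mem_filter.2 ⟨hp, by linarith [h5.2]⟩, h5.1⟩
  choose f hf hf' using h
  obtain ⟨κ, -, κ', -, hne, heq⟩ := Finset.exists_ne_map_eq_of_card_lt_of_maps_to
    (s := Finset.univ) (t := A) (by simp) (f := f) fun κ _ => hf κ
  have h1 := hf' κ
  have h2 := hf' κ'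
  rw [← heq] at h2
  have h1 := abs_lt.1 ((lt_div_iff₀' two_pos).2 h1)
  have h2 := abs_lt.1 ((lt_div_iff₀' two_pos).2 h2)
  have h3 : ((κ : ℕ) : ℝ) < (κ' : ℕ) + 1 := by linarith [h1.1, h1.2, h2.1, h2.2]
  have h4 : ((κ' : ℕ) : ℝ) < (κ : ℕ) + 1 := by linarith [h1.1, h1.2, h2.1, h2.2]
  norm_cast at h3 h4
  exact hne (Fin.ext (by omega))

/-- The part of the remaining weight that is given to the height `κ`. -/
noncomputable def share (κ : ℕ) (ζ : Conf G M (Susp X)) : ℝ := max 0 (2 * D.clearance κ ζ - 1)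

theorem share_nonneg (κ : ℕ) (ζ : Conf G M (Susp X)) : 0 ≤ D.share κ ζ := le_max_left _ _

theorem share_le_one (κ : ℕ) (ζ : Conf G M (Susp X)) : D.share κ ζ ≤ 1 :=
  max_le zero_le_one (by linarith [D.clearance_le_one κ ζ])

/-- The weight of the height `κ`: the heights `0`, `1`, … in turn take their shares of what is left
of the total weight `1`.  A height of clearance `1` takes all that is left, so that the weights depend
continuously on the configuration, and only finitely many are non-zero. -/
noncomputable def weight (κ : ℕ) (ζ : Conf G M (Susp X)) : ℝ :=
  D.share κ ζ * ∏ i ∈ Finset.range κ, (1 - D.share i ζ)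

theorem continuous_weight (κ : ℕ) : Continuous (D.weight κ : Conf G M (Susp X) → ℝ) := by
  have h : ∀ κ, Continuous (D.share κ : Conf G M (Susp X) → ℝ) := fun κ =>
    continuous_const.max ((continuous_const.mul (D.continuous_clearance κ)).sub continuous_const)
  exact (h κ).mul (continuous_finsetProd _ fun i _ => continuous_const.sub (h i))

theorem weight_nonneg (κ : ℕ) (ζ : Conf G M (Susp X)) : 0 ≤ D.weight κ ζ :=
  mul_nonneg (D.share_nonneg _ _)
    (Finset.prod_nonneg fun i _ => sub_nonneg.2 (D.share_le_one i ζ))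

theorem clearance_of_weight_ne {κ : ℕ} {ζ : Conf G M (Susp X)} (h : D.weight κ ζ ≠ 0) :
    1 / 2 < D.clearance κ ζ := by
  by_contra hcon
  refine h ?_
  rw [weight, share, max_eq_left (by linarith), zero_mul]

theorem share_eq_one {κ : ℕ} {ζ : Conf G M (Susp X)} (h : D.clearance κ ζ = 1) :
    D.share κ ζ = 1 := by
  rw [share, h]
  norm_num

theorem le_room_of_weight_ne {κ : ℕ} {ζ : Conf G M (Susp X)} (h : D.weight κ ζ ≠ 0) :
    2 * κ ≤ D.room ζ := by
  obtain ⟨κ', h1, h2⟩ := D.exists_clearance_eq_one ζ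
  have h3 : κ ≤ κ' := by
    by_contra hcon
    refine h ?_
    rw [weight, Finset.prod_eq_zero (Finset.mem_range.2 (not_le.1 hcon)), mul_zero]
    rw [D.share_eq_one h2, sub_self]
  have h4 : (κ : ℝ) ≤ κ' := by exact_mod_cast h3
  linarith

theorem sum_range_weight (n : ℕ) (ζ : Conf G M (Susp X)) :
    ∑ κ ∈ Finset.range n, D.weight κ ζ = 1 - ∏ κ ∈ Finset.range n, (1 - D.share κ ζ) := by
  induction n with
  | zero => simp
  | succ n ih =>
    rw [Finset.sum_range_succ, Finset.prod_range_succ, ih, weight]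
    ring

theorem sum_weight {ζ : Conf G M (Susp X)} {A : Finset ℕ} (hA : ∀ κ, D.weight κ ζ ≠ 0 → κ ∈ A) :
    ∑ κ ∈ A, D.weight κ ζ = 1 := by
  obtain ⟨κ', h1, h2⟩ := D.exists_clearance_eq_one ζ
  have h3 : ∑ κ ∈ Finset.range (κ' + 1), D.weight κ ζ = 1 := by
    rw [sum_range_weight, Finset.prod_eq_zero (Finset.self_mem_range_succ κ'), sub_zero]
    rw [D.share_eq_one h2, sub_self]
  rw [← h3]
  refine Finset.sum_congr_of_eq_on_inter (fun κ _ hκ => ?_) (fun κ _ hκ => ?_) fun _ _ _ => rfl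
  · have h4 : κ' < κ := by simpa using hκ
    rw [weight, Finset.prod_eq_zero (Finset.mem_range.2 h4), mul_zero]
    rw [D.share_eq_one h2, sub_self]
  · by_contra h
    exact hκ (hA κ h)

/-- The weights of all heights, as a probability measure on the line. -/
noncomputable def weights (ζ : Conf G M (Susp X)) : ℝ →₀ ℝ :=
  ∑ κ ∈ Finset.range (⌊D.room ζ⌋₊ + 1), Finsupp.single (κ : ℝ) (D.weight κ ζ)

theorem weights_eq {ζ : Conf G M (Susp X)} {A : Finset ℕ} (hA : ∀ κ, D.weight κ ζ ≠ 0 → κ ∈ A) :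
    D.weights ζ = ∑ κ : A, Finsupp.single ((κ : ℕ) : ℝ) (D.weight κ ζ) := by
  rw [weights, Finset.sum_coe_sort A fun κ => Finsupp.single (κ : ℝ) (D.weight κ ζ)]
  refine Finset.sum_congr_of_eq_on_inter (fun κ _ hκ => ?_) (fun κ _ hκ => ?_) fun _ _ _ => rfl
  · by_contra h
    exact hκ (hA κ fun h' => h (by rw [h', Finsupp.single_zero]))
  · by_contra h
    have h1 := D.le_room_of_weight_ne fun h' => h (by rw [h', Finsupp.single_zero])
    refine hκ (Finset.mem_range.2 (Nat.lt_succ_of_le (Nat.le_floor ?_)))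
    linarith [κ.cast_nonneg (α := ℝ)]

theorem weight_mem_stdSimplex {ζ : Conf G M (Susp X)} {A : Finset ℕ}
    (hA : ∀ κ, D.weight κ ζ ≠ 0 → κ ∈ A) : (fun κ : A => D.weight κ ζ) ∈ stdSimplex ℝ A :=
  ⟨fun _ => D.weight_nonneg _ _,
    (Finset.sum_coe_sort A fun κ => D.weight κ ζ).trans (D.sum_weight hA)⟩

/-- The height `κ` is usable for cutting: it is away from the points and within the room.  This is an
open condition, satisfied by all heights of positive weight. -/
def Usable (κ : ℕ) (ζ : Conf G M (Susp X)) : Prop :=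
  1 / 4 < D.clearance κ ζ ∧ (κ = 0 ∨ κ < D.room ζ)

theorem isOpen_usable (κ : ℕ) : IsOpen {ζ : Conf G M (Susp X) | D.Usable κ ζ} := by
  exact (isOpen_lt continuous_const (D.continuous_clearance κ)).inter
    (isOpen_const.union (isOpen_lt continuous_const D.continuous_room))

variable {D} in
theorem Usable.le_room {κ : ℕ} {ζ : Conf G M (Susp X)} (h : D.Usable κ ζ) : (κ : ℝ) ≤ D.room ζ := by
  rcases h.2 with rfl | h
  · exact_mod_cast D.room_nonneg ζ
  · exact h.le

/-- Near a configuration, all weight is at finitely many heights usable for all configurations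
nearby. -/
theorem eventually_usable (ζ₀ : Conf G M (Susp X)) :
    ∃ A : Finset ℕ, ∀ᶠ ζ in 𝓝 ζ₀, (∀ κ ∈ A, D.Usable κ ζ) ∧ ∀ κ, D.weight κ ζ ≠ 0 → κ ∈ A := by
  classical
  set N := ⌊D.room ζ₀⌋₊ + 1 with hN
  refine ⟨(Finset.range N).filter fun κ => D.Usable κ ζ₀, ?_⟩
  have h1 : ∀ᶠ ζ in 𝓝 ζ₀, ∀ κ ∈ (Finset.range N).filter fun κ => D.Usable κ ζ₀, D.Usable κ ζ :=
    (Filter.eventually_all_finset _).2 fun κ hκ =>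
      (D.isOpen_usable κ).mem_nhds (Finset.mem_filter.1 hκ).2
  have h2 : ∀ᶠ ζ in 𝓝 ζ₀, ∀ κ ∈ Finset.range N, ¬ D.Usable κ ζ₀ → D.weight κ ζ = 0 := by
    refine (Filter.eventually_all_finset _).2 fun κ _ => ?_
    by_cases hκ : D.Usable κ ζ₀
    · exact Eventually.of_forall fun _ h => absurd hκ h
    · rw [Usable, not_and_or, not_or] at hκ
      rcases hκ with hκ | ⟨h0, hκ⟩
      · have h3 : D.clearance κ ζ₀ < 1 / 2 := by linarith
        filter_upwards [(D.continuous_clearance κ).continuousAt.eventually_lt_const h3] with ζ hζ _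
        by_contra h
        linarith [D.clearance_of_weight_ne h]
      · have h2 : (0 : ℝ) < κ := by exact_mod_cast Nat.pos_of_ne_zero h0
        have h3 : D.room ζ₀ < 2 * κ := by linarith
        filter_upwards [(D.continuous_room).continuousAt.eventually_lt_const h3] with ζ hζ _
        by_contra h
        linarith [D.le_room_of_weight_ne h]
  have h3 : D.room ζ₀ < N := by
    rw [hN]
    exact_mod_cast Nat.lt_floor_add_one (D.room ζ₀)
  filter_upwards [h1, h2, (D.continuous_room).continuousAt.eventually_lt_const h3] with ζ h1 h2 h3
  refine ⟨h1, fun κ hκ => Finset.mem_filter.2 ?_⟩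
  have h4 := D.le_room_of_weight_ne hκ
  have h5 : κ < N := by
    have : (κ : ℝ) < N := by linarith [κ.cast_nonneg (α := ℝ)]
    exact_mod_cast this
  refine ⟨Finset.mem_range.2 h5, ?_⟩
  by_contra h
  exact hκ (h2 κ (Finset.mem_range.2 h5) h)

/-- The height of a point that counts is at distance more than `1 / 8` from a usable height. -/
theorem Usable.lt_abs_sub {κ : ℕ} {ζ : Conf G M (Susp X)} (h : D.Usable κ ζ) {p : M × Susp X}
    (hp : p ∈ ζ.carrier) (hρ : D.ρ p.2.coord.2 = 0) :
    1 / 8 < |(D.room ζ + 1) * ramp p.2.coord.1 - κ| := by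
  have h1 := (lt_min_iff.1 (h.1.trans_le (D.clearance_le_gap hp))).2
  rcases lt_max_iff.1 h1 with h2 | h2
  · linarith
  · rw [D.depth_coord, hρ] at h2
    have h3 : 0 < endDepth p.2.coord.1 := by
      rcases lt_max_iff.1 (show 0 < max 0 (endDepth p.2.coord.1) by linarith) with h3 | h3
      · exact absurd h3 (lt_irrefl _)
      · exact h3
    have h4 := h.le_room
    have h5 := D.room_nonneg ζ
    have h6 : (0 : ℝ) ≤ κ := κ.cast_nonneg
    rcases eq_or_eq_neg_of_abs_eq (abs_ramp_of_endDepth_pos h3) with h7 | h7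
    · rw [h7, lt_abs]
      exact Or.inl (by linarith)
    · rw [h7, lt_abs]
      exact Or.inr (by linarith)

end Weight
end LabelContraction

/-! ### The homotopy inverse -/

section Restr

variable {G M X : Type*} [Group G] [MulAction G M] [TopologicalSpace M] [TopologicalSpace X]
  [BasedSpace X] [MulAction G X] [BasedGSpace G X]

theorem apart_shift {s : ℝ} {d d' : LabelledDisc M X} (h : d.Apart d') :
    (shift s d).Apart (shift s d') := by
  intro hb
  have h1 := Set.disjoint_left.1 (h hb)
  exact Set.disjoint_left.2 fun y hy hy' =>
    @h1 (y - s) (mem_interval_shift.1 hy) (mem_interval_shift.1 hy')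

theorem LineConf.mem_restr_iff {S : LineConf G M X} {x y : ℝ} {d : LabelledDisc M X} :
    d ∈ (S.restr x y).carrier ↔
      shift x d ∈ S.carrier ∧ 0 < d.height - d.radius ∧ d.height + d.radius < y - x := by
  rcases le_total x y with h | h
  · exact LineConf.mem_restr h
  · refine and_congr_right fun hd => ⟨fun h1 => ?_, fun h1 => ?_⟩
    · have h2 := InSlab.bounds h1
      rw [max_eq_left (by linarith)] at h2
      linarith [h2.1, h2.2, h1.1]
    · have := S.radius_pos (shift x d) hd
      simp only [shift, LabelledDisc.height, LabelledDisc.radius] at h1 this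
      linarith [h1.1, h1.2]

/-- The part of a collection between two moving heights is continuous at a point, if near it the
discs in this part are listed by a family of discs that lie strictly between the two heights. -/
theorem LineConf.continuousAt_restr {W ι : Type*} [TopologicalSpace W] [Finite ι]
    {S : W → LineConf G M X} {a b : W → ℝ} {w₀ : W} (f : W → ι → LabelledDisc M X)
    (ha : ContinuousAt a w₀) (hb : ContinuousAt b w₀)
    (hf : ∀ i, ContinuousAt (fun w => f w i) w₀)
    (hin : ∀ i, a w₀ < (f w₀ i).height - (f w₀ i).radius ∧
      (f w₀ i).height + (f w₀ i).radius < b w₀)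
    (hr : ∀ᶠ w in 𝓝 w₀, ∀ i, 0 < (f w i).radius)
    (hapart : ∀ᶠ w in 𝓝 w₀, ∀ i j, i ≠ j → (f w i).Apart (f w j))
    (hact : ∀ᶠ w in 𝓝 w₀, ∀ (g : G) i, ∃ j, f w j = (f w i).act g)
    (hmem : ∀ᶠ w in 𝓝 w₀, ∀ i, (f w i).label ≠ BasedSpace.pt → f w i ∈ (S w).carrier)
    (hex : ∀ᶠ w in 𝓝 w₀, ∀ d ∈ (S w).carrier, a w < d.height - d.radius →
      d.height + d.radius < b w → ∃ i, f w i = d) :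
    ContinuousAt (fun w => (S w).restr (a w) (b w)) w₀ := by
  have hh : ∀ i, ContinuousAt (fun w => (f w i).height) w₀ := fun i =>
    continuousAt_fst.comp (continuousAt_snd.comp (hf i))
  have hrad : ∀ i, ContinuousAt (fun w => (f w i).radius) w₀ := fun i =>
    continuousAt_fst.comp (continuousAt_snd.comp (continuousAt_snd.comp (hf i)))
  have hin1 : ∀ᶠ w in 𝓝 w₀, ∀ i, a w < (f w i).height - (f w i).radius :=
    eventually_all.2 fun i => ha.eventually_lt ((hh i).sub (hrad i)) (hin i).1
  have hin2 : ∀ᶠ w in 𝓝 w₀, ∀ i, (f w i).height + (f w i).radius < b w :=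
    eventually_all.2 fun i => ((hh i).add (hrad i)).eventually_lt hb (hin i).2
  refine DiscConf.continuousAt_of_family (fun w i => shift (-a w) (f w i))
    (continuousAt_const.max (hb.sub ha)) (fun i => ?_) ?_
  · exact (continuousAt_fst.comp (hf i)).prodMk ((ha.neg.add (hh i)).prodMk
      (continuousAt_snd.comp (continuousAt_snd.comp (hf i))))
  · filter_upwards [hr, hapart, hact, hmem, hex, hin1, hin2] with w hr hapart hact hmem hex
      hin1 hin2
    have hs : ∀ d : LabelledDisc M X, shift (a w) (shift (-a w) d) = d := fun d => by
      rw [shift_shift, add_neg_cancel, shift_zero]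
    refine ⟨fun i => ?_, fun i j hij => apart_shift (hapart i j hij), fun g i => ?_, ?_⟩
    · have h1 := hin1 i
      have h2 := hin2 i
      refine inSlab_of_bounds (hr i) ?_ (lt_max_of_lt_right ?_) <;>
      · simp only [shift, LabelledDisc.height, LabelledDisc.radius] at h1 h2 ⊢
        linarith
    · obtain ⟨j, hj⟩ := hact g i
      exact ⟨j, by rw [hj]; rfl⟩
    · ext d
      rw [LineConf.mem_restr_iff]
      constructor
      · rintro ⟨h, h1, h2⟩
        obtain ⟨i, hi⟩ := hex _ h
          (by simp only [shift, LabelledDisc.height, LabelledDisc.radius] at h1 h2 ⊢; linarith)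
          (by simp only [shift, LabelledDisc.height, LabelledDisc.radius] at h1 h2 ⊢; linarith)
        refine ⟨⟨i, ?_⟩, (S w).label_ne (shift (a w) d) h⟩
        beta_reduce
        rw [hi, shift_shift, neg_add_cancel, shift_zero]
      · rintro ⟨⟨i, rfl⟩, hd⟩
        beta_reduce
        rw [hs]
        have h1 := hin1 i
        have h2 := hin2 i
        refine ⟨hmem i hd, ?_, ?_⟩ <;>
        · simp only [shift, LabelledDisc.height, LabelledDisc.radius] at h1 h2 ⊢
          linarith

end Restr

section ConfTuple

variable {G M Y : Type*} [Group G] [Finite G] [TopologicalSpace M] [T2Space M] [MulAction G M]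
  [ContinuousConstSMul G M] [TopologicalSpace Y] [BasedSpace Y] [MulAction G Y] [BasedGSpace G Y]

theorem ConfTuple.continuous_point {q : ℕ} (i : Fin q) :
    Continuous fun f : ConfTuple G M Y q => f.1 i :=
  (continuous_apply i).comp continuous_subtype_val

/-- The permutation of an ordered configuration by an element of `G` is locally constant. -/
theorem ConfTuple.eventually_smul {q : ℕ} (w₀ : ConfTuple G M Y q) :
    ∀ᶠ w in 𝓝 w₀, ∀ (g : G) (i j : Fin q), w.1 j = g • w.1 i → w₀.1 j = g • w₀.1 i := by
  refine eventually_all.2 fun g => ?_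
  filter_upwards [eventually_eq_map (P := fun (w : ConfTuple G M Y q) i => (w.1 i).1)
    (continuous_const_smul g) fun i =>
      (continuous_fst.comp (ConfTuple.continuous_point i)).continuousAt] with w hw i j hij
  have h2 := hw i j (congrArg Prod.fst hij)
  obtain ⟨j', hj'⟩ := w₀.2.2 g i
  have : j' = j := w₀.2.1 (by
    change (w₀.1 j').1 = (w₀.1 j).1
    rw [h2, hj']
    rfl)
  rw [← this, hj']

end ConfTuple

namespace LabelContraction

variable {G M X : Type*} [Group G] [Finite G] [TopologicalSpace M] [T2Space M] [MulAction G M]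
  [ContinuousConstSMul G M] [TopologicalSpace X] [BasedSpace X] [MulAction G X] [BasedGSpace G X]
  (D : LabelContraction G X)

theorem depth_smul (g : G) (z : Susp X) : D.depth (g • z) = D.depth z := by
  induction z using Quotient.inductionOn with
  | h p =>
    change max (D.ρ (g • p.2)) _ = max (D.ρ p.2) _
    rw [D.ρ_smul]

/-- The disc of fixed radius over a labelled point, placed at a height that depends on its
suspension coordinate and on the room `L`.  The radius is a third of the radius `1/8` that is used in
the spreading. -/
noncomputable def place (L : ℝ) (p : M × Susp X) : LabelledDisc M X :=
  (p.1, (L + 1) * ramp p.2.coord.1, 1 / 24, D.hom (p.2.coord.2, 1))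

theorem place_smul (g : G) (L : ℝ) {p : M × Susp X} (h : p.2 ≠ BasedSpace.pt) :
    D.place L (g • p) = (D.place L p).act g := by
  simp only [place, Prod.smul_snd, Susp.coord_smul g h, Prod.smul_fst, D.hom_smul]
  rfl

theorem continuousAt_place {W : Type*} [TopologicalSpace W] {L : W → ℝ} {p : W → M × Susp X} {w : W}
    (hL : ContinuousAt L w) (hp : ContinuousAt p w) (h : D.depth (p w).2 < 1) :
    ContinuousAt (fun w => D.place (L w) (p w)) w := by
  have h1 : ContinuousAt (fun w => (p w).2.coord) w :=
    (D.continuousAt_coord h).comp (f := fun w => (p w).2) (continuousAt_snd.comp hp)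
  have h2 : ContinuousAt (fun w => ((p w).2.coord.1 : ℝ)) w :=
    continuous_subtype_val.continuousAt.comp (continuousAt_fst.comp h1)
  have h3 : ContinuousAt (fun w => ramp (p w).2.coord.1) w :=
    continuous_ramp.continuousAt.comp (f := fun w => ((p w).2.coord.1 : ℝ)) h2
  have h4 : ContinuousAt (fun w => D.hom ((p w).2.coord.2, 1)) w :=
    D.continuous_hom.continuousAt.comp (f := fun w => ((p w).2.coord.2, (1 : I)))
      ((continuousAt_snd.comp h1).prodMk continuousAt_const)
  exact (continuousAt_fst.comp hp).prodMk (((hL.add continuousAt_const).mul h3).prodMk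
    (continuousAt_const.prodMk h4))

/-- The collection of the discs placed over the points of a configuration labelled in `SX`. -/
noncomputable def stack (ζ : Conf G M (Susp X)) : LineConf G M X where
  carrier := {d | d.label ≠ BasedSpace.pt ∧ ∃ p ∈ ζ.carrier, d = D.place (D.room ζ) p}
  finite := by
    refine (ζ.finite.image fun p => D.place (D.room ζ) p).subset ?_
    rintro _ ⟨-, p, hp, rfl⟩
    exact ⟨p, hp, rfl⟩
  radius_pos := by
    rintro _ ⟨-, p, hp, rfl⟩
    change (0 : ℝ) < 1 / 24
    norm_num
  apart := by
    rintro _ ⟨-, p, hp, rfl⟩ _ ⟨-, p', hp', rfl⟩ hne hb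
    exact absurd (congrArg (D.place (D.room ζ)) (ζ.injOn hp hp' hb)) hne
  label_ne := fun _ h => h.1
  act_mem := by
    rintro g _ ⟨hd, p, hp, rfl⟩
    exact ⟨smul_ne_pt g hd, g • p, ζ.smul_mem g p hp, (D.place_smul g _ (ζ.label_ne p hp)).symm⟩

theorem clean_stack {κ : ℕ} {ζ : Conf G M (Susp X)} (h : D.Usable κ ζ) : (D.stack ζ).Clean κ := by
  rintro _ ⟨hd, p, hp, rfl⟩
  have h1 := h.lt_abs_sub D hp (D.label_ne_pt hd)
  simp only [place, LabelledDisc.height, LabelledDisc.radius]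
  rcases lt_abs.1 h1 with h2 | h2
  · exact Or.inr (by linarith)
  · exact Or.inl (by linarith)

theorem continuousAt_restr_stack {κ κ' : ℕ} {q : ℕ} {w₀ : ConfTuple G M (Susp X) q}
    (h : D.Usable κ (toConf ⟨q, w₀⟩)) (h' : D.Usable κ' (toConf ⟨q, w₀⟩)) :
    ContinuousAt (fun w : ConfTuple G M (Susp X) q =>
      (D.stack (toConf ⟨q, w⟩)).restr κ κ') w₀ := by
  have hconf : Continuous fun w : ConfTuple G M (Susp X) q => toConf ⟨q, w⟩ :=
    isQuotientMap_toConf.continuous.comp continuous_sigmaMk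
  set L : ConfTuple G M (Susp X) q → ℝ := fun w => D.room (toConf ⟨q, w⟩) with hL
  have hLc : Continuous L := D.continuous_room.comp hconf
  have hdep : ∀ i, Continuous fun w : ConfTuple G M (Susp X) q => D.depth (w.1 i).2 := fun i =>
    D.continuous_depth.comp (continuous_snd.comp (ConfTuple.continuous_point i))
  -- Only discs over points with depth zero contribute.
  let ι := {i : Fin q // D.depth (w₀.1 i).2 = 0 ∧ (κ : ℝ) < (D.place (L w₀) (w₀.1 i)).height - 1 / 24 ∧
    (D.place (L w₀) (w₀.1 i)).height + 1 / 24 < κ'}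
  have hlt : ∀ i : ι, D.depth (w₀.1 i).2 < 1 := fun i => by rw [i.2.1]; exact zero_lt_one
  have hne : ∀ᶠ w in 𝓝 w₀, ∀ i : ι, (w.1 i).2 ≠ BasedSpace.pt := by
    refine eventually_all.2 fun i => ?_
    filter_upwards [(hdep i).continuousAt.eventually_lt_const (hlt i)] with w hw
    exact D.ne_pt_of_depth_lt hw
  have hpl : ∀ i, D.depth (w₀.1 i).2 < 1 →
      ContinuousAt (fun w : ConfTuple G M (Susp X) q => D.place (L w) (w.1 i)) w₀ := fun i hi =>
    D.continuousAt_place hLc.continuousAt (ConfTuple.continuous_point i).continuousAt hi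
  refine LineConf.continuousAt_restr (ι := ι) (fun w i => D.place (L w) (w.1 i))
    continuousAt_const continuousAt_const (fun i => hpl i (hlt i)) (fun i => i.2.2)
    (Eventually.of_forall fun w i => ?_)
    (Eventually.of_forall fun w i j hij hb => ?_) ?_ ?_ ?_
  · change (0 : ℝ) < 1 / 24
    norm_num
  · exact absurd (Subtype.ext (w.2.1 hb)) hij
  · filter_upwards [hne, ConfTuple.eventually_smul w₀] with w hw hw' g i
    obtain ⟨j, hj⟩ := w.2.2 g i
    have h1 := hw' g i j hj
    refine ⟨⟨j, ?_⟩, ?_⟩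
    · rw [h1, D.place_smul g _ (D.ne_pt_of_depth_lt (hlt i)), Prod.smul_snd, D.depth_smul]
      exact i.2
    · change D.place (L w) (w.1 j) = _
      rw [hj, D.place_smul g _ (hw i)]
  · filter_upwards [hne] with w hw i hi
    exact ⟨hi, w.1 i, ⟨mem_range_self _, hw i⟩, rfl⟩
  · have h1 : ∀ᶠ w in 𝓝 w₀, ∀ i, D.depth (w₀.1 i).2 ≠ 0 → 0 < D.depth (w.1 i).2 := by
      refine eventually_all.2 fun i => ?_
      by_cases hi : D.depth (w₀.1 i).2 = 0
      · exact Eventually.of_forall fun w h => absurd hi h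
      · have := (D.depth_nonneg (w₀.1 i).2).lt_of_ne (Ne.symm hi)
        filter_upwards [(hdep i).continuousAt.eventually_const_lt this] with w hw _ using hw
    have h2 : ∀ᶠ w in 𝓝 w₀, ∀ i, D.depth (w₀.1 i).2 = 0 →
        (κ : ℝ) < (D.place (L w) (w.1 i)).height → (D.place (L w) (w.1 i)).height < κ' →
        (κ : ℝ) < (D.place (L w₀) (w₀.1 i)).height - 1 / 24 ∧
          (D.place (L w₀) (w₀.1 i)).height + 1 / 24 < κ' := by
      refine eventually_all.2 fun i => ?_
      by_cases hi : D.depth (w₀.1 i).2 = 0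
      · have hlt : D.depth (w₀.1 i).2 < 1 := by rw [hi]; exact zero_lt_one
        have hcont : ContinuousAt (fun w : ConfTuple G M (Susp X) q =>
            (D.place (L w) (w.1 i)).height) w₀ :=
          continuousAt_fst.comp (continuousAt_snd.comp (hpl i hlt))
        have hmem : w₀.1 i ∈ (toConf ⟨q, w₀⟩).carrier :=
          ⟨mem_range_self i, D.ne_pt_of_depth_lt hlt⟩
        have hρ : D.ρ (w₀.1 i).2.coord.2 = 0 := by
          rw [D.depth_coord] at hi
          exact le_antisymm ((le_max_left _ _).trans hi.le) (D.ρ_nonneg _)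
        have h3 := h.lt_abs_sub D hmem hρ
        have h4 := h'.lt_abs_sub D hmem hρ
        change 1 / 8 < |(D.place (L w₀) (w₀.1 i)).height - κ| at h3
        change 1 / 8 < |(D.place (L w₀) (w₀.1 i)).height - κ'| at h4
        rcases lt_abs.1 h3 with h3 | h3
        · rcases lt_abs.1 h4 with h4 | h4
          · have h5 : (κ' : ℝ) < (D.place (L w₀) (w₀.1 i)).height := by linarith
            filter_upwards [hcont.eventually_const_lt h5] with w hw _ _ h6
            exact absurd h6 hw.not_gt
          · exact Eventually.of_forall fun w _ _ _ => ⟨by linarith, by linarith⟩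
        · have h5 : (D.place (L w₀) (w₀.1 i)).height < κ := by linarith
          filter_upwards [hcont.eventually_lt_const h5] with w hw _ h6
          exact absurd h6 hw.not_gt
      · exact Eventually.of_forall fun w h => absurd h hi
    have h3 : ∀ᶠ w in 𝓝 w₀, D.Usable κ' (toConf ⟨q, w⟩) :=
      hconf.continuousAt.eventually ((D.isOpen_usable κ').mem_nhds h')
    filter_upwards [h1, h2, h3] with w h1 h2 h3
    rintro _ ⟨hd, p, ⟨⟨i, rfl⟩, hp⟩, rfl⟩ h4 h5
    have h6 : (0 : ℝ) < (D.place (L w) (w.1 i)).radius := by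
      change (0 : ℝ) < 1 / 24
      norm_num
    have h4 : (κ : ℝ) < (D.place (L w) (w.1 i)).height := h4.trans (sub_lt_self _ h6)
    have h5 : (D.place (L w) (w.1 i)).height < κ' := (lt_add_of_pos_right _ h6).trans h5
    have hi : D.depth (w₀.1 i).2 = 0 := by
      by_contra hi
      have h7 := h1 i hi
      rw [D.depth_coord, D.label_ne_pt hd, lt_max_iff] at h7
      have h8 := abs_ramp_of_endDepth_pos (h7.resolve_left (lt_irrefl _))
      have h9 := h3.le_room
      have h10 := D.room_nonneg (toConf ⟨q, w⟩)
      have h11 : (0 : ℝ) ≤ κ := κ.cast_nonneg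
      simp only [place, LabelledDisc.height, hL] at h4 h5
      rcases eq_or_eq_neg_of_abs_eq h8 with h12 | h12
      · change ramp (w.1 i).2.coord.1 = 1 at h12
        rw [h12] at h4 h5
        linarith
      · change ramp (w.1 i).2.coord.1 = -1 at h12
        rw [h12] at h4 h5
        linarith
    exact ⟨⟨i, hi, h2 i hi h4 h5⟩, rfl⟩

/-- The homotopy inverse of the slicing map: the discs placed over the points of a configuration are
cut at the heights away from the points. -/
noncomputable def unslice (ζ : Conf G M (Susp X)) : ClassifyingSpace (DiscConf G M X) :=
  (D.stack ζ).cut (D.weights ζ)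

theorem continuous_unslice :
    Continuous (D.unslice : Conf G M (Susp X) → ClassifyingSpace (DiscConf G M X)) := by
  refine isQuotientMap_toConf.continuous_iff.2 (continuous_sigma fun q => ?_)
  have hconf : Continuous fun w : ConfTuple G M (Susp X) q => toConf ⟨q, w⟩ :=
    isQuotientMap_toConf.continuous.comp continuous_sigmaMk
  refine continuous_iff_continuousAt.2 fun w₀ => ?_
  change ContinuousAt (fun w => D.unslice (toConf ⟨q, w⟩)) w₀
  obtain ⟨A, hA⟩ := D.eventually_usable (toConf ⟨q, w₀⟩)
  have hA := hconf.continuousAt.eventually hA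
  have hA₀ := hA.self_of_nhds
  have h1 := LineConf.continuousWithinAt_cut (ι := A) (A := univ) (w₀ := w₀) (mem_univ _)
    (S := fun w : ConfTuple G M (Susp X) q => D.stack (toConf ⟨q, w⟩))
    (x := fun _ κ => ((κ : ℕ) : ℝ)) (p := fun w κ => D.weight κ (toConf ⟨q, w⟩))
    (by
      rw [nhdsWithin_univ]
      filter_upwards [hA] with w hw using D.weight_mem_stdSimplex hw.2)
    (Eventually.of_forall fun w κ κ' h => Nat.cast_le.2 h)
    (by
      rw [nhdsWithin_univ]
      filter_upwards [hA] with w hw κ using D.clean_stack (hw.1 κ κ.2))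
    (fun κ => ((D.continuous_weight κ).comp hconf).continuousWithinAt)
    (fun κ κ' _ => (D.continuousAt_restr_stack (hA₀.1 κ κ.2)
      (hA₀.1 κ' κ'.2)).continuousWithinAt)
  rw [continuousWithinAt_univ] at h1
  refine h1.congr ?_
  filter_upwards [hA] with w hw
  rw [unslice, D.weights_eq hw.2]

end LabelContraction

/-! ### Cutting a spread configuration -/

theorem isQuotientMap_prodMap_id {A B P : Type*} [TopologicalSpace A] [TopologicalSpace B]
    [TopologicalSpace P] [LocallyCompactSpace P] {f : A → B} (hf : IsQuotientMap f) :
    IsQuotientMap (Prod.map f (id : P → P)) := by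
  refine ⟨isCoinducing_iff.2 fun s => ⟨fun h => ?_,
    fun h => h.preimage (hf.continuous.prodMap continuous_id)⟩,
    hf.surjective.prodMap Function.surjective_id⟩
  have h1 : Continuous fun p : B × P => p ∈ s :=
    hf.continuous_lift_prod_left (continuous_Prop.2 h)
  exact continuous_Prop.1 h1

section Lift

variable {G M X : Type*} [Group G] [MulAction G M] [TopologicalSpace M] [TopologicalSpace X]
  [BasedSpace X] [MulAction G X] [BasedGSpace G X]

/-- A map on an open subset of `C × P` is continuous if it is so on ordered collections. -/
theorem DiscConf.continuousOn_of_tuples {P Z : Type*} [TopologicalSpace P] [LocallyCompactSpace P]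
    [TopologicalSpace Z] {g : DiscConf G M X × P → Z} {U : Set (DiscConf G M X × P)}
    (hU : IsOpen U)
    (hg : ∀ q, ∀ w : DiscTuple G M X q × P, (toDiscConf ⟨q, w.1⟩, w.2) ∈ U →
      ContinuousAt (fun w : DiscTuple G M X q × P => g (toDiscConf ⟨q, w.1⟩, w.2)) w) :
    ContinuousOn g U := by
  rw [continuousOn_iff_continuous_domRestrict]
  refine ((isQuotientMap_prodMap_id (P := P) isQuotientMap_toDiscConf).restrictPreimage_isOpen
    hU).continuous_iff.2 ?_
  refine continuous_iff_continuousAt.2 ?_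
  rintro ⟨⟨⟨q, f⟩, t⟩, hw⟩
  have h1 : ContinuousAt (fun w : (Σ q, DiscTuple G M X q) × P => g (toDiscConf w.1, w.2))
      (⟨q, f⟩, t) := by
    have h3 : ContinuousAt (fun w : Σ q, DiscTuple G M X q × P => g (toDiscConf ⟨w.1, w.2.1⟩, w.2.2))
        ⟨q, (f, t)⟩ :=
      (Topology.IsOpenEmbedding.sigmaMk (i := q)).continuousAt_iff.1 (hg q (f, t) hw)
    exact h3.comp (f := Homeomorph.sigmaProdDistrib (X := fun q => DiscTuple G M X q) (Y := P))
      (x := ((⟨q, f⟩ : Σ q, DiscTuple G M X q), t))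
      (Homeomorph.sigmaProdDistrib).continuous.continuousAt
  exact ContinuousAt.comp (f := Subtype.val)
    (g := fun w : (Σ q, DiscTuple G M X q) × P => g (toDiscConf w.1, w.2))
    (x := (⟨(⟨q, f⟩, t), hw⟩ : Prod.map toDiscConf id ⁻¹' U)) h1 continuousAt_subtype_val

end Lift

section Spread

variable {L a b k k' : ℝ}

theorem spreadHi_le_of_centre (hL : 0 ≤ L) (hk : 0 ≤ k) (h : spreadCentre L a b + 1 / 8 < k) :
    spreadHi L a b ≤ k :=
  max_le (by linarith [min_le_right b 0]) ((min_le_left _ _).trans h.le)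

theorem le_spreadLo_of_centre (hk : k ≤ L) (h : k < spreadCentre L a b - 1 / 8) :
    k ≤ spreadLo L a b :=
  le_max_of_le_right (le_min h.le (by linarith [le_max_right a 0]))

theorem spread_of_between (hk : 0 ≤ k) (hk' : k' ≤ L) (h : k < spreadCentre L a b - 1 / 8)
    (h' : spreadCentre L a b + 1 / 8 < k') :
    spreadLo L a b = spreadCentre L a b - 1 / 8 ∧ spreadHi L a b = spreadCentre L a b + 1 / 8 := by
  have h1 := min_le_right a 0
  have h2 := le_max_right a 0
  have h3 := min_le_right b 0
  have h4 := le_max_right b 0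
  constructor
  · rw [spreadLo, confine,
      min_eq_left (show spreadCentre L a b - 1 / 8 ≤ L + max a 0 by linarith),
      max_eq_right (by linarith)]
  · rw [spreadHi, confine,
      min_eq_left (show spreadCentre L a b + 1 / 8 ≤ L + max b 0 by linarith),
      max_eq_right (by linarith)]

end Spread

namespace LabelContraction

variable {G M X : Type*} [Group G] [Finite G] [TopologicalSpace M] [T2Space M] [MulAction G M]
  [ContinuousConstSMul G M] [TopologicalSpace X] [BasedSpace X] [MulAction G X] [BasedGSpace G X]
  (D : LabelContraction G X)

/-- The height `u` is away from the spread discs.  Discs with `ρ ≠ 0` are exempt, since the contraction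
takes their labels to the basepoint; among the others there may be discs whose new label is the
basepoint, so that the condition is stronger than that no disc of the spread configuration meets
`u`. -/
def Clear (c : DiscConf G M X) (τ u : ℝ) : Prop :=
  ∀ d ∈ c.carrier, D.ρ d.label = 0 →
    (D.move 1 τ (D.room (c.slice τ)) d).height + (D.move 1 τ (D.room (c.slice τ)) d).radius < u ∨
    u < (D.move 1 τ (D.room (c.slice τ)) d).height - (D.move 1 τ (D.room (c.slice τ)) d).radius

variable {D} in
theorem Clear.clean {c : DiscConf G M X} {τ u : ℝ} (h : D.Clear c τ u) :
    (D.spread 1 τ c).toLine.Clean u := by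
  rintro _ ⟨hd, e, he, rfl⟩
  exact h e he (D.label_ne_pt hd)

theorem clear_zero (c : DiscConf G M X) (τ : ℝ) : D.Clear c τ 0 := fun d hd _ =>
  Or.inr (InSlab.bounds (D.inSlab_move (s := 1) (D.room_nonneg (c.slice τ)) (c.inSlab d hd))).1

theorem clear_len (c : DiscConf G M X) (τ : ℝ) : D.Clear c τ (D.spread 1 τ c).len := fun d hd _ =>
  Or.inl (InSlab.bounds (D.inSlab_move (s := 1) (D.room_nonneg (c.slice τ)) (c.inSlab d hd))).2

theorem coord_suspLabel {τ : ℝ} {d : LabelledDisc M X} (h : suspLabel τ d ≠ BasedSpace.pt)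
    (hτ : |τ - d.height| ≤ d.radius) (hr : 0 < d.radius) :
    ((suspLabel τ d).coord.1 : ℝ) = -(d.height - d.radius - τ) / (2 * d.radius) ∧
      (suspLabel τ d).coord.2 = d.label := by
  rw [suspLabel, Susp.coord_mk h]
  refine ⟨?_, rfl⟩
  rw [abs_le] at hτ
  simp only
  rw [projIcc_of_mem]
  · simp only
    congr 1
    ring
  · constructor
    · exact div_nonneg (by linarith) (by linarith)
    · rw [div_le_one (by linarith)]
      linarith

/-- A usable height is away from the centres of the spreading, also for the discs that do not meet the
slicing height. -/
theorem Usable.lt_abs_spreadCentre {c : DiscConf G M X} {τ : ℝ} {κ : ℕ}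
    (h : D.Usable κ (c.slice τ)) {d : LabelledDisc M X} (hd : d ∈ c.carrier)
    (hρ : D.ρ d.label = 0) :
    1 / 8 < |spreadCentre (D.room (c.slice τ)) (d.height - d.radius - τ)
      (d.height + d.radius - τ) - κ| := by
  have hr := (c.inSlab d hd).1
  have hκ := h.le_room
  have hκ0 : (0 : ℝ) ≤ κ := κ.cast_nonneg
  rcases le_or_gt 0 (d.height - d.radius - τ) with ha | ha
  · rw [spreadCentre_of_nonneg (by linarith) ha, lt_abs]
    exact Or.inl (by linarith)
  rcases le_or_gt (d.height + d.radius - τ) 0 with hb | hb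
  · rw [spreadCentre_of_nonpos (by linarith) hb, lt_abs]
    exact Or.inr (by linarith)
  have hτ : |τ - d.height| < d.radius := abs_lt.2 ⟨by linarith, by linarith⟩
  have hne : suspLabel τ d ≠ BasedSpace.pt := by
    rw [Ne, suspLabel_eq_pt_iff hr, not_or]
    exact ⟨c.label_ne d hd, not_le.2 hτ⟩
  obtain ⟨h1, h2⟩ := coord_suspLabel hne hτ.le hr
  have h3 := h.lt_abs_sub D (p := (d.base, suspLabel τ d)) ⟨hne, d, hd, hτ.le, rfl⟩
    (by rw [h2]; exact hρ)
  rw [spreadCentre_of_mem ha.le hb.le]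
  simp only [h1] at h3
  convert h3 using 6
  ring

theorem Usable.clear {c : DiscConf G M X} {τ : ℝ} {κ : ℕ} (h : D.Usable κ (c.slice τ)) :
    D.Clear c τ (τ + D.room (c.slice τ) + κ) := by
  intro d hd hρ
  have hL := D.room_nonneg (c.slice τ)
  have h1 := spreadLo_lt_spreadHi hL (a := d.height - d.radius - τ) (b := d.height + d.radius - τ)
    (by linarith [(c.inSlab d hd).1])
  rw [move_upper, move_lower]
  simp only [Icc.coe_one, sub_self, zero_mul, zero_add, one_mul]
  rcases lt_abs.1 (h.lt_abs_spreadCentre D hd hρ) with h2 | h2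
  · have : κ ≤ spreadLo (D.room (c.slice τ)) (d.height - d.radius - τ)
        (d.height + d.radius - τ) := le_spreadLo_of_centre h.le_room (by linarith)
    exact Or.inr (by linarith)
  · have : spreadHi (D.room (c.slice τ)) (d.height - d.radius - τ)
        (d.height + d.radius - τ) ≤ κ := spreadHi_le_of_centre hL κ.cast_nonneg (by linarith)
    exact Or.inl (by linarith)

theorem continuousAt_restr_spread_of_tuple {q : ℕ} {w₀ : DiscTuple G M X q × ℝ}
    {u v : DiscConf G M X × ℝ → ℝ} (hu : Continuous u) (hv : Continuous v)
    (hu' : D.Clear (toDiscConf ⟨q, w₀.1⟩) w₀.2 (u (toDiscConf ⟨q, w₀.1⟩, w₀.2)))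
    (hv' : D.Clear (toDiscConf ⟨q, w₀.1⟩) w₀.2 (v (toDiscConf ⟨q, w₀.1⟩, w₀.2))) :
    ContinuousAt (fun w : DiscTuple G M X q × ℝ => (D.spread 1 w.2 (toDiscConf ⟨q, w.1⟩)).toLine.restr
      (u (toDiscConf ⟨q, w.1⟩, w.2)) (v (toDiscConf ⟨q, w.1⟩, w.2))) w₀ := by
  have hpair : Continuous fun w : DiscTuple G M X q × ℝ => (toDiscConf ⟨q, w.1⟩, w.2) :=
    (DiscTuple.continuous_toDiscConf.comp continuous_fst).prodMk continuous_snd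
  have hroom : Continuous fun w : DiscTuple G M X q × ℝ =>
      D.room ((toDiscConf ⟨q, w.1⟩).slice w.2) := by
    simpa only [Function.comp_def] using (D.continuous_room_slice (M := M)).comp hpair
  set f : DiscTuple G M X q × ℝ → Fin q → LabelledDisc M X := fun w i =>
    D.move 1 w.2 (D.room ((toDiscConf ⟨q, w.1⟩).slice w.2)) (w.1.1.2 i) with hf
  have hlab : ∀ i, Continuous fun w : DiscTuple G M X q × ℝ => D.ρ (w.1.1.2 i).label := fun i =>
    D.continuous_ρ.comp (continuous_snd.comp (continuous_snd.comp (continuous_snd.comp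
      ((DiscTuple.continuous_disc i).comp continuous_fst))))
  have hfc : ∀ i, ContinuousAt (fun w => f w i) w₀ := fun i =>
    D.continuousAt_move continuousAt_const continuous_snd.continuousAt hroom.continuousAt
      ((DiscTuple.continuous_disc i).comp continuous_fst).continuousAt (w₀.1.2.2.1 i).1
  have hhc : ∀ i, ContinuousAt (fun w => (f w i).height) w₀ := fun i =>
    continuousAt_fst.comp (continuousAt_snd.comp (hfc i))
  have hrc : ∀ i, ContinuousAt (fun w => (f w i).radius) w₀ := fun i =>
    continuousAt_fst.comp (continuousAt_snd.comp (continuousAt_snd.comp (hfc i)))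
  have huc := (hu.comp hpair).continuousAt (x := w₀)
  have hvc := (hv.comp hpair).continuousAt (x := w₀)
  -- Only discs whose label is away from the basepoint contribute.
  let ι := {i : Fin q // D.ρ (w₀.1.1.2 i).label = 0 ∧
    u (toDiscConf ⟨q, w₀.1⟩, w₀.2) < (f w₀ i).height - (f w₀ i).radius ∧
    (f w₀ i).height + (f w₀ i).radius < v (toDiscConf ⟨q, w₀.1⟩, w₀.2)}
  refine LineConf.continuousAt_restr (ι := ι) (fun w i => f w i) huc hvc (fun i => hfc i)
    (fun i => i.2.2) (Eventually.of_forall fun w i => ?_)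
    (Eventually.of_forall fun w i j hij => ?_) ?_ (Eventually.of_forall fun w i hi => ?_) ?_
  · exact D.move_radius_pos (D.room_nonneg _) (w.1.2.2.1 i).1
  · exact apart_move D (D.room_nonneg _) (w.1.2.2.1 i).1 (w.1.2.2.1 j).1
      (w.1.2.2.2.1 i j fun h => hij (Subtype.ext h))
  · filter_upwards [DiscTuple.eventually_act (continuous_fst) w₀] with w hw g i
    obtain ⟨j, hj⟩ := w.1.2.2.2.2 g i
    have h1 := hw g i j hj
    have h2 : f w₀ j = (f w₀ i).act g := by
      change D.move 1 _ _ (w₀.1.1.2 j) = _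
      rw [h1, D.move_act]
    refine ⟨⟨j, ?_, ?_⟩, ?_⟩
    · rw [h1]
      exact (D.ρ_smul g _).trans i.2.1
    · rw [h2]
      exact i.2.2
    · change f w j = _
      simp only [hf]
      rw [hj, D.move_act]
  · refine ⟨hi, w.1.1.2 i, ⟨⟨i, rfl⟩, fun h => hi ?_⟩, rfl⟩
    change D.hom ((w.1.1.2 i).label, 1) = _
    rw [h, D.hom_pt]
  · have h1 : ∀ᶠ w in 𝓝 w₀, ∀ i, D.ρ (w.1.1.2 i).label = 0 → D.ρ (w₀.1.1.2 i).label = 0 := by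
      refine eventually_all.2 fun i => ?_
      by_cases hi : D.ρ (w₀.1.1.2 i).label = 0
      · exact Eventually.of_forall fun w _ => hi
      · filter_upwards [(hlab i).continuousAt.eventually_ne hi] with w hw h using absurd h hw
    have hcl : ∀ {z : DiscConf G M X × ℝ → ℝ} (_ : D.Clear (toDiscConf ⟨q, w₀.1⟩) w₀.2
        (z (toDiscConf ⟨q, w₀.1⟩, w₀.2))) (i : Fin q), D.ρ (w₀.1.1.2 i).label = 0 →
        (f w₀ i).height + (f w₀ i).radius < z (toDiscConf ⟨q, w₀.1⟩, w₀.2) ∨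
          z (toDiscConf ⟨q, w₀.1⟩, w₀.2) < (f w₀ i).height - (f w₀ i).radius := by
      intro z hz i hi
      refine hz _ ⟨⟨i, rfl⟩, fun h => ?_⟩ hi
      change (w₀.1.1.2 i).label = _ at h
      rw [h, D.ρ_pt] at hi
      exact one_ne_zero hi
    have h2 : ∀ᶠ w in 𝓝 w₀, ∀ i, D.ρ (w₀.1.1.2 i).label = 0 →
        u (toDiscConf ⟨q, w.1⟩, w.2) < (f w i).height - (f w i).radius →
        u (toDiscConf ⟨q, w₀.1⟩, w₀.2) < (f w₀ i).height - (f w₀ i).radius := by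
      refine eventually_all.2 fun i => ?_
      by_cases hi : D.ρ (w₀.1.1.2 i).label = 0
      · rcases hcl hu' i hi with h | h
        · filter_upwards [((hhc i).add (hrc i)).eventually_lt huc h] with w hw _ h3
          have h4 : 0 < (f w i).radius := D.move_radius_pos (D.room_nonneg _) (w.1.2.2.1 i).1
          have hw : (f w i).height + (f w i).radius < u (toDiscConf ⟨q, w.1⟩, w.2) := hw
          linarith
        · exact Eventually.of_forall fun w _ _ => h
      · exact Eventually.of_forall fun w h => absurd h hi
    have h3 : ∀ᶠ w in 𝓝 w₀, ∀ i, D.ρ (w₀.1.1.2 i).label = 0 →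
        (f w i).height + (f w i).radius < v (toDiscConf ⟨q, w.1⟩, w.2) →
        (f w₀ i).height + (f w₀ i).radius < v (toDiscConf ⟨q, w₀.1⟩, w₀.2) := by
      refine eventually_all.2 fun i => ?_
      by_cases hi : D.ρ (w₀.1.1.2 i).label = 0
      · rcases hcl hv' i hi with h | h
        · exact Eventually.of_forall fun w _ _ => h
        · filter_upwards [hvc.eventually_lt ((hhc i).sub (hrc i)) h] with w hw _ h3
          have h4 : 0 < (f w i).radius := D.move_radius_pos (D.room_nonneg _) (w.1.2.2.1 i).1
          have hw : v (toDiscConf ⟨q, w.1⟩, w.2) < (f w i).height - (f w i).radius := hw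
          linarith
      · exact Eventually.of_forall fun w h => absurd h hi
    filter_upwards [h1, h2, h3] with w h1 h2 h3
    rintro _ ⟨hd, _, ⟨⟨i, rfl⟩, -⟩, rfl⟩ h4 h5
    have hi := h1 i (D.label_ne_pt hd)
    exact ⟨⟨i, hi, h2 i hi h4, h3 i hi h5⟩, rfl⟩

/-- The part of the spread configuration between two continuously moving clear heights is
continuous. -/
theorem continuousOn_restr_spread {U : Set (DiscConf G M X × ℝ)} (hU : IsOpen U)
    {u v : DiscConf G M X × ℝ → ℝ} (hu : Continuous u) (hv : Continuous v)
    (hu' : ∀ p ∈ U, D.Clear p.1 p.2 (u p)) (hv' : ∀ p ∈ U, D.Clear p.1 p.2 (v p)) :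
    ContinuousOn (fun p => (D.spread 1 p.2 p.1).toLine.restr (u p) (v p)) U :=
  DiscConf.continuousOn_of_tuples hU fun _ _ hw =>
    D.continuousAt_restr_spread_of_tuple hu hv (hu' _ hw) (hv' _ hw)

/-- Between usable heights, the spread configuration consists of the discs placed over the points of
the slice. -/
theorem restr_spread_eq_restr_stack {c : DiscConf G M X} {τ : ℝ} {κ κ' : ℕ}
    (h : D.Usable κ (c.slice τ)) (h' : D.Usable κ' (c.slice τ)) :
    (D.stack (c.slice τ)).restr κ κ' = (D.spread 1 τ c).toLine.restr
      (τ + D.room (c.slice τ) + κ) (τ + D.room (c.slice τ) + κ') := by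
  set L := D.room (c.slice τ) with hL
  have hL0 : 0 ≤ L := D.room_nonneg _
  have hκ0 : (0 : ℝ) ≤ κ := κ.cast_nonneg
  -- The discs in question agree up to translation.
  have key : ∀ e : LabelledDisc M X, (κ : ℝ) < e.height - e.radius →
      e.height + e.radius < κ' → (e ∈ (D.stack (c.slice τ)).carrier ↔
        shift (τ + L) e ∈ (D.spread 1 τ c).carrier) := by
    have hmove : ∀ d : LabelledDisc M X, D.move 1 τ L d = (d.base, τ + L +
        (spreadLo L (d.height - d.radius - τ) (d.height + d.radius - τ) +
        spreadHi L (d.height - d.radius - τ) (d.height + d.radius - τ)) / 2,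
        (spreadHi L (d.height - d.radius - τ) (d.height + d.radius - τ) -
        spreadLo L (d.height - d.radius - τ) (d.height + d.radius - τ)) / 6,
        D.hom (d.label, 1)) := by
      intro d
      simp only [move, Icc.coe_one, sub_self, zero_mul, zero_add, one_mul]
    -- A disc whose centre is between the two heights meets the slicing height and has the same
    -- position in both collections.
    have hbet : ∀ d ∈ c.carrier, (κ : ℝ) < spreadCentre L (d.height - d.radius - τ)
        (d.height + d.radius - τ) - 1 / 8 → spreadCentre L (d.height - d.radius - τ)
        (d.height + d.radius - τ) + 1 / 8 < κ' → suspLabel τ d ≠ BasedSpace.pt ∧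
        |τ - d.height| ≤ d.radius ∧
        D.move 1 τ L d = shift (τ + L) (D.place L (d.base, suspLabel τ d)) := by
      intro d hd h1 h2
      have hr := (c.inSlab d hd).1
      have h3 := h'.le_room
      have ha : d.height - d.radius - τ < 0 := by
        by_contra hcon
        rw [spreadCentre_of_nonneg (by linarith) (not_lt.1 hcon)] at h2
        linarith
      have hb : 0 < d.height + d.radius - τ := by
        by_contra hcon
        rw [spreadCentre_of_nonpos (by linarith) (not_lt.1 hcon)] at h1
        linarith
      have hτ : |τ - d.height| < d.radius := abs_lt.2 ⟨by linarith, by linarith⟩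
      have hne : suspLabel τ d ≠ BasedSpace.pt := by
        rw [Ne, suspLabel_eq_pt_iff hr, not_or]
        exact ⟨c.label_ne d hd, not_le.2 hτ⟩
      obtain ⟨h4, h5⟩ := coord_suspLabel hne hτ.le hr
      obtain ⟨h6, h7⟩ := spread_of_between hκ0 h3 h1 h2
      have h8 : spreadCentre L (d.height - d.radius - τ) (d.height + d.radius - τ) =
          (L + 1) * ramp (suspLabel τ d).coord.1 := by
        rw [spreadCentre_of_mem ha.le hb.le, h4]
        congr 3
        ring
      refine ⟨hne, hτ.le, ?_⟩
      rw [hmove, h6, h7, h8]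
      refine Prod.ext rfl (Prod.ext ?_ (Prod.ext ?_ ?_))
      · change _ = τ + L + (L + 1) * ramp (suspLabel τ d).coord.1
        ring
      · change _ = (1 / 24 : ℝ)
        ring
      · change _ = D.hom ((suspLabel τ d).coord.2, 1)
        rw [h5]
    intro e he he'
    constructor
    · rintro ⟨hlab, p, ⟨hp, d, hd, hτ, rfl⟩, rfl⟩
      have hr := (c.inSlab d hd).1
      obtain ⟨h4, h5⟩ := coord_suspLabel hp hτ hr
      have hρ := D.label_ne_pt hlab
      have hb := abs_le.1 hτ
      have h8 : spreadCentre L (d.height - d.radius - τ) (d.height + d.radius - τ) =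
          (L + 1) * ramp (suspLabel τ d).coord.1 := by
        rw [spreadCentre_of_mem (by linarith) (by linarith), h4]
        congr 3
        ring
      have h9 := h.lt_abs_spreadCentre D hd (by rw [← h5]; exact hρ)
      have h10 := h'.lt_abs_spreadCentre D hd (by rw [← h5]; exact hρ)
      rw [← hL, h8] at h9 h10
      change (κ : ℝ) < (L + 1) * ramp (suspLabel τ d).coord.1 - 1 / 24 at he
      change (L + 1) * ramp (suspLabel τ d).coord.1 + 1 / 24 < κ' at he'
      obtain ⟨-, -, h11⟩ := hbet d hd
        (by rw [h8]; rcases lt_abs.1 h9 with h | h <;> linarith)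
        (by rw [h8]; rcases lt_abs.1 h10 with h | h <;> linarith)
      exact ⟨hlab, d, hd, h11.symm⟩
    · rintro ⟨hlab, d, hd, hed⟩
      have hr := (c.inSlab d hd).1
      have hlab' : D.hom (d.label, 1) ≠ BasedSpace.pt := by
        rw [hed] at hlab
        exact hlab
      have hρ := D.label_ne_pt hlab'
      have h9 := h.lt_abs_spreadCentre D hd hρ
      have h10 := h'.lt_abs_spreadCentre D hd hρ
      have h1 := spreadLo_lt_spreadHi hL0 (a := d.height - d.radius - τ)
        (b := d.height + d.radius - τ) (by linarith)
      rw [← hL] at h9 h10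
      have h2 := hed.trans (hmove d)
      have hh : τ + L + e.height = _ := congrArg (fun d => d.2.1) h2
      have hrad : e.radius = _ := congrArg (fun d => d.2.2.1) h2
      simp only at hh hrad
      obtain ⟨h11, h12, h13⟩ := hbet d hd
        (by
          rcases lt_abs.1 h9 with h3 | h3
          · linarith
          · have := spreadHi_le_of_centre (a := d.height - d.radius - τ)
              (b := d.height + d.radius - τ) hL0 hκ0 (by linarith)
            linarith)
        (by
          rcases lt_abs.1 h10 with h3 | h3
          · have := le_spreadLo_of_centre (a := d.height - d.radius - τ)
              (b := d.height + d.radius - τ) h'.le_room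
              (show (κ' : ℝ) < spreadCentre L _ _ - 1 / 8 by linarith)
            change _ ≤ spreadLo L _ _ at this
            linarith
          · linarith)
      rw [← hL, h13] at hed
      refine ⟨hlab, _, ⟨h11, d, hd, h12, rfl⟩, shift_injective _ hed⟩
  refine DiscConf.ext ?_ (Set.ext fun d => ?_)
  · change max 0 ((κ' : ℝ) - κ) = max 0 _
    congr 1
    ring
  · rw [LineConf.mem_restr_iff, LineConf.mem_restr_iff]
    have h1 : τ + L + κ' - (τ + L + κ) = (κ' : ℝ) - κ := by ring
    rw [h1]
    refine and_congr_left fun hd => ?_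
    rw [← shift_shift (τ + L) (κ : ℝ)]
    exact key (shift κ d)
      (by simp only [shift, LabelledDisc.height, LabelledDisc.radius] at hd ⊢; linarith)
      (by simp only [shift, LabelledDisc.height, LabelledDisc.radius] at hd ⊢; linarith)

end LabelContraction

/-! ### Spreading points of the classifying space -/

section CutMeasure

variable {G M X : Type*} [Group G] [MulAction G M] [TopologicalSpace M] [TopologicalSpace X]
  [BasedSpace X] [MulAction G X] [BasedGSpace G X]

namespace DiscConf

theorem IsCutMeasure.mapDomain {c c' : DiscConf G M X} {μ : ℝ →₀ ℝ} (h : c.IsCutMeasure μ)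
    {f : ℝ → ℝ} (hf : ∀ x, 0 ≤ x → x ≤ c.len → 0 ≤ f x ∧ f x ≤ c'.len) :
    c'.IsCutMeasure (μ.mapDomain f) where
  nonneg := by
    classical
    intro x
    rw [Finsupp.mapDomain, Finsupp.sum, Finsupp.finsetSum_apply]
    refine Finset.sum_nonneg fun y _ => ?_
    rw [Finsupp.single_apply]
    split_ifs
    · exact h.nonneg y
    · exact le_rfl
  sum_eq_one := by
    rw [Finsupp.sum_mapDomain_index (fun _ => rfl) (fun _ _ _ => rfl), h.sum_eq_one]
  bounds := by
    classical
    intro x hx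
    obtain ⟨y, hy, rfl⟩ := Finset.mem_image.1 (Finsupp.mapDomain_support hx)
    exact hf y (h.bounds y hy).1 (h.bounds y hy).2

theorem IsCutMeasure.convex {c : DiscConf G M X} {μ ν : ℝ →₀ ℝ} (h : c.IsCutMeasure μ)
    (h' : c.IsCutMeasure ν) (s : I) :
    c.IsCutMeasure ((1 - (s : ℝ)) • μ + (s : ℝ) • ν) where
  nonneg x := add_nonneg (mul_nonneg (sub_nonneg.2 s.2.2) (h.nonneg x))
    (mul_nonneg s.2.1 (h'.nonneg x))
  sum_eq_one := by
    rw [Finsupp.sum_add_index' (fun _ => rfl) (fun _ _ _ => rfl),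
      Finsupp.sum_smul_index' (fun _ => rfl), Finsupp.sum_smul_index' (fun _ => rfl)]
    simp only [smul_eq_mul, Finsupp.sum, ← Finset.mul_sum]
    have h1 := h.sum_eq_one
    have h2 := h'.sum_eq_one
    simp only [Finsupp.sum] at h1 h2
    rw [h1, h2]
    ring
  bounds x hx := by
    by_cases hμ : μ x = 0
    · refine h'.bounds x (Finsupp.mem_support_iff.2 fun hν => Finsupp.mem_support_iff.1 hx ?_)
      simp [hμ, hν]
    · exact h.bounds x (Finsupp.mem_support_iff.2 hμ)

theorem cut_add_left (a : DiscConf G M X) {c : DiscConf G M X} {μ : ℝ →₀ ℝ}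
    (h : c.IsCutMeasure μ) :
    (a + c).toLine.cut (μ.mapDomain (a.len + ·)) = c.toLine.cut μ := by
  refine (LineConf.cut_congr h.nonneg h.sum_eq_one a.len fun x hx y hy hxy => ?_).symm
  refine LineConf.restr_congr (h.bounds x hx).1 hxy (h.bounds y hy).2 ?_
  rw [restr_toLine, add_zero, restr_add_right]

theorem cut_add_right (a : DiscConf G M X) {c : DiscConf G M X} {μ : ℝ →₀ ℝ}
    (h : c.IsCutMeasure μ) : (c + a).toLine.cut μ = c.toLine.cut μ := by
  have h1 := LineConf.cut_congr (S := c.toLine) (S' := (c + a).toLine) h.nonneg h.sum_eq_one 0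
    fun x hx y hy hxy => by
      refine LineConf.restr_congr (h.bounds x hx).1 hxy (h.bounds y hy).2 ?_
      rw [restr_toLine, zero_add, zero_add, restr_add_left]
  simp only [zero_add] at h1
  rw [h1]
  congr 1
  exact Finsupp.mapDomain_id.symm

variable {n : ℕ}

theorem mk_eq_cut_total (c : Fin n → DiscConf G M X) (p : stdSimplex ℝ (Fin (n + 1))) :
    ClassifyingSpace.mk c p = (total c).toLine.cut (cutMeasure c p) := by
  have h := LineConf.mk_eq_cut (total c).toLine (x := cutHeight c) (monotone_len_partialSum c)
    (clean_partialSum c) p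
  refine Eq.trans ?_ h
  congr 1
  funext l
  exact (restr_partialSum c l).symm

section

variable [Finite G] [T2Space M] [ContinuousConstSMul G M]

/-- A point of the classifying space represented by configurations of length zero is the
basepoint. -/
theorem mk_of_len_total_eq_zero (c : Fin n → DiscConf G M X) (p : stdSimplex ℝ (Fin (n + 1)))
    (h : (total c).len = 0) :
    ClassifyingSpace.mk c p = (0 : DiscConf G M X).toLine.cut (Finsupp.single 0 1) := by
  rw [mk_eq_cut_total, eq_zero h]
  congr 1
  have h1 : ∀ i, cutHeight c i = 0 := fun i =>
    le_antisymm (h ▸ cutHeight_le c i) (cutHeight_nonneg c i)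
  simp only [cutMeasure, h1, ← Finsupp.single_finsetSum]
  rw [stdSimplex.sum_eq_one]

end

end DiscConf
end CutMeasure

namespace LabelContraction

variable {G M X : Type*} [Group G] [Finite G] [TopologicalSpace M] [T2Space M] [MulAction G M]
  [ContinuousConstSMul G M] [TopologicalSpace X] [BasedSpace X] [MulAction G X] [BasedGSpace G X]
  (D : LabelContraction G X) {s : I}

theorem room_slice_of_outside {c : DiscConf G M X} {τ : ℝ} (h : τ ≤ 0 ∨ c.len ≤ τ) :
    D.room (c.slice τ) = 0 := by
  rw [DiscConf.slice_eq_empty h]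
  exact D.room_empty rfl

theorem len_spread (c : DiscConf G M X) (τ : ℝ) :
    (D.spread s τ c).len = c.len + 2 * s * D.room (c.slice τ) := rfl

/-- A rule that makes a new probability measure from a configuration and a probability measure on
it, so that cutting the spread configuration by the new measure is well defined on the classifying
space. -/
structure IsNatural (s : I) (N : DiscConf G M X → (ℝ →₀ ℝ) → (ℝ →₀ ℝ)) : Prop where
  isCutMeasure : ∀ c μ, c.IsCutMeasure μ → (D.spread s (level μ) c).IsCutMeasure (N c μ)
  add_left : ∀ a c μ, c.IsCutMeasure μ →
    N (a + c) (μ.mapDomain (a.len + ·)) = (N c μ).mapDomain (a.len + ·)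
  add_right : ∀ a c μ, c.IsCutMeasure μ → N (c + a) μ = N c μ

theorem level_nonneg {c : DiscConf G M X} {μ : ℝ →₀ ℝ} (h : c.IsCutMeasure μ) : 0 ≤ level μ :=
  le_level h.nonneg h.sum_eq_one fun x hx => (h.bounds x hx).1

theorem level_le_len {c : DiscConf G M X} {μ : ℝ →₀ ℝ} (h : c.IsCutMeasure μ) :
    level μ ≤ c.len :=
  level_le h.nonneg h.sum_eq_one fun x hx => (h.bounds x hx).2

/-- The self-map of the classifying space that spreads a configuration around the slicing height and
cuts the result by a new measure. -/
noncomputable def deform {N : DiscConf G M X → (ℝ →₀ ℝ) → (ℝ →₀ ℝ)} (hN : D.IsNatural s N) :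
    ClassifyingSpace (DiscConf G M X) → ClassifyingSpace (DiscConf G M X) :=
  Quot.lift (fun a => (D.spread s (level (DiscConf.cutMeasure a.2.1 a.2.2))
      (DiscConf.total a.2.1)).toLine.cut
      (N (DiscConf.total a.2.1) (DiscConf.cutMeasure a.2.1 a.2.2)))
    (DiscConf.eq_of_nerveRel (Ψ := fun c μ => (D.spread s (level μ) c).toLine.cut (N c μ))
      (fun a c μ h => by
        have h1 : level (μ.mapDomain (a.len + ·)) = a.len + level μ :=
          level_mapDomain h.nonneg h.sum_eq_one a.len
        have h2 : (D.spread s (a.len + level μ) a).len = a.len := by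
          rw [len_spread, D.room_slice_of_outside (Or.inr (by linarith [level_nonneg h]))]
          ring
        have h3 := DiscConf.cut_add_left (D.spread s (a.len + level μ) a) (hN.isCutMeasure c μ h)
        rw [h2] at h3
        rw [h1, hN.add_left a c μ h, D.spread_add, add_sub_cancel_left, h3])
      fun a c μ h => by
        rw [hN.add_right a c μ h, D.spread_add, DiscConf.cut_add_right _ (hN.isCutMeasure c μ h)])

/-- The position of the height `h` after room `2 * s * L` has been made at `τ`. -/
noncomputable def openHeight (s : I) (τ L h : ℝ) : ℝ :=
  open Classical in if τ < h then h + 2 * s * L else h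

/-- The measure on the spread configuration that is carried by the old cuts. -/
noncomputable def openMeasure (s : I) (c : DiscConf G M X) (μ : ℝ →₀ ℝ) : ℝ →₀ ℝ :=
  μ.mapDomain (openHeight s (level μ) (D.room (c.slice (level μ))))

/-- The measure on the spread configuration that only depends on the slice: the weights of the slice,
placed with `0` in the middle of the room. -/
noncomputable def sliceMeasure (c : DiscConf G M X) (μ : ℝ →₀ ℝ) : ℝ →₀ ℝ :=
  (D.weights (c.slice (level μ))).mapDomain (level μ + D.room (c.slice (level μ)) + ·)

theorem slice_add_left {a c : DiscConf G M X} {μ : ℝ →₀ ℝ} (h : c.IsCutMeasure μ) :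
    (a + c).slice (level (μ.mapDomain (a.len + ·))) = c.slice (level μ) := by
  rw [level_mapDomain h.nonneg h.sum_eq_one, DiscConf.slice_add_of_ge
    (by linarith [level_nonneg h]), add_sub_cancel_left]

theorem isNatural_openMeasure (s : I) :
    D.IsNatural s (D.openMeasure s : DiscConf G M X → (ℝ →₀ ℝ) → (ℝ →₀ ℝ)) where
  isCutMeasure c μ h := by
    have h0 : 0 ≤ 2 * (s : ℝ) * D.room (c.slice (level μ)) :=
      mul_nonneg (mul_nonneg zero_le_two s.2.1) (D.room_nonneg _)
    refine h.mapDomain fun x hx hx' => ?_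
    rw [len_spread, openHeight]
    split_ifs
    · exact ⟨by linarith, by linarith⟩
    · exact ⟨hx, by linarith⟩
  add_left a c μ h := by
    rw [openMeasure, openMeasure, slice_add_left h, level_mapDomain h.nonneg h.sum_eq_one,
      ← Finsupp.mapDomain_comp, ← Finsupp.mapDomain_comp]
    congr 1
    funext x
    simp only [Function.comp_apply, openHeight, add_lt_add_iff_left]
    split_ifs
    · ring
    · rfl
  add_right a c μ h := by
    rw [openMeasure, openMeasure, DiscConf.slice_add_of_le (level_le_len h)]

theorem sliceMeasure_eq (c : DiscConf G M X) (μ : ℝ →₀ ℝ) {A : Finset ℕ}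
    (hA : ∀ κ, D.weight κ (c.slice (level μ)) ≠ 0 → κ ∈ A) :
    D.sliceMeasure c μ = ∑ κ : A, Finsupp.single (level μ + D.room (c.slice (level μ)) + (κ : ℕ))
      (D.weight κ (c.slice (level μ))) := by
  rw [sliceMeasure, D.weights_eq hA, Finsupp.mapDomain_finsetSum]
  simp only [Finsupp.mapDomain_single]

theorem isNatural_sliceMeasure :
    D.IsNatural 1 (D.sliceMeasure : DiscConf G M X → (ℝ →₀ ℝ) → (ℝ →₀ ℝ)) where
  isCutMeasure c μ h := by
    obtain ⟨A, hA⟩ := D.eventually_usable (c.slice (level μ))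
    have hA := hA.self_of_nhds.2
    rw [D.sliceMeasure_eq c μ hA]
    refine DiscConf.isCutMeasure_sum (D.weight_mem_stdSimplex hA) fun κ hκ => ?_
    have h1 := D.le_room_of_weight_ne hκ
    have h2 := level_nonneg h
    have h3 := level_le_len h
    have h4 : (0 : ℝ) ≤ (κ : ℕ) := Nat.cast_nonneg _
    rw [len_spread, Icc.coe_one]
    exact ⟨by linarith, by linarith⟩
  add_left a c μ h := by
    rw [sliceMeasure, sliceMeasure, slice_add_left h, level_mapDomain h.nonneg h.sum_eq_one,
      ← Finsupp.mapDomain_comp]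
    congr 1
    funext x
    simp only [Function.comp_apply]
    ring
  add_right a c μ h := by
    rw [sliceMeasure, sliceMeasure, DiscConf.slice_add_of_le (level_le_len h)]

theorem IsNatural.convex {N N' : DiscConf G M X → (ℝ →₀ ℝ) → (ℝ →₀ ℝ)} (h : D.IsNatural s N)
    (h' : D.IsNatural s N') (t : I) :
    D.IsNatural s fun c μ => (1 - (t : ℝ)) • N c μ + (t : ℝ) • N' c μ where
  isCutMeasure c μ hμ := (h.isCutMeasure c μ hμ).convex (h'.isCutMeasure c μ hμ) t
  add_left a c μ hμ := by
    rw [h.add_left a c μ hμ, h'.add_left a c μ hμ, Finsupp.mapDomain_add, Finsupp.mapDomain_smul,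
      Finsupp.mapDomain_smul]
  add_right a c μ hμ := by rw [h.add_right a c μ hμ, h'.add_right a c μ hμ]

variable {n : ℕ}

/-- The entries of an element of the nerve, each spread around the height `τ` of the total
configuration. -/
noncomputable def spreadEntries (s : I) (τ : ℝ) (c : Fin n → DiscConf G M X) :
    Fin n → DiscConf G M X :=
  fun l => D.spread s (τ - DiscConf.cutHeight c l.castSucc) (c l)

theorem partialSum_spreadEntries (τ : ℝ) (c : Fin n → DiscConf G M X) (i : Fin (n + 1)) :
    Fin.partialSum (D.spreadEntries s τ c) i = D.spread s τ (Fin.partialSum c i) := by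
  induction i using Fin.induction with
  | zero =>
    rw [Fin.partialSum_zero, Fin.partialSum_zero]
    refine (DiscConf.eq_zero ?_).symm
    rw [len_spread, D.room_slice_of_outside, DiscConf.len_zero]
    · ring
    · exact le_total _ _
  | succ i ih =>
    rw [Fin.partialSum_succ, Fin.partialSum_succ, ih, D.spread_add]
    rfl

theorem total_spreadEntries (τ : ℝ) (c : Fin n → DiscConf G M X) :
    DiscConf.total (D.spreadEntries s τ c) = D.spread s τ (DiscConf.total c) :=
  D.partialSum_spreadEntries τ c _

theorem cutHeight_spreadEntries (τ : ℝ) (c : Fin n → DiscConf G M X) (i : Fin (n + 1)) :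
    DiscConf.cutHeight (D.spreadEntries s τ c) i =
      openHeight s τ (D.room ((DiscConf.total c).slice τ)) (DiscConf.cutHeight c i) := by
  rw [DiscConf.cutHeight, partialSum_spreadEntries, len_spread, openHeight]
  split_ifs with h
  · obtain ⟨r, hr⟩ := exists_partialSum_add c i
    rw [DiscConf.total, ← hr, DiscConf.slice_add_of_le h.le]
    rfl
  · rw [D.room_slice_of_outside (Or.inr (not_lt.1 h)), mul_zero, add_zero]
    rfl

theorem openMeasure_cutMeasure (c : Fin n → DiscConf G M X) (p : stdSimplex ℝ (Fin (n + 1))) :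
    D.openMeasure s (DiscConf.total c) (DiscConf.cutMeasure c p) =
      DiscConf.cutMeasure (D.spreadEntries s (level (DiscConf.cutMeasure c p)) c) p := by
  set τ := level (DiscConf.cutMeasure c p) with hτ
  rw [openMeasure, ← hτ, DiscConf.cutMeasure, DiscConf.cutMeasure, Finsupp.mapDomain_finsetSum]
  refine Finset.sum_congr rfl fun i _ => ?_
  rw [Finsupp.mapDomain_single, cutHeight_spreadEntries]

theorem deform_openMeasure_mk (c : Fin n → DiscConf G M X) (p : stdSimplex ℝ (Fin (n + 1))) :
    D.deform (D.isNatural_openMeasure s) (ClassifyingSpace.mk c p) =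
      ClassifyingSpace.mk (D.spreadEntries s (level (DiscConf.cutMeasure c p)) c) p := by
  rw [DiscConf.mk_eq_cut_total (D.spreadEntries s _ c) p, total_spreadEntries,
    ← openMeasure_cutMeasure]
  rfl

theorem deform_openMeasure_zero (b : ClassifyingSpace (DiscConf G M X)) :
    D.deform (D.isNatural_openMeasure 0) b = b := by
  induction b using Quot.inductionOn with
  | h a =>
    refine (D.deform_openMeasure_mk a.2.1 a.2.2).trans ?_
    rw [show D.spreadEntries 0 (level (DiscConf.cutMeasure a.2.1 a.2.2)) a.2.1 = a.2.1 from
      funext fun l => D.spread_zero _]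
    rfl

theorem continuous_spreadEntries :
    Continuous fun q : ((Fin n → DiscConf G M X) × stdSimplex ℝ (Fin (n + 1))) × I =>
      D.spreadEntries q.2 (level (DiscConf.cutMeasure q.1.1 q.1.2)) q.1.1 := by
  refine continuous_pi fun l => ?_
  have h1 : Continuous fun q : ((Fin n → DiscConf G M X) × stdSimplex ℝ (Fin (n + 1))) × I =>
      (q.1.1 l, (level (DiscConf.cutMeasure q.1.1 q.1.2) -
        DiscConf.cutHeight q.1.1 l.castSucc, q.2)) :=
    ((continuous_apply l).comp (continuous_fst.comp continuous_fst)).prodMk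
      (((DiscConf.continuous_level.comp continuous_fst).sub
        ((DiscConf.continuous_cutHeight l.castSucc).comp
          (continuous_fst.comp continuous_fst))).prodMk continuous_snd)
  have h2 := (D.continuous_spread (M := M)).comp h1
  simpa only [Function.comp_def, spreadEntries] using h2

theorem continuous_deform_openMeasure :
    Continuous fun q : ClassifyingSpace (DiscConf G M X) × I =>
      D.deform (D.isNatural_openMeasure q.2) q.1 := by
  refine ClassifyingSpace.continuous_of_mk fun n => ?_
  simp only [deform_openMeasure_mk]
  have h1 : Continuous fun q : ((Fin n → DiscConf G M X) × stdSimplex ℝ (Fin (n + 1))) × I =>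
      (D.spreadEntries q.2 (level (DiscConf.cutMeasure q.1.1 q.1.2)) q.1.1, q.1.2) :=
    D.continuous_spreadEntries.prodMk (continuous_snd.comp continuous_fst)
  simpa only [Function.comp_def] using ClassifyingSpace.continuous_mk.comp h1

/-- After the spreading, the measure that only depends on the slice recovers the image of the
slice. -/
theorem deform_sliceMeasure (b : ClassifyingSpace (DiscConf G M X)) :
    D.deform D.isNatural_sliceMeasure b = D.unslice (sliceMap b) := by
  induction b using Quot.inductionOn with
  | h a =>
    have hμ := DiscConf.isCutMeasure a.2.1 a.2.2
    set c := DiscConf.total a.2.1 with hc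
    set μ := DiscConf.cutMeasure a.2.1 a.2.2 with hμ'
    change (D.spread 1 (level μ) c).toLine.cut (D.sliceMeasure c μ) =
      (D.stack (c.slice (level μ))).cut (D.weights (c.slice (level μ)))
    obtain ⟨A, hA⟩ := D.eventually_usable (c.slice (level μ))
    have hA := hA.self_of_nhds
    have hw := D.weight_mem_stdSimplex hA.2
    refine (LineConf.cut_congr ?_ ?_ _ ?_).symm
    · rw [D.weights_eq hA.2]
      exact sum_single_nonneg hw
    · rw [D.weights_eq hA.2]
      exact sum_single_sum hw
    · rw [D.weights_eq hA.2]
      intro x hx y hy _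
      obtain ⟨κ, rfl, -⟩ := exists_of_mem_support_sum_single hx
      obtain ⟨κ', rfl, -⟩ := exists_of_mem_support_sum_single hy
      exact D.restr_spread_eq_restr_stack (hA.1 κ κ.2) (hA.1 κ' κ'.2)

end LabelContraction

/-! ### Inserting cuts in one entry -/

section LexSum

variable {A B : Type*} [LinearOrder A] [LinearOrder B]

theorem monotone_lex_elim {f : A → ℝ} {g : B → ℝ} (hf : Monotone f) (hg : Monotone g)
    (h : ∀ a b, f a ≤ g b) : Monotone fun z : A ⊕ₗ B => Sum.elim f g (ofLex z) := by
  intro a b hab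
  rcases a with a | a <;> rcases b with b | b
  · exact hf (Sum.Lex.inl_le_inl_iff.1 hab)
  · exact h a b
  · exact (Sum.Lex.not_inr_le_inl hab).elim
  · exact hg (Sum.Lex.inr_le_inr_iff.1 hab)

/-- A covering relation in a lexicographic sum is one in a summand, or it joins the top element of
the first summand to the bottom element of the second. -/
theorem covBy_lex_cases {P : A ⊕ₗ B → A ⊕ₗ B → Prop}
    (hl : ∀ a a', a ⋖ a' → P (Sum.inlₗ a) (Sum.inlₗ a'))
    (hm : ∀ a b, IsTop a → IsBot b → P (Sum.inlₗ a) (Sum.inrₗ b))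
    (hr : ∀ b b', b ⋖ b' → P (Sum.inrₗ b) (Sum.inrₗ b')) {z z' : A ⊕ₗ B} (h : z ⋖ z') : P z z' := by
  rcases z with a | a <;> rcases z' with b | b
  · refine hl a b ⟨Sum.Lex.inl_lt_inl_iff.1 h.1, fun c hc hc' => ?_⟩
    exact h.2 (c := Sum.inlₗ c) (Sum.Lex.inl_lt_inl_iff.2 hc) (Sum.Lex.inl_lt_inl_iff.2 hc')
  · refine hm a b (fun c => not_lt.1 fun hc => ?_) fun c => not_lt.1 fun hc => ?_
    · exact h.2 (c := Sum.inlₗ c) (Sum.Lex.inl_lt_inl_iff.2 hc) (Sum.Lex.inl_lt_inr _ _)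
    · exact h.2 (c := Sum.inrₗ c) (Sum.Lex.inl_lt_inr _ _) (Sum.Lex.inr_lt_inr_iff.2 hc)
  · exact (Sum.Lex.not_inr_lt_inl h.1).elim
  · refine hr a b ⟨Sum.Lex.inr_lt_inr_iff.1 h.1, fun c hc hc' => ?_⟩
    exact h.2 (c := Sum.inrₗ c) (Sum.Lex.inr_lt_inr_iff.2 hc) (Sum.Lex.inr_lt_inr_iff.2 hc')

theorem sum_lex {E : Type*} [AddCommMonoid E] [Fintype A] [Fintype B] (f : A ⊕ₗ B → E) :
    ∑ z, f z = ∑ a, f (Sum.inlₗ a) + ∑ b, f (Sum.inrₗ b) :=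
  Fintype.sum_sum_type fun z : A ⊕ B => f (toLex z)

theorem exists_of_covBy_lower {n : ℕ} {k : Fin (n + 1)} {i j : {i : Fin (n + 1) // i ≤ k}}
    (h : i ⋖ j) : ∃ l : Fin n, (i : Fin (n + 1)) = l.castSucc ∧ (j : Fin (n + 1)) = l.succ := by
  have hij : (i : Fin (n + 1)) < j := h.1
  obtain ⟨l, hl⟩ := Fin.exists_castSucc_eq.2 (hij.trans_le (Fin.le_last _)).ne
  have h1 : l.succ ≤ (j : Fin (n + 1)) := Fin.castSucc_lt_iff_succ_le.1 (hl ▸ hij)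
  refine ⟨l, hl.symm, le_antisymm (not_lt.1 fun h2 => ?_) h1⟩
  refine h.2 (c := ⟨l.succ, h1.trans j.2⟩) ?_ h2
  exact Subtype.mk_lt_mk.2 (hl ▸ Fin.castSucc_lt_succ)

theorem exists_of_covBy_upper {n : ℕ} {k : Fin (n + 1)} {i j : {i : Fin (n + 1) // ¬ i ≤ k}}
    (h : i ⋖ j) : ∃ l : Fin n, (i : Fin (n + 1)) = l.castSucc ∧ (j : Fin (n + 1)) = l.succ := by
  have hij : (i : Fin (n + 1)) < j := h.1
  obtain ⟨l, hl⟩ := Fin.exists_castSucc_eq.2 (hij.trans_le (Fin.le_last _)).ne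
  have h1 : l.succ ≤ (j : Fin (n + 1)) := Fin.castSucc_lt_iff_succ_le.1 (hl ▸ hij)
  have h3 : (i : Fin (n + 1)) < l.succ := hl ▸ Fin.castSucc_lt_succ
  refine ⟨l, hl.symm, le_antisymm (not_lt.1 fun h2 => ?_) h1⟩
  exact h.2 (c := ⟨l.succ, fun h4 => i.2 (h3.le.trans h4)⟩) h3 h2

theorem isTop_lower {n : ℕ} {k : Fin (n + 1)} {i : {i : Fin (n + 1) // i ≤ k}} (h : IsTop i) :
    (i : Fin (n + 1)) = k := le_antisymm i.2 (h ⟨k, le_rfl⟩)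

theorem isBot_upper {n : ℕ} {k : Fin n} {i : {i : Fin (n + 1) // ¬ i ≤ k.castSucc}} (h : IsBot i) :
    (i : Fin (n + 1)) = k.succ :=
  le_antisymm (h ⟨k.succ, not_le.2 Fin.castSucc_lt_succ⟩)
    (Fin.castSucc_lt_iff_succ_le.1 (not_le.1 i.2))

end LexSum

namespace DiscConf

variable {G M X : Type*} [Group G] [Finite G] [TopologicalSpace M] [T2Space M] [MulAction G M]
  [ContinuousConstSMul G M] [TopologicalSpace X] [BasedSpace X] [MulAction G X] [BasedGSpace G X]
  {n : ℕ}

theorem restr_total_entry (c : Fin n → DiscConf G M X) (k : Fin n) :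
    (total c).toLine.restr (cutHeight c k.castSucc) (cutHeight c k.succ) = c k :=
  restr_partialSum c k

theorem restr_total (c : Fin n → DiscConf G M X) (k : Fin n) {u v : ℝ} (hu : 0 ≤ u) (huv : u ≤ v)
    (hv : v ≤ (c k).len) :
    (total c).toLine.restr (cutHeight c k.castSucc + u) (cutHeight c k.castSucc + v) =
      (c k).toLine.restr u v := by
  refine (LineConf.restr_congr hu huv hv ?_).symm
  rw [restr_toLine, add_zero, ← cutHeight_succ, restr_total_entry]

theorem clean_total (c : Fin n → DiscConf G M X) (k : Fin n) {u : ℝ} (hu : 0 ≤ u)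
    (hu' : u ≤ (c k).len) (h : (c k).toLine.Clean u) :
    (total c).toLine.Clean (cutHeight c k.castSucc + u) := by
  intro d hd
  have h1 := cutHeight_succ c k
  rcases clean_partialSum c k.castSucc d hd with h2 | h2
  · exact Or.inl (h2.trans_le (le_add_of_nonneg_right hu))
  rcases clean_partialSum c k.succ d hd with h3 | h3
  swap
  · refine Or.inr (lt_of_le_of_lt ?_ h3)
    change _ ≤ cutHeight c k.succ
    linarith
  have h2 : cutHeight c k.castSucc < d.height - d.radius := h2
  have h3 : d.height + d.radius < cutHeight c k.succ := h3
  have hmem : shift (-cutHeight c k.castSucc) d ∈ (c k).carrier := by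
    rw [← restr_total_entry c k, LineConf.mem_restr (by linarith [(c k).len_nonneg])]
    have h4 := (total c).toLine.radius_pos d hd
    simp only [shift_shift, add_neg_cancel, shift_zero]
    refine ⟨hd, ?_, ?_⟩ <;> simp only [shift] <;> linarith
  rcases h _ hmem with h4 | h4
  · left
    simp only [shift] at h4
    linarith
  · right
    simp only [shift] at h4
    linarith

/-- Cutting the total configuration of an element of the nerve at additional heights in one entry
is continuous as soon as the pieces of this entry are. -/
theorem continuousWithinAt_cut_insert {W ι : Type*} [TopologicalSpace W] [Fintype ι] [LinearOrder ι]
    {A : Set W} {w₀ : W} (hw₀ : w₀ ∈ A) {e : W → Fin n → DiscConf G M X} (k : Fin n)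
    {p : W → Fin (n + 1) → ℝ} {y r : W → ι → ℝ}
    (hp : ∀ᶠ w in 𝓝[A] w₀, (∀ i, 0 ≤ p w i) ∧ (∀ i, 0 ≤ r w i) ∧ ∑ i, p w i + ∑ i, r w i = 1)
    (hy : ∀ᶠ w in 𝓝[A] w₀, Monotone (y w) ∧
      ∀ i, 0 ≤ y w i ∧ y w i ≤ (e w k).len ∧ (e w k).toLine.Clean (y w i))
    (hpc : ∀ i, ContinuousWithinAt (fun w => p w i) A w₀)
    (hrc : ∀ i, ContinuousWithinAt (fun w => r w i) A w₀)
    (hec : ∀ l, ContinuousWithinAt (fun w => e w l) A w₀)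
    (hl : ∀ i, ContinuousWithinAt (fun w => (e w k).toLine.restr 0 (y w i)) A w₀)
    (hm : ∀ i j, ContinuousWithinAt (fun w => (e w k).toLine.restr (y w i) (y w j)) A w₀)
    (hu : ∀ i, ContinuousWithinAt (fun w => (e w k).toLine.restr (y w i) (e w k).len) A w₀) :
    ContinuousWithinAt (fun w => (total (e w)).toLine.cut
      (∑ i, Finsupp.single (cutHeight (e w) i) (p w i) +
        ∑ i, Finsupp.single (cutHeight (e w) k.castSucc + y w i) (r w i))) A w₀ := by
  let x : W → {i : Fin (n + 1) // i ≤ k.castSucc} ⊕ₗ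
      (ι ⊕ₗ {i : Fin (n + 1) // ¬ i ≤ k.castSucc}) → ℝ := fun w z =>
    Sum.elim (fun i : {i : Fin (n + 1) // i ≤ k.castSucc} => cutHeight (e w) i)
      (fun z : ι ⊕ₗ {i : Fin (n + 1) // ¬ i ≤ k.castSucc} => Sum.elim
        (fun i => cutHeight (e w) k.castSucc + y w i)
        (fun i : {i : Fin (n + 1) // ¬ i ≤ k.castSucc} => cutHeight (e w) i) (ofLex z)) (ofLex z)
  let a : W → {i : Fin (n + 1) // i ≤ k.castSucc} ⊕ₗ
      (ι ⊕ₗ {i : Fin (n + 1) // ¬ i ≤ k.castSucc}) → ℝ := fun w z =>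
    Sum.elim (fun i : {i : Fin (n + 1) // i ≤ k.castSucc} => p w i)
      (fun z : ι ⊕ₗ {i : Fin (n + 1) // ¬ i ≤ k.castSucc} =>
        Sum.elim (r w) (fun i : {i : Fin (n + 1) // ¬ i ≤ k.castSucc} => p w i) (ofLex z)) (ofLex z)
  have hsum : ∀ {E : Type} [AddCommMonoid E] (f : ℝ → ℝ → E) (w : W),
      ∑ z, f (x w z) (a w z) = ∑ i, f (cutHeight (e w) i) (p w i) +
        ∑ i, f (cutHeight (e w) k.castSucc + y w i) (r w i) := by
    intro E _ f w
    rw [sum_lex, sum_lex, ← Fintype.sum_subtype_add_sum_subtype (fun i => i ≤ k.castSucc)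
      (fun i => f (cutHeight (e w) i) (p w i)), add_right_comm, add_assoc]
    rfl
  have hmono : ∀ w, Monotone (cutHeight (e w)) := fun w => monotone_cutHeight (e w)
  have key : ContinuousWithinAt (fun w => (total (e w)).toLine.cut
      (∑ z, Finsupp.single (x w z) (a w z))) A w₀ := by
    refine LineConf.continuousWithinAt_cut hw₀ ?_ ?_ ?_ ?_ ?_
    · filter_upwards [hp] with w hw
      refine ⟨?_, (hsum (fun _ b => b) w).trans hw.2.2⟩
      rintro (i | i | i)
      · exact hw.1 i
      · exact hw.2.1 i
      · exact hw.1 i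
    · filter_upwards [hy] with w hw
      have h1 := cutHeight_succ (e w) k
      refine monotone_lex_elim (fun i j hij => hmono w hij) (monotone_lex_elim
        (fun i j hij => add_le_add_right (hw.1 hij) _) (fun i j hij => hmono w hij) ?_) ?_
      · intro i j
        have h2 := hmono w (Fin.castSucc_lt_iff_succ_le.1 (not_le.1 j.2))
        linarith [(hw.2 i).2.1]
      · rintro i (j | j)
        · have h2 := hmono w i.2
          change cutHeight (e w) i ≤ cutHeight (e w) k.castSucc + y w j
          linarith [(hw.2 j).1]
        · exact hmono w (i.2.trans (not_le.1 j.2).le)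
    · filter_upwards [hy] with w hw
      rintro (i | i | i)
      · exact clean_partialSum (e w) i
      · exact clean_total (e w) k (hw.2 i).1 (hw.2 i).2.1 (hw.2 i).2.2
      · exact clean_partialSum (e w) i
    · rintro (i | i | i)
      · exact hpc i
      · exact hrc i
      · exact hpc i
    · have hent : ∀ {f g : W → ℝ} (l : Fin n), (∀ w, f w = cutHeight (e w) l.castSucc) →
          (∀ w, g w = cutHeight (e w) l.succ) →
          ContinuousWithinAt (fun w => (total (e w)).toLine.restr (f w) (g w)) A w₀ := by
        intro f g l hf hg
        simp only [hf, hg, restr_total_entry]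
        exact hec l
      intro z z' h
      refine covBy_lex_cases (P := fun z z' => ContinuousWithinAt (fun w =>
        (total (e w)).toLine.restr (x w z) (x w z')) A w₀) ?_ ?_ ?_ h
      · intro i j hij
        obtain ⟨l, h1, h2⟩ := exists_of_covBy_lower hij
        exact hent l (fun w => congrArg (cutHeight (e w)) h1) fun w => congrArg (cutHeight (e w)) h2
      · rintro i (j | j) hi hj
        · refine (hl j).congr_of_eventuallyEq_of_mem ?_ hw₀
          filter_upwards [hy] with w hw
          rw [← restr_total (e w) k le_rfl (hw.2 j).1 (hw.2 j).2.1, add_zero]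
          exact congrArg (fun z => (total (e w)).toLine.restr (cutHeight (e w) z)
            (cutHeight (e w) k.castSucc + y w j)) (isTop_lower hi)
        · refine hent k (fun w => congrArg (cutHeight (e w)) (isTop_lower hi)) fun w =>
            congrArg (cutHeight (e w)) (isBot_upper fun b => ?_)
          exact Sum.Lex.inr_le_inr_iff.1 (hj (Sum.inrₗ b))
      · intro z z' h
        refine covBy_lex_cases (P := fun z z' => ContinuousWithinAt (fun w =>
          (total (e w)).toLine.restr (x w (Sum.inrₗ z)) (x w (Sum.inrₗ z'))) A w₀) ?_ ?_ ?_ h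
        · intro i j hij
          refine (hm i j).congr_of_eventuallyEq_of_mem ?_ hw₀
          filter_upwards [hy] with w hw
          exact restr_total (e w) k (hw.2 i).1 (hw.1 hij.le) (hw.2 j).2.1
        · intro i j _ hj
          refine (hu i).congr_of_eventuallyEq_of_mem ?_ hw₀
          filter_upwards [hy] with w hw
          rw [← restr_total (e w) k (hw.2 i).1 (hw.2 i).2.1 le_rfl, ← cutHeight_succ,
            ← isBot_upper hj]
          rfl
        · intro i j hij
          obtain ⟨l, h1, h2⟩ := exists_of_covBy_upper hij
          exact hent l (fun w => congrArg (cutHeight (e w)) h1)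
            fun w => congrArg (cutHeight (e w)) h2
  exact key.congr (fun w _ => congrArg _ (hsum Finsupp.single w).symm)
    (congrArg _ (hsum Finsupp.single w₀).symm)

end DiscConf

namespace LabelContraction

variable {G M X : Type*} [Group G] [Finite G] [TopologicalSpace M] [T2Space M] [MulAction G M]
  [ContinuousConstSMul G M] [TopologicalSpace X] [BasedSpace X] [MulAction G X] [BasedGSpace G X]
  (D : LabelContraction G X)

/-! ### Moving all cuts into the room -/

/-- The linear homotopy from the measure of the old cuts to the measure that only depends on the
slice. -/
theorem isNatural_mixed (t : I) : D.IsNatural 1 fun (c : DiscConf G M X) μ =>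
    (1 - (t : ℝ)) • D.openMeasure 1 c μ + (t : ℝ) • D.sliceMeasure c μ :=
  IsNatural.convex D (D.isNatural_openMeasure 1) D.isNatural_sliceMeasure t

variable {n : ℕ}

/-- The image of a point whose slicing height lies in the `k`-th slab is cut at the old heights and
at additional heights in the `k`-th entry. -/
theorem deform_mixed_mk {c : Fin n → DiscConf G M X} {p : stdSimplex ℝ (Fin (n + 1))} (t : I)
    {k : Fin n} (h : (c, p) ∈ levelSlab G M X k) {A : Finset ℕ}
    (hA : ∀ κ, D.weight κ ((c k).slice
      (level (DiscConf.cutMeasure c p) - DiscConf.cutHeight c k.castSucc)) ≠ 0 → κ ∈ A) :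
    D.deform (D.isNatural_mixed t) (ClassifyingSpace.mk c p) =
      (DiscConf.total (D.spreadEntries 1 (level (DiscConf.cutMeasure c p)) c)).toLine.cut
        (∑ i, Finsupp.single
            (DiscConf.cutHeight (D.spreadEntries 1 (level (DiscConf.cutMeasure c p)) c) i)
            ((1 - (t : ℝ)) * p i) +
          ∑ κ : A, Finsupp.single
            (DiscConf.cutHeight (D.spreadEntries 1 (level (DiscConf.cutMeasure c p)) c) k.castSucc +
              (level (DiscConf.cutMeasure c p) - DiscConf.cutHeight c k.castSucc +
                D.room ((c k).slice
                  (level (DiscConf.cutMeasure c p) - DiscConf.cutHeight c k.castSucc)) + (κ : ℕ)))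
            ((t : ℝ) * D.weight κ ((c k).slice
              (level (DiscConf.cutMeasure c p) - DiscConf.cutHeight c k.castSucc)))) := by
  have hs := DiscConf.slice_total c k h.1 h.2
  have hh : DiscConf.cutHeight (D.spreadEntries 1 (level (DiscConf.cutMeasure c p)) c) k.castSucc =
      DiscConf.cutHeight c k.castSucc := by
    rw [cutHeight_spreadEntries, openHeight, if_neg (not_lt.2 h.1)]
  change (D.spread 1 (level (DiscConf.cutMeasure c p)) (DiscConf.total c)).toLine.cut
    ((1 - (t : ℝ)) • D.openMeasure 1 (DiscConf.total c) (DiscConf.cutMeasure c p) +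
      (t : ℝ) • D.sliceMeasure (DiscConf.total c) (DiscConf.cutMeasure c p)) = _
  rw [total_spreadEntries, openMeasure_cutMeasure, D.sliceMeasure_eq _ _ (hs ▸ hA), hs, hh]
  congr 2
  · simp only [DiscConf.cutMeasure, Finset.smul_sum, Finsupp.smul_single, smul_eq_mul]
  · simp only [Finset.smul_sum, Finsupp.smul_single, smul_eq_mul]
    refine Finset.sum_congr rfl fun κ _ => congrArg (Finsupp.single · _) ?_
    ring

theorem continuousWithinAt_deform_mixed (k : Fin n)
    {w₀ : ((Fin n → DiscConf G M X) × stdSimplex ℝ (Fin (n + 1))) × I}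
    (hw₀ : w₀ ∈ {w | w.1 ∈ levelSlab G M X k}) :
    ContinuousWithinAt
      (fun w : ((Fin n → DiscConf G M X) × stdSimplex ℝ (Fin (n + 1))) × I =>
        D.deform (D.isNatural_mixed w.2) (ClassifyingSpace.mk w.1.1 w.1.2))
      {w | w.1 ∈ levelSlab G M X k} w₀ := by
  let W := ((Fin n → DiscConf G M X) × stdSimplex ℝ (Fin (n + 1))) × I
  let φ : W → DiscConf G M X × ℝ := fun w =>
    (w.1.1 k, level (DiscConf.cutMeasure w.1.1 w.1.2) - DiscConf.cutHeight w.1.1 k.castSucc)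
  have hφ : Continuous φ :=
    ((continuous_apply k).comp (continuous_fst.comp continuous_fst)).prodMk
      ((DiscConf.continuous_level.comp continuous_fst).sub
        ((DiscConf.continuous_cutHeight k.castSucc).comp (continuous_fst.comp continuous_fst)))
  have hζ : Continuous fun q : DiscConf G M X × ℝ => q.1.slice q.2 := continuous_slice
  obtain ⟨A, hA⟩ := D.eventually_usable ((φ w₀).1.slice (φ w₀).2)
  have hA' : ∀ᶠ w in 𝓝[{w : W | w.1 ∈ levelSlab G M X k}] w₀,
      (∀ κ ∈ A, D.Usable κ ((φ w).1.slice (φ w).2)) ∧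
        ∀ κ, D.weight κ ((φ w).1.slice (φ w).2) ≠ 0 → κ ∈ A :=
    (((hζ.comp hφ).tendsto w₀).mono_left nhdsWithin_le_nhds).eventually hA
  have hW : ∀ᶠ w in 𝓝[{w : W | w.1 ∈ levelSlab G M X k}] w₀, w.1 ∈ levelSlab G M X k :=
    self_mem_nhdsWithin
  let U : Set (DiscConf G M X × ℝ) := ⋂ κ : A, {q | D.Usable κ (q.1.slice q.2)}
  have hU : IsOpen U := isOpen_iInter_of_finite fun κ => (D.isOpen_usable κ).preimage hζ
  have hUw : φ w₀ ∈ U := mem_iInter.2 fun κ => hA.self_of_nhds.1 κ κ.2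
  let y : DiscConf G M X × ℝ → A → ℝ := fun q κ => q.2 + D.room (q.1.slice q.2) + (κ : ℕ)
  have hyc : ∀ κ, Continuous fun q => y q κ := fun κ =>
    (continuous_snd.add (D.continuous_room.comp hζ)).add continuous_const
  have hycl : ∀ κ, ∀ q ∈ U, D.Clear q.1 q.2 (y q κ) := fun κ q hq =>
    Usable.clear D (mem_iInter.1 hq κ)
  have hlen : Continuous fun q : DiscConf G M X × ℝ => (D.spread 1 q.2 q.1).len := by
    simp only [len_spread]
    exact (DiscConf.continuous_len.comp continuous_fst).add
      (continuous_const.mul (D.continuous_room.comp hζ))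
  have hpiece : ∀ {u v : DiscConf G M X × ℝ → ℝ}, Continuous u → Continuous v →
      (∀ q ∈ U, D.Clear q.1 q.2 (u q)) → (∀ q ∈ U, D.Clear q.1 q.2 (v q)) →
      ContinuousWithinAt (fun w : W => (D.spread 1 (φ w).2 (φ w).1).toLine.restr
        (u (φ w)) (v (φ w))) {w | w.1 ∈ levelSlab G M X k} w₀ := by
    intro u v hu hv hu' hv'
    have h1 := (D.continuousOn_restr_spread hU hu hv hu' hv').continuousAt (hU.mem_nhds hUw)
    exact (ContinuousAt.comp (f := φ) (x := w₀) h1 hφ.continuousAt).continuousWithinAt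
  have hwc : ∀ κ, Continuous fun w : W => D.weight κ ((φ w).1.slice (φ w).2) := fun κ =>
    (D.continuous_weight κ).comp (hζ.comp hφ)
  have ht : Continuous fun w : W => (w.2 : ℝ) := continuous_subtype_val.comp continuous_snd
  have hpc : ∀ i, Continuous fun w : W => (w.1.2 i : ℝ) := fun i =>
    (continuous_apply i).comp
      (continuous_subtype_val.comp (continuous_snd.comp continuous_fst))
  have key := DiscConf.continuousWithinAt_cut_insert hw₀ k
    (e := fun w : W => D.spreadEntries 1 (level (DiscConf.cutMeasure w.1.1 w.1.2)) w.1.1)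
    (p := fun w i => (1 - (w.2 : ℝ)) * w.1.2 i) (y := fun w κ => y (φ w) κ)
    (r := fun w (κ : A) => (w.2 : ℝ) * D.weight κ ((φ w).1.slice (φ w).2)) ?_ ?_ ?_ ?_ ?_ ?_ ?_ ?_
  · refine key.congr_of_eventuallyEq_of_mem ?_ hw₀
    filter_upwards [hA', hW] with w hw hw'
    exact D.deform_mixed_mk w.2 hw' hw.2
  · filter_upwards [hA'] with w hw
    have h1 := D.weight_mem_stdSimplex hw.2
    refine ⟨fun i => mul_nonneg (sub_nonneg.2 w.2.2.2) (w.1.2.2.1 i),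
      fun κ => mul_nonneg w.2.2.1 (h1.1 κ), ?_⟩
    rw [← Finset.mul_sum, ← Finset.mul_sum, h1.2, stdSimplex.sum_eq_one]
    ring
  · filter_upwards [hA', hW] with w hw hw'
    refine ⟨fun κ κ' h => add_le_add_right (Nat.cast_le.2 h) _, fun κ => ?_⟩
    have h1 : 0 ≤ (φ w).2 := sub_nonneg.2 hw'.1
    have h2 : (φ w).2 ≤ (φ w).1.len := by
      have := hw'.2
      rw [DiscConf.cutHeight_succ] at this
      exact sub_le_iff_le_add'.2 this
    have h3 := (hw.1 κ κ.2).le_room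
    have h4 := D.room_nonneg ((φ w).1.slice (φ w).2)
    have h5 : (0 : ℝ) ≤ (κ : ℕ) := Nat.cast_nonneg _
    refine ⟨by positivity, ?_, (Usable.clear D (hw.1 κ κ.2)).clean⟩
    change (φ w).2 + D.room ((φ w).1.slice (φ w).2) + (κ : ℕ) ≤
      (φ w).1.len + 2 * (1 : I) * D.room ((φ w).1.slice (φ w).2)
    rw [Icc.coe_one]
    linarith
  · exact fun i => ((continuous_const.sub ht).mul (hpc i)).continuousWithinAt
  · exact fun κ => (ht.mul (hwc κ)).continuousWithinAt
  · intro l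
    have h1 := (continuous_apply l).comp (D.continuous_spreadEntries (G := G) (M := M) (n := n))
    exact (h1.comp (f := fun w : W => (w.1, (1 : I)))
      (continuous_fst.prodMk continuous_const)).continuousWithinAt
  · exact fun κ => hpiece continuous_const (hyc κ) (fun q _ => D.clear_zero q.1 q.2) (hycl κ)
  · exact fun κ κ' => hpiece (hyc κ) (hyc κ') (hycl κ) (hycl κ')
  · exact fun κ => hpiece (hyc κ) hlen (hycl κ) fun q _ => D.clear_len q.1 q.2

/-- On each of the finitely many closed sets `levelSlab k`, which cover the product with a simplex,
the new cuts lie in the `k`-th entry. -/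
theorem continuous_deform_mixed :
    Continuous fun q : ClassifyingSpace (DiscConf G M X) × I =>
      D.deform (D.isNatural_mixed q.2) q.1 := by
  have key : ∀ n ≠ 0, Continuous fun w :
      ((Fin n → DiscConf G M X) × stdSimplex ℝ (Fin (n + 1))) × I =>
        D.deform (D.isNatural_mixed w.2) (ClassifyingSpace.mk w.1.1 w.1.2) := by
    intro n hn
    refine (locallyFinite_of_finite fun k : Fin n =>
      {w : ((Fin n → DiscConf G M X) × stdSimplex ℝ (Fin (n + 1))) × I |
        w.1 ∈ levelSlab G M X k}).continuous ?_ (fun k => (isClosed_levelSlab k).preimage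
          continuous_fst) fun k w hw => D.continuousWithinAt_deform_mixed k hw
    refine eq_univ_of_forall fun w => ?_
    obtain ⟨k, hk⟩ := mem_iUnion.1 ((iUnion_levelSlab (G := G) (M := M) (X := X) hn).symm ▸
      mem_univ w.1)
    exact mem_iUnion.2 ⟨k, hk⟩
  refine ClassifyingSpace.continuous_of_mk fun n => ?_
  rcases eq_or_ne n 0 with rfl | hn
  · -- the points represented in dimension zero are all equal to a point represented in dimension one
    have h1 : ∀ (c : Fin 0 → DiscConf G M X) (p : stdSimplex ℝ (Fin 1)),
        ClassifyingSpace.mk c p = ClassifyingSpace.mk (fun _ : Fin 1 => (0 : DiscConf G M X))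
          (stdSimplex.vertex 0) := by
      intro c p
      rw [DiscConf.mk_of_len_total_eq_zero, DiscConf.mk_of_len_total_eq_zero]
      · rw [DiscConf.total, ← Fin.succ_last, Fin.partialSum_succ]
        simp [DiscConf.len_zero]
      · rfl
    simp only [h1]
    exact (key 1 one_ne_zero).comp (f := fun w : ((Fin 0 → DiscConf G M X) ×
      stdSimplex ℝ (Fin 1)) × I => (((fun _ : Fin 1 => (0 : DiscConf G M X)),
        (stdSimplex.vertex 0 : stdSimplex ℝ (Fin 2))), w.2))
      (continuous_const.prodMk continuous_snd)
  · exact key n hn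

theorem deform_congr {s : I} {N N' : DiscConf G M X → (ℝ →₀ ℝ) → (ℝ →₀ ℝ)} (h : D.IsNatural s N)
    (h' : D.IsNatural s N') (hN : N = N') : D.deform h = D.deform h' := by
  subst hN
  rfl

theorem deform_mixed_zero :
    D.deform (D.isNatural_mixed (M := M) 0) = D.deform (D.isNatural_openMeasure 1) :=
  D.deform_congr _ _ (by funext c μ; simp)

theorem deform_mixed_one :
    D.deform (D.isNatural_mixed (M := M) 1) = D.deform D.isNatural_sliceMeasure :=
  D.deform_congr _ _ (by funext c μ; simp)

end LabelContraction

/-! ### The slice of a cut collection -/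

section SliceCut

variable {G M X : Type*} [Group G] [Finite G] [TopologicalSpace M] [T2Space M] [MulAction G M]
  [ContinuousConstSMul G M] [TopologicalSpace X] [BasedSpace X] [MulAction G X] [BasedGSpace G X]

theorem LineConf.partialSum_restr (S : LineConf G M X) {n : ℕ} {x : Fin (n + 1) → ℝ}
    (hx : Monotone x) (hS : ∀ i, S.Clean (x i)) (i : Fin (n + 1)) :
    Fin.partialSum (fun l : Fin n => S.restr (x l.castSucc) (x l.succ)) i =
      S.restr (x 0) (x i) := by
  induction i using Fin.induction with
  | zero => rw [Fin.partialSum_zero, LineConf.restr_self]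
  | succ i ih =>
    rw [Fin.partialSum_succ, ih]
    exact S.restr_add (hx (Fin.zero_le _)) (hx Fin.castSucc_lt_succ.le) (hS _)

theorem LineConf.mem_slice_restr {S : LineConf G M X} {a b z : ℝ} (ha : S.Clean a) (hb : S.Clean b)
    (hz : 0 ≤ z) (hz' : a + z ≤ b) {y : M × Susp X} :
    y ∈ ((S.restr a b).slice z).carrier ↔ y.2 ≠ BasedSpace.pt ∧
      ∃ d ∈ S.carrier, |a + z - d.height| ≤ d.radius ∧ y = (d.base, suspLabel (a + z) d) := by
  have hab : a ≤ b := by linarith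
  refine and_congr_right fun _ => ⟨?_, ?_⟩
  · rintro ⟨d, hd, hdz, rfl⟩
    refine ⟨shift a d, ((LineConf.mem_restr hab).1 hd).1, ?_, ?_⟩
    · simp only [shift, LabelledDisc.height, LabelledDisc.radius] at hdz ⊢
      rwa [add_sub_add_left_eq_sub]
    · rw [suspLabel_shift, add_sub_cancel_left]
      rfl
  · rintro ⟨d, hd, hdz, rfl⟩
    have h1 := abs_le.1 hdz
    refine ⟨shift (-a) d, (LineConf.mem_restr hab).2 ⟨?_, ?_, ?_⟩, ?_, ?_⟩
    · rwa [shift_shift, add_neg_cancel, shift_zero]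
    · simp only [shift, LabelledDisc.height, LabelledDisc.radius]
      rcases ha d hd with h2 | h2
      · linarith [h1.2]
      · linarith
    · simp only [shift, LabelledDisc.height, LabelledDisc.radius]
      rcases hb d hd with h2 | h2
      · linarith
      · linarith [h1.1]
    · simp only [shift, LabelledDisc.height, LabelledDisc.radius] at hdz ⊢
      rwa [show z - (-a + d.2.1) = a + z - d.2.1 by ring]
    · rw [suspLabel_shift, sub_neg_eq_add, add_comm z a]
      rfl

/-- The slicing map takes a collection of discs on a line, cut by a measure, to its slice at the
slicing height of the measure. -/
theorem LineConf.mem_sliceMap_cut {S : LineConf G M X} {μ : ℝ →₀ ℝ} (h0 : ∀ x, 0 ≤ μ x)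
    (h1 : μ.sum (fun _ a => a) = 1) (hS : ∀ x ∈ μ.support, S.Clean x) {y : M × Susp X} :
    y ∈ (sliceMap (S.cut μ)).carrier ↔ y.2 ≠ BasedSpace.pt ∧
      ∃ d ∈ S.carrier, |level μ - d.height| ≤ d.radius ∧ y = (d.base, suspLabel (level μ) d) := by
  obtain ⟨n, x, p, hx, hp, hmem, hμ⟩ := exists_strictMono_rep h0 h1
  have hcl : ∀ i, S.Clean (x i) := fun i => hS _ (hmem i)
  set c : Fin n → DiscConf G M X := fun l => S.restr (x l.castSucc) (x l.succ) with hc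
  have hsum := S.partialSum_restr hx.monotone hcl
  have hheight : ∀ i, DiscConf.cutHeight c i = x i - x 0 := fun i => by
    rw [DiscConf.cutHeight, hsum, S.len_restr (hx.monotone (Fin.zero_le i))]
  have hcut := DiscConf.isCutMeasure c p
  have hμ' : μ = (DiscConf.cutMeasure c p).mapDomain (x 0 + ·) := by
    rw [hμ, DiscConf.cutMeasure, Finsupp.mapDomain_finsetSum]
    refine Finset.sum_congr rfl fun i _ => ?_
    rw [Finsupp.mapDomain_single, hheight, add_sub_cancel]
  have hlevel : level μ = x 0 + level (DiscConf.cutMeasure c p) := by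
    rw [hμ', level_mapDomain hcut.nonneg hcut.sum_eq_one]
  have hb := DiscConf.cutHeight_le_level c p
  rw [hheight, hheight, sub_self] at hb
  have hmk : S.cut μ = ClassifyingSpace.mk c p := by
    rw [hμ, hc, S.cut_of_strictMono hx p hp]
  rw [hmk, sliceMap_mk, hlevel, DiscConf.total, hsum]
  exact LineConf.mem_slice_restr (hcl _) (hcl _) hb.1 (by linarith [hb.2])

end SliceCut

/-! ### Slicing a stack -/

namespace LabelContraction

variable {G M X : Type*} [Group G] [Finite G] [TopologicalSpace M] [T2Space M] [MulAction G M]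
  [ContinuousConstSMul G M] [TopologicalSpace X] [BasedSpace X] [MulAction G X] [BasedGSpace G X]
  (D : LabelContraction G X)

/-- The slicing height of the weights of a configuration. -/
noncomputable def cutLevel (ζ : Conf G M (Susp X)) : ℝ := level (D.weights ζ)

theorem continuous_cutLevel : Continuous (D.cutLevel : Conf G M (Susp X) → ℝ) := by
  refine continuous_iff_continuousAt.2 fun ζ₀ => ?_
  obtain ⟨A, hA⟩ := D.eventually_usable ζ₀
  have h1 : ContinuousAt (fun ζ => level (∑ κ : A, Finsupp.single ((κ : ℕ) : ℝ) (D.weight κ ζ)))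
      ζ₀ := by
    refine continuousAt_level (x := fun _ (κ : A) => ((κ : ℕ) : ℝ))
      (p := fun ζ (κ : A) => D.weight κ ζ) continuousAt_const ?_ ?_
    · exact (continuous_pi fun κ : A => D.continuous_weight κ).continuousAt
    · filter_upwards [hA] with ζ hζ using D.weight_mem_stdSimplex hζ.2
  refine h1.congr ?_
  filter_upwards [hA] with ζ hζ
  rw [cutLevel, D.weights_eq hζ.2]

theorem cutLevel_mem (ζ : Conf G M (Susp X)) : 0 ≤ D.cutLevel ζ ∧ D.cutLevel ζ ≤ D.room ζ := by
  obtain ⟨A, hA⟩ := D.eventually_usable ζ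
  have hA := hA.self_of_nhds
  have hw := D.weight_mem_stdSimplex hA.2
  rw [cutLevel, D.weights_eq hA.2]
  refine ⟨le_level (sum_single_nonneg hw) (sum_single_sum hw) fun x hx => ?_,
    level_le (sum_single_nonneg hw) (sum_single_sum hw) fun x hx => ?_⟩
  · obtain ⟨κ, rfl, -⟩ := exists_of_mem_support_sum_single hx
    exact Nat.cast_nonneg _
  · obtain ⟨κ, rfl, -⟩ := exists_of_mem_support_sum_single hx
    exact (hA.1 κ κ.2).le_room

/-- The parameters of the homotopy of labels: a slicing height `T` in a room `L`, and a time. -/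
abbrev SettleParam : Type := {p : ℝ × ℝ × I // 0 ≤ p.1 ∧ p.1 ≤ p.2.1}

instance : LocallyCompactSpace SettleParam :=
  ((isClosed_le continuous_const continuous_fst).inter
    (isClosed_le continuous_fst
      (continuous_fst.comp continuous_snd))).isClosedEmbedding_subtypeVal.locallyCompactSpace

/-- The suspension coordinate after slicing at height `T` the disc placed over a point with
suspension coordinate `t`. -/
noncomputable def restack (p : SettleParam) (t : I) : I :=
  projIcc 0 1 zero_le_one (12 * (p.1.1 + 1 / 24 - (p.1.2.1 + 1) * ramp t))

/-- The suspension coordinate moves on a straight line to its value after slicing the stack. -/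
noncomputable def settleCoord (p : SettleParam) (t : I) : I :=
  ⟨(1 - (p.1.2.2 : ℝ)) * t + p.1.2.2 * restack p t, by
    have h1 := p.1.2.2.2
    have h2 := t.2
    have h3 := (restack p t).2
    constructor
    · exact add_nonneg (mul_nonneg (sub_nonneg.2 h1.2) h2.1) (mul_nonneg h1.1 h3.1)
    · nlinarith [mul_nonneg (sub_nonneg.2 h1.2) (sub_nonneg.2 h2.2),
        mul_nonneg h1.1 (sub_nonneg.2 h3.2)]⟩

theorem settleCoord_zero (p : SettleParam) : settleCoord p 0 = 0 := by
  have h1 : restack p 0 = 0 := by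
    refine projIcc_of_le_left _ ?_
    rw [Icc.coe_zero, ramp_of_le (by norm_num)]
    linarith [p.2.2]
  refine Subtype.ext ?_
  simp [settleCoord, h1]

theorem settleCoord_one (p : SettleParam) : settleCoord p 1 = 1 := by
  have h1 : restack p 1 = 1 := by
    refine projIcc_of_right_le _ ?_
    rw [Icc.coe_one, ramp_of_ge (by norm_num)]
    linarith [p.2.1, p.2.2]
  refine Subtype.ext ?_
  simp [settleCoord, h1]

theorem continuous_settleCoord :
    Continuous fun q : SettleParam × I => settleCoord q.1 q.2 := by
  have h1 : Continuous fun q : SettleParam × I => restack q.1 q.2 := by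
    refine continuous_projIcc.comp (continuous_const.mul ((Continuous.add ?_ continuous_const).sub
      ((Continuous.add ?_ continuous_const).mul (continuous_ramp.comp ?_)))) <;> fun_prop
  have h2 : Continuous fun q : SettleParam × I => (q.1.1.2.2 : ℝ) := by fun_prop
  exact Continuous.subtype_mk (((continuous_const.sub h2).mul
    (continuous_subtype_val.comp continuous_snd)).add
      (h2.mul (continuous_subtype_val.comp h1))) _

/-- The homotopy of the labels in `SX` from the identity to the effect of stacking and slicing. -/
noncomputable def settle (p : SettleParam) : Susp X → Susp X :=
  Quotient.lift (fun a : I × X => Susp.mk (settleCoord p a.1) (D.hom (a.2, p.1.2.2))) (by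
    have key : ∀ a ∈ suspBase X,
        Susp.mk (settleCoord p a.1) (D.hom (a.2, p.1.2.2)) = BasedSpace.pt := by
      rintro ⟨t, x⟩ (h | h | h)
      · exact Susp.mk_eq_pt_iff.2 (Or.inl ((congrArg _ h).trans (settleCoord_zero p)))
      · exact Susp.mk_eq_pt_iff.2 (Or.inr (Or.inl ((congrArg _ h).trans (settleCoord_one p))))
      · refine Susp.mk_eq_pt_iff.2 (Or.inr (Or.inr ?_))
        have h : x = BasedSpace.pt := h
        simp only [h, D.hom_pt]
    rintro a b (rfl | ⟨ha, hb⟩)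
    · rfl
    · exact (key a ha).trans (key b hb).symm)

theorem settle_mk (p : SettleParam) (t : I) (x : X) :
    D.settle p (Susp.mk t x) = Susp.mk (settleCoord p t) (D.hom (x, p.1.2.2)) := rfl

theorem settle_smul (p : SettleParam) (g : G) (z : Susp X) :
    D.settle p (g • z) = g • D.settle p z := by
  rw [← Susp.mk_coord z, Susp.smul_mk, settle_mk, settle_mk, D.hom_smul, Susp.smul_mk]

theorem settle_pt (p : SettleParam) : D.settle p BasedSpace.pt = BasedSpace.pt :=
  (D.settle_mk p 0 BasedSpace.pt).trans
    (Susp.mk_eq_pt_iff.2 (Or.inl (settleCoord_zero p)))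

theorem continuous_settle : Continuous fun q : Susp X × SettleParam => D.settle q.2 q.1 := by
  refine Susp.isQuotientMap_mk.continuous_lift_prod_left ?_
  have h1 : Continuous fun q : (I × X) × SettleParam => settleCoord q.2 q.1.1 :=
    continuous_settleCoord.comp (continuous_snd.prodMk (continuous_fst.comp continuous_fst))
  have h2 : Continuous fun q : (I × X) × SettleParam => D.hom (q.1.2, q.2.1.2.2) :=
    D.continuous_hom.comp (by fun_prop)
  exact Susp.continuous_mk.comp (h1.prodMk h2)

/-- The parameters of a configuration at time `s`. -/
noncomputable def settleParam (ζ : Conf G M (Susp X)) (s : I) : SettleParam :=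
  ⟨(D.cutLevel ζ, D.room ζ, s), D.cutLevel_mem ζ⟩

/-- The homotopy of configurations that is induced by the homotopy of labels. -/
noncomputable def settleConf (q : Conf G M (Susp X) × I) : Conf G M (Susp X) :=
  q.1.relabel (D.settle (D.settleParam q.1 q.2)) (D.settle_smul _)

theorem continuous_settleConf :
    Continuous (D.settleConf : Conf G M (Susp X) × I → Conf G M (Susp X)) := by
  have h1 : Continuous fun q : Conf G M (Susp X) × I => (q.1, D.settleParam q.1 q.2) := by
    refine continuous_fst.prodMk (Continuous.subtype_mk ?_ _)
    exact (D.continuous_cutLevel.comp continuous_fst).prodMk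
      ((D.continuous_room.comp continuous_fst).prodMk continuous_snd)
  exact (Conf.continuous_relabel (M := M) D.settle_smul D.settle_pt D.continuous_settle).comp h1

theorem settleConf_zero (ζ : Conf G M (Susp X)) : D.settleConf (ζ, 0) = ζ := by
  have h1 : ∀ z : Susp X, D.settle (D.settleParam ζ 0) z = z := by
    intro z
    rw [← Susp.mk_coord z, settle_mk]
    have h2 : settleCoord (D.settleParam ζ 0) z.coord.1 = z.coord.1 :=
      Subtype.ext (by simp [settleCoord, settleParam])
    rw [h2]
    exact congrArg _ (D.hom_zero _)
  refine Conf.ext (Set.ext fun y => ⟨?_, fun hy => ?_⟩)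
  · rintro ⟨-, z, hz, h2⟩
    rw [h1] at h2
    rw [← h2] at hz
    exact hz
  · exact ⟨ζ.label_ne y hy, y.2, hy, (h1 _).symm⟩

theorem settleConf_one (ζ : Conf G M (Susp X)) : D.settleConf (ζ, 1) = sliceMap (D.unslice ζ) := by
  obtain ⟨A, hA⟩ := D.eventually_usable ζ
  have hA := hA.self_of_nhds
  have hw := D.weight_mem_stdSimplex hA.2
  have hslice := fun y : M × Susp X => LineConf.mem_sliceMap_cut (S := D.stack ζ)
    (μ := D.weights ζ) (y := y)
    (by rw [D.weights_eq hA.2]; exact sum_single_nonneg hw)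
    (by rw [D.weights_eq hA.2]; exact sum_single_sum hw)
    (by
      rw [D.weights_eq hA.2]
      intro x hx
      obtain ⟨κ, rfl, -⟩ := exists_of_mem_support_sum_single hx
      exact D.clean_stack (hA.1 κ κ.2))
  have hlabel : ∀ p : M × Susp X, D.settle (D.settleParam ζ 1) p.2 =
      suspLabel (D.cutLevel ζ) (D.place (D.room ζ) p) := by
    intro p
    conv_lhs => rw [← Susp.mk_coord p.2]
    rw [settle_mk, suspLabel]
    congr 1
    refine Subtype.ext ?_
    simp only [settleCoord, settleParam, restack, place, Icc.coe_one, sub_self, zero_mul, zero_add,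
      one_mul]
    congr 2
    ring
  refine Conf.ext (Set.ext fun y => ?_)
  refine Iff.trans (and_congr_right fun hy => ⟨?_, ?_⟩) (hslice y).symm
  · rintro ⟨z, hz, h1⟩
    have h2 := hlabel (y.1, z)
    rw [← h1] at h2
    have h3 : suspLabel (D.cutLevel ζ) (D.place (D.room ζ) (y.1, z)) ≠ BasedSpace.pt := h2 ▸ hy
    refine ⟨D.place (D.room ζ) (y.1, z), ⟨fun h => h3 ?_, _, hz, rfl⟩, ?_, Prod.ext rfl h2⟩
    · exact Susp.mk_eq_pt_iff.2 (Or.inr (Or.inr h))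
    · -- outside of the disc, the suspension coordinate is an end of the interval
      by_contra hcon
      refine h3 (Susp.mk_eq_pt_iff.2 ?_)
      have h4 : (D.place (D.room ζ) (y.1, z)).radius = 1 / 24 := rfl
      rcases lt_abs.1 (not_le.1 hcon) with h5 | h5
      · refine Or.inr (Or.inl (projIcc_of_right_le _ ?_))
        rw [h4] at h5 ⊢
        rw [le_div_iff₀ (by norm_num)]
        change _ < D.cutLevel ζ - _ at h5
        linarith
      · refine Or.inl (projIcc_of_le_left _ ?_)
        rw [h4] at h5 ⊢
        refine div_nonpos_of_nonpos_of_nonneg ?_ (by norm_num)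
        change _ < -(D.cutLevel ζ - _) at h5
        linarith
  · rintro ⟨_, ⟨-, p, hp, rfl⟩, -, rfl⟩
    exact ⟨p.2, hp, (hlabel p).symm⟩

end LabelContraction

end EquivConf

open EquivConf
theorem theorem3 {G : Type*} [Group G] [Finite G]
    {m : ℕ} {M : Type*} [TopologicalSpace M] [ChartedSpace (EuclideanSpace ℝ (Fin m)) M]
    [IsManifold (𝓡 m) ∞ M] [T2Space M] [SecondCountableTopology M]
    [MulAction G M] (hM : ∀ g : G, ContMDiff (𝓡 m) (𝓡 m) ∞ (fun y : M => g • y))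
    {X : Type*} [TopologicalSpace X] [BasedSpace X] [MulAction G X] [BasedGSpace G X]
    (hX : NondegenerateBasepoint G X) :
    ∃ q : ContinuousMap.HomotopyEquiv (ClassifyingSpace (DiscConf G M X)) (Conf G M (Susp X)),
      IsThickSliceMap q.toFun := by
  have : ContinuousConstSMul G M := ⟨fun g => (hM g).continuous⟩
  obtain ⟨D⟩ := hX.exists_labelContraction
  let f : C(ClassifyingSpace (DiscConf G M X), Conf G M (Susp X)) := ⟨sliceMap, continuous_sliceMap⟩
  let j : C(Conf G M (Susp X), ClassifyingSpace (DiscConf G M X)) := ⟨D.unslice, D.continuous_unslice⟩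
  let opened : C(ClassifyingSpace (DiscConf G M X), ClassifyingSpace (DiscConf G M X)) :=
    ⟨D.deform (D.isNatural_openMeasure 1),
      D.continuous_deform_openMeasure.comp (f := fun b => (b, (1 : I)))
        (continuous_id.prodMk continuous_const)⟩
  have h1 : (ContinuousMap.id _).Homotopic opened := ⟨{
    toFun := fun q => D.deform (D.isNatural_openMeasure q.1) q.2
    continuous_toFun := D.continuous_deform_openMeasure.comp (f := Prod.swap) continuous_swap
    map_zero_left := D.deform_openMeasure_zero
    map_one_left := fun _ => rfl }⟩
  have h2 : opened.Homotopic (j.comp f) := ⟨{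
    toFun := fun q => D.deform (D.isNatural_mixed q.1) q.2
    continuous_toFun := D.continuous_deform_mixed.comp (f := Prod.swap) continuous_swap
    map_zero_left := fun b => congrFun D.deform_mixed_zero b
    map_one_left := fun b => (congrFun D.deform_mixed_one b).trans (D.deform_sliceMeasure b) }⟩
  have h3 : (ContinuousMap.id _).Homotopic (f.comp j) := ⟨{
    toFun := fun q => D.settleConf (q.2, q.1)
    continuous_toFun := D.continuous_settleConf.comp (f := Prod.swap) continuous_swap
    map_zero_left := D.settleConf_zero
    map_one_left := D.settleConf_one }⟩
  exact ⟨⟨f, j, (h1.trans h2).symm, h3.symm⟩, isThickSliceMap_sliceMap⟩
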